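/- Write $\mathbb N_*=\{1,2,\dots\}$ and $\overline{\mathbb N}_*=\mathbb N_*\cup\{\infty\}$. Let $0<\alpha_1<\alpha_2<\cdots<1$ with $\alpha_k\to1$. On a probability space $(\Omega,\mathbb P)$ let the following be independent: (i) for each $k\ge1$ and $v\in\mathbb N_*^{k-1}$, the decreasingly ordered marks $\gamma_k(v1)>\gamma_k(v2)>\cdots>0$ of a Poisson point process on $(0,\infty)$ with intensity $\mu_k(dt)=c_k t^{-1-\alpha_k}\,dt$, where $c_k=\alpha_k/\Gamma(1-\alpha_k/\alpha_{k+1})$; (ii) for $k,x\in\mathbb N_*$, Poisson processes $N^{k,x}$ of rate $1$ on $(0,\infty)$ with marks $\sigma^{k,x}_1<\sigma^{k,x}_2<\cdots$; (iii) for $k,x,i\in\mathbb N_*$, exponential random variables $T^{k,x}_i$ of mean $1$. Let $X_0\equiv\emptyset$ and define recursively, for $k\ge1$ and $t\ge0$, the clock $$\Xi_k(t)=\sum_{x\in\mathbb N_*}\sum_{i=1}^{N^{k,x}(t)}\gamma_k\big(X_{k-1}(\sigma^{k,x}_i)x\big)\,T^{k,x}_i ,$$ its generalized inverse $\Xi_k^{-1}(t)=\inf\{r\ge0:\Xi_k(r)>t\}$,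 and the $\overline{\mathbb N}_*^k$-valued process $X_k(t)=(X_{k-1}(\Xi_k^{-1}(t)),x)$ if $t\in\bigcup_{i\ge1}[\Xi_k(\sigma^{k,x}_i-),\Xi_k(\sigma^{k,x}_i))$ for some $x\in\mathbb N_*$, and $X_k(t)=(X_{k-1}(\Xi_k^{-1}(t)),\infty)$ otherwise. (Almost surely $X_{k-1}(\sigma_i^{k,x})\in\mathbb N_*^{k-1}$ for all $i,x$.) For $1\le k\le n$ let $\theta_k^n=\Xi_n\circ\Xi_{n-1}\circ\cdots\circ\Xi_k$. For $v\in\mathbb N_*^k$ put $\overline\gamma_k(v)=\prod_{j=1}^k\gamma_j(v_1\cdots v_j)$ and let $$W(v)=\lim_{n\to\infty}\ \sum_{y\in\mathbb N_*^n,\ (y_1,\dots,y_k)=v}\Big(\frac{\overline\gamma_n(y)}{\overline\gamma_k(v)}\Big)^{\alpha_{n+1}},$$ a limit that exists almost surely. Let $\widetilde\Xi_n$ be defined as $\Xi_n$ with $\gamma_n(\cdot)$ replaced by $W(\cdot)\gamma_n(\cdot)$, and let $\widetilde\theta_k^n=\widetilde\Xi_n\circ\Xi_{n-1}\circ\cdots\circ\Xi_k$.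 Let $D_k$ be any countable dense subset of $[0,\infty)$; define the limiting clock by $\theta_k^\infty(t)=\lim_{n\to\infty}\widetilde\theta_k^n(t)$ (which exists almost surely) for $t\in D_k$, and $\theta_k^\infty(t)=\lim_{s\downarrow t,\ s\in D_k}\theta_k^\infty(s)$ for $t\notin D_k$. **Proposition (finite dimensional convergence).** If $\sum_{k\ge1}(1-\alpha_k)<\infty$, then for every fixed $t>0$ and every $k\in\mathbb N_*$ the random variables $\theta_k^n(t)$ $(n\ge k)$ and $\theta_k^\infty(t)$ are almost surely finite, and $\theta_k^n(t)$ converges in probability to $\theta_k^\infty(t)$ as $n\to\infty$. -/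

import Mathlib

open MeasureTheory ProbabilityTheory Filter Topology Set
open scoped ENNReal NNReal

noncomputable section

namespace KTree

/-! ### Poisson point processes -/

/-- The number of points of the family `p` (counted with multiplicity) lying in `A`. -/
def pointCount {Ω ι : Type*} (p : ι → Ω → ℝ) (A : Set ℝ) (ω : Ω) : ℕ∞ :=
  {i : ι | p i ω ∈ A}.encard

/-- The random points `p i`, `i : ι`, are the marks of a Poisson point process on the line with
intensity measure `μ`: the number of points in a measurable set `A` has the Poisson law of mean
`μ A` (it is a.s. infinite if `μ A = ∞`), and the numbers of points in finitely many pairwise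
disjoint measurable sets are independent. -/
structure IsPoissonPointProcess {Ω ι : Type*} [MeasurableSpace Ω] (P : Measure Ω)
    (p : ι → Ω → ℝ) (μ : Measure ℝ) : Prop where
  count_law : ∀ A : Set ℝ, MeasurableSet A → μ A ≠ ∞ →
    ∀ n : ℕ, P {ω | pointCount p A ω = n} = poissonMeasure (μ A).toNNReal {n}
  count_top : ∀ A : Set ℝ, MeasurableSet A → μ A = ∞ → ∀ᵐ ω ∂P, pointCount p A ω = ⊤
  count_indep : ∀ (m : ℕ) (A : Fin m → Set ℝ), (∀ i, MeasurableSet (A i)) →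
    Pairwise (fun i j => Disjoint (A i) (A j)) → iIndepFun (fun i => pointCount p (A i)) P

/-! ### Parameters -/

/-- The parameters `0 < α₁ < α₂ < … < 1` with `α_k → 1`; the value `α 0` is not used. -/
structure IsParameter (α : ℕ → ℝ) : Prop where
  pos : ∀ k, 1 ≤ k → 0 < α k
  strictMono : ∀ k, 1 ≤ k → α k < α (k + 1)
  lt_one : ∀ k, 1 ≤ k → α k < 1
  tendsto : Tendsto α atTop (𝓝 1)

/-- The constant `c_k = α_k / Γ(1 - α_k / α_{k+1})`. -/
def intensityConst (α : ℕ → ℝ) (k : ℕ) : ℝ :=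
  α k / Real.Gamma (1 - α k / α (k + 1))

/-- The intensity measure `μ_k(dt) = c_k t^{-(1 + α_k)} dt` on `(0, ∞)`. -/
def intensity (α : ℕ → ℝ) (k : ℕ) : Measure ℝ :=
  (volume.restrict (Ioi 0)).withDensity
    fun t => ENNReal.ofReal (intensityConst α k / t ^ (1 + α k))

/-! ### The input of the construction -/

/-- One realization of the random input. Nodes of the tree at depth `k` are the elements of
`Fin k → ℕ+`. Levels are `k = 1, 2, …`; the values at level `0` are not used. -/
structure Input where
  /-- `γ k v` is the mark `γ_k(v)` of the node `v` at depth `k`. -/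
  γ : (k : ℕ) → (Fin k → ℕ+) → ℝ
  /-- `σ k x i` is the `i`-th mark of the Poisson process `N^{k,x}`. -/
  σ : ℕ → ℕ+ → ℕ+ → ℝ
  /-- `T k x i` is the exponential variable `T_i^{k,x}`. -/
  T : ℕ → ℕ+ → ℕ+ → ℝ

/-- The law of the random input: for each node `v` at depth `k`, the marks
`γ_{k+1}(v1) > γ_{k+1}(v2) > … > 0` of the offspring of `v` are the ordered marks of a Poisson
point process with intensity `μ_{k+1}`; the `σ^{k,x}_1 < σ^{k,x}_2 < …` are the ordered marks of a
Poisson process of rate `1` on `(0, ∞)`; the `T_i^{k,x}` are exponential of mean `1`; and all these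
point processes and random variables are independent. -/
structure IsRandomInput {Ω : Type*} [MeasurableSpace Ω] (P : Measure Ω) (α : ℕ → ℝ)
    (R : Ω → Input) : Prop where
  measurable_γ : ∀ k v, Measurable fun ω => (R ω).γ k v
  measurable_σ : ∀ k x i, Measurable fun ω => (R ω).σ k x i
  measurable_T : ∀ k x i, Measurable fun ω => (R ω).T k x i
  γ_ordered : ∀ (k : ℕ) (v : Fin k → ℕ+), ∀ᵐ ω ∂P,
    (StrictAnti fun x : ℕ+ => (R ω).γ (k + 1) (Fin.snoc v x)) ∧
      ∀ x : ℕ+, 0 < (R ω).γ (k + 1) (Fin.snoc v x)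
  γ_poisson : ∀ (k : ℕ) (v : Fin k → ℕ+),
    IsPoissonPointProcess P (fun (x : ℕ+) ω => (R ω).γ (k + 1) (Fin.snoc v x))
      (intensity α (k + 1))
  σ_ordered : ∀ (k : ℕ) (x : ℕ+), ∀ᵐ ω ∂P,
    StrictMono ((R ω).σ (k + 1) x) ∧ ∀ i, 0 < (R ω).σ (k + 1) x i
  σ_poisson : ∀ (k : ℕ) (x : ℕ+),
    IsPoissonPointProcess P (fun (i : ℕ+) ω => (R ω).σ (k + 1) x i) (volume.restrict (Ioi 0))
  T_law : ∀ (k : ℕ) (x i : ℕ+), P.map (fun ω => (R ω).T (k + 1) x i) = expMeasure 1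
  indep : iIndep
    (Sum.elim
      (fun p : (k : ℕ) × (Fin k → ℕ+) =>
        MeasurableSpace.comap
          (fun ω (x : ℕ+) => (R ω).γ (p.1 + 1) (Fin.snoc p.2 x)) inferInstance)
      (Sum.elim
        (fun p : ℕ × ℕ+ =>
          MeasurableSpace.comap (fun ω (i : ℕ+) => (R ω).σ (p.1 + 1) p.2 i) inferInstance)
        (fun p : ℕ × ℕ+ × ℕ+ =>
          MeasurableSpace.comap (fun ω => (R ω).T (p.1 + 1) p.2.1 p.2.2) inferInstance))) P

/-! ### Clocks and finite level K processes

Everything below is defined for a single realization of the input. Time takes values in `[0, ∞]`,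
so that sums and compositions are always defined. -/

/-- Extension by `0` of a function on `ℕ+ ^ k` to `(ℕ+ ∪ {∞}) ^ k`. (Almost surely the process is
never evaluated at a mark where it has an infinite coordinate.) -/
def extendZero {k : ℕ} (f : (Fin k → ℕ+) → ℝ≥0∞) (s : Fin k → WithTop ℕ+) : ℝ≥0∞ :=
  open Classical in if ∀ i, s i ≠ ⊤ then f (fun i => (s i).untopD 1) else 0

/-- The sum over `x` and over the marks `σ_i^{k+1,x} ≤ t` of `w(Y(σ_i^{k+1,x}) x) T_i^{k+1,x}`,
where `Y` is a process with values in the nodes at depth `k` and `w` gives a weight to the nodes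
at depth `k + 1`. -/
def clockSum (R : Input) {k : ℕ} (Y : ℝ≥0∞ → (Fin k → WithTop ℕ+))
    (w : (Fin (k + 1) → ℕ+) → ℝ≥0∞) (t : ℝ≥0∞) : ℝ≥0∞ :=
  open Classical in
  ∑' (x : ℕ+) (i : ℕ+),
    if ENNReal.ofReal (R.σ (k + 1) x i) ≤ t then
      extendZero (fun v => w (Fin.snoc v x)) (Y (ENNReal.ofReal (R.σ (k + 1) x i))) *
        ENNReal.ofReal (R.T (k + 1) x i)
    else 0

/-- The generalized inverse `t ↦ inf {r ≥ 0 : f r > t}`. -/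
def genInv (f : ℝ≥0∞ → ℝ≥0∞) (t : ℝ≥0∞) : ℝ≥0∞ :=
  sInf {r | t < f r}

/-- `t` belongs to one of the intervals `[f(σ_i^{k,x} -), f(σ_i^{k,x}))`, `i ≥ 1`. -/
def InInterval (R : Input) (k : ℕ) (f : ℝ≥0∞ → ℝ≥0∞) (t : ℝ≥0∞) (x : ℕ+) : Prop :=
  ∃ i : ℕ+, Function.leftLim f (ENNReal.ofReal (R.σ k x i)) ≤ t ∧
    t < f (ENNReal.ofReal (R.σ k x i))

/-- The `x` such that `t ∈ ⋃ i, [f(σ_i^{k,x} -), f(σ_i^{k,x}))`, and `∞` if there is none.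
(Almost surely there is at most one such `x`; otherwise the least one is taken.) -/
def lastCoord (R : Input) (k : ℕ) (f : ℝ≥0∞ → ℝ≥0∞) (t : ℝ≥0∞) : WithTop ℕ+ :=
  open Classical in
  if h : ∃ x, InInterval R k f t x then ((PNat.find h : ℕ+) : WithTop ℕ+) else ⊤

/-- The `k` level K process `X_k`. -/
def X (R : Input) : (k : ℕ) → ℝ≥0∞ → (Fin k → WithTop ℕ+)
  | 0 => fun _ => Fin.elim0
  | k + 1 => fun t =>
      Fin.snoc
        (X R k (genInv (clockSum R (X R k) fun v => ENNReal.ofReal (R.γ (k + 1) v)) t))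
        (lastCoord R (k + 1) (clockSum R (X R k) fun v => ENNReal.ofReal (R.γ (k + 1) v)) t)

/-- The clock process `Ξ_k`, `k ≥ 1` (the identity for `k = 0`, by convention). -/
def Xi (R : Input) : ℕ → ℝ≥0∞ → ℝ≥0∞
  | 0 => id
  | k + 1 => clockSum R (X R k) fun v => ENNReal.ofReal (R.γ (k + 1) v)

/-- The clock composition `θ_k^n = Ξ_n ∘ ⋯ ∘ Ξ_k` for `n ≥ k ≥ 1`; the empty composition, i.e. the
identity, for `n < k`. -/
def theta (R : Input) (k : ℕ) : ℕ → ℝ≥0∞ → ℝ≥0∞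
  | 0 => id
  | n + 1 => if k ≤ n + 1 then Xi R (n + 1) ∘ theta R k n else id

/-! ### Limiting clocks -/

/-- The product `γ̄_k(v) = ∏_{j=1}^k γ_j(v|_j)`. -/
def gammaBar (R : Input) {k : ℕ} (v : Fin k → ℕ+) : ℝ :=
  ∏ j : Fin k, R.γ (j + 1) (Fin.take (j + 1) (Nat.succ_le_of_lt j.isLt) v)

/-- `W(v) = lim_n ∑_y (γ̄_n(y) / γ̄_k(v)) ^ α_{n+1}`, the sum being over the nodes `y` at depth
`n = k + m` with `y|_k = v`. The limit exists almost surely; it is written as an upper limit, which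
is defined everywhere. -/
def W (α : ℕ → ℝ) (R : Input) {k : ℕ} (v : Fin k → ℕ+) : ℝ≥0∞ :=
  limsup (fun m : ℕ =>
    ∑' y : {y : Fin (k + m) → ℕ+ // Fin.take k (Nat.le_add_right k m) y = v},
      ENNReal.ofReal ((gammaBar R y.1 / gammaBar R v) ^ α (k + m + 1))) atTop

/-- The adjusted clock `Ξ̃_k`, `k ≥ 1`, in which `γ_k(v)` is replaced by `W(v) γ_k(v)` (the identity
for `k = 0`, by convention). -/
def XiTilde (α : ℕ → ℝ) (R : Input) : ℕ → ℝ≥0∞ → ℝ≥0∞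
  | 0 => id
  | k + 1 => clockSum R (X R k) fun v => W α R v * ENNReal.ofReal (R.γ (k + 1) v)

/-- `θ̃_k^n = Ξ̃_n ∘ Ξ_{n-1} ∘ ⋯ ∘ Ξ_k` for `n ≥ k ≥ 1`. -/
def thetaTilde (α : ℕ → ℝ) (R : Input) (k n : ℕ) (t : ℝ≥0∞) : ℝ≥0∞ :=
  XiTilde α R n (theta R k (n - 1) t)

/-- The limit `lim_n θ̃_k^n(t)`, which exists almost surely for each fixed `t`; it is written as an
upper limit, which is defined everywhere. -/
def thetaLim (α : ℕ → ℝ) (R : Input) (k : ℕ) (t : ℝ≥0∞) : ℝ≥0∞ :=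
  limsup (fun n : ℕ => thetaTilde α R k n t) atTop

/-- The limiting clock `θ_k^∞` built from a countable dense set `D` of times: it is
`lim_n θ̃_k^n(t)` at the times `t ∈ D`, and at the other times it is the limit of these values along
`s ∈ D`, `s ↓ t`. As `θ̃_k^n` is nondecreasing in time, the latter is an infimum. -/
def thetaInf (α : ℕ → ℝ) (R : Input) (D : Set ℝ≥0) (k : ℕ) (t : ℝ≥0) : ℝ≥0∞ :=
  open Classical in
  if t ∈ D then thetaLim α R k t else ⨅ s : {s : ℝ≥0 // s ∈ D ∧ t < s}, thetaLim α R k s.1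

end KTree

end

/-! Everything is read off Laplace transforms `E e^{-cZ}` of variables in `[0, ∞]`. Freeze all the
input except the Poisson processes and exponential variables of level `k + 1`. A window of a clock
with weights `w` then has transform `exp (-∑_v L_v ∑_x psi (w (vx)))`, where `L_v` is the time that
`X_k` spends at `v` and `psi c = c / (1 + c)` (`lintegral_expNeg_windowSum`). Three consequences
carry the proof.

Convergence of the adjusted clocks. The time spent by `X_{n+1}` at a node is a sum of jumps of
`Ξ_{n+1}`, so `∑_v L_v W(v)` at depth `n + 1` is the adjusted window of the level before
(`tsum_occupation_mul`). Since `psi c ≤ c` and `∑_x W(vx) γ(vx) ≤ W(v)`, the exponentials `e^{-θ̃}`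
form a bounded submartingale with respect to a filtration that contains all the marks `γ` from the
start (`lintegral_expNeg_adjustedWindow_mono`). Hence the adjusted clocks converge a.s.

Their law given the past. The constants `c_k` make `W(v)` stable: `E e^{-xW(v)} = exp
(-x^{α_{k+1}})` at depth `k` (`laplace_subtreeLimit`). With `e^{-L psi c} = E e^{-cG_L}`, where
`G_L` is compound Poisson of rate `L` with exponential jumps, averaging over `W` and `γ` yields `exp
(-l^{α_{k+1}} ∑_v E[G_{L_v}^{α_{k+1}}])` for the adjusted window
(`lintegral_expNeg_adjustedWindow`). Interpolation gives `E[G_L^a] ≤ L`, and for bounded `L` also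
`E[G_L^a] ≥ κ L` with `κ` close to `1` when `a` is. The first bound, propagated along the
submartingale, makes the limit finite and right-continuous at a fixed time.

Comparison with the plain clocks. Let `s` be the plain composition and `u` the adjusted window over
`(0, s]`. The first bound at `l = 1` gives `E[e^{-s} e^{-u}] ≥ E[e^{-2s}]`; the second at `l = 2`
gives `E[e^{-2u}] ≤ E[e^{-2s}] + ε` for late levels. Expanding the square, `E[(e^{-u} - e^{-s})^2] ≤
ε` (`eventually_lintegral_sq_le`). As `u` converges a.s. to a finite limit, `s` converges to it in
probability. -/

noncomputable section

namespace KTree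

/-! ### The function `x ↦ e^{-x}` on `[0, ∞]` -/

/-- The function `x ↦ e^{-x}` on `[0, ∞]`. -/
def expNeg (x : ℝ≥0∞) : ℝ≥0∞ := EReal.exp (-(x : EReal))

/-- The function `p ↦ - log p`, truncated at `0`. -/
def negLog (p : ℝ≥0∞) : ℝ≥0∞ := (-(ENNReal.log p)).toENNReal

/-- The exponent `c ↦ 1 - 1 / (1 + c)` of exponential jumps. -/
def psi (c : ℝ≥0∞) : ℝ≥0∞ := 1 - (1 + c)⁻¹

@[simp] lemma expNeg_zero : expNeg 0 = 1 := by simp [expNeg]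

@[simp] lemma expNeg_top : expNeg ∞ = 0 := by simp [expNeg]

lemma expNeg_ofReal {x : ℝ} (hx : 0 ≤ x) :
    expNeg (ENNReal.ofReal x) = ENNReal.ofReal (Real.exp (-x)) := by
  rw [expNeg, EReal.coe_ennreal_ofReal, max_eq_left hx, ← EReal.coe_neg, EReal.exp_coe]

lemma expNeg_eq_ofReal {x : ℝ≥0∞} (hx : x ≠ ∞) :
    expNeg x = ENNReal.ofReal (Real.exp (-x.toReal)) := by
  rw [← expNeg_ofReal ENNReal.toReal_nonneg, ENNReal.ofReal_toReal hx]

lemma expNeg_antitone : Antitone expNeg := fun x y h => by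
  simpa [expNeg] using h

lemma expNeg_injective : Function.Injective expNeg := fun x y h => by
  have := EReal.exp_strictMono.injective h
  simpa using this

lemma expNeg_le_one (x : ℝ≥0∞) : expNeg x ≤ 1 := by
  simpa using expNeg_antitone (zero_le (a := x))

lemma expNeg_ne_top (x : ℝ≥0∞) : expNeg x ≠ ∞ := ((expNeg_le_one x).trans_lt ENNReal.one_lt_top).ne

lemma expNeg_eq_one_iff {x : ℝ≥0∞} : expNeg x = 1 ↔ x = 0 := by
  rw [← expNeg_zero, expNeg_injective.eq_iff]

lemma expNeg_add (x y : ℝ≥0∞) : expNeg (x + y) = expNeg x * expNeg y := by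
  by_cases hx : x = ∞
  · simp [hx]
  by_cases hy : y = ∞
  · simp [hy]
  rw [expNeg_eq_ofReal hx, expNeg_eq_ofReal hy, expNeg_eq_ofReal (ENNReal.add_ne_top.2 ⟨hx, hy⟩),
    ← ENNReal.ofReal_mul (Real.exp_pos _).le, ← Real.exp_add, ENNReal.toReal_add hx hy, neg_add]

lemma expNeg_sum {ι : Type*} (s : Finset ι) (f : ι → ℝ≥0∞) :
    expNeg (∑ i ∈ s, f i) = ∏ i ∈ s, expNeg (f i) := by
  classical
  induction s using Finset.induction_on with
  | empty => simp
  | insert a s ha ih => rw [Finset.sum_insert ha, Finset.prod_insert ha, expNeg_add, ih]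

lemma continuous_expNeg : Continuous expNeg :=
  ENNReal.continuous_exp.comp (continuous_neg.comp continuous_coe_ennreal_ereal)

lemma measurable_expNeg : Measurable expNeg := continuous_expNeg.measurable

/-- Compactness of `[0, ∞]`. Convergence in `[0, ∞]`, including convergence to `∞`, can thus be
tested after applying `expNeg`. -/
lemma isClosedEmbedding_expNeg : IsClosedEmbedding expNeg :=
  continuous_expNeg.isClosedEmbedding expNeg_injective

lemma tendsto_expNeg_iff {ι : Type*} {l : Filter ι} {f : ι → ℝ≥0∞} {a : ℝ≥0∞} :
    Tendsto (fun i => expNeg (f i)) l (𝓝 (expNeg a)) ↔ Tendsto f l (𝓝 a) :=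
  (isClosedEmbedding_expNeg.isInducing.tendsto_nhds_iff).symm

/-- Any Laplace factor `p ≤ 1` becomes an exponential, so that infinite products of independent
factors can be handled as sums in `[0, ∞]`. -/
lemma expNeg_negLog {p : ℝ≥0∞} (hp : p ≤ 1) : expNeg (negLog p) = p := by
  have h : 0 ≤ -(ENNReal.log p) := by
    rw [EReal.neg_nonneg]
    exact ENNReal.log_le_zero_iff.2 hp
  rw [expNeg, negLog, EReal.coe_toENNReal h, neg_neg, ENNReal.exp_log]

lemma one_sub_expNeg_le (x : ℝ≥0∞) : 1 - expNeg x ≤ x := by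
  by_cases hx : x = ∞
  · simp [hx]
  rw [expNeg_eq_ofReal hx, ← ENNReal.ofReal_one, ← ENNReal.ofReal_sub _ (Real.exp_pos _).le]
  apply ENNReal.ofReal_le_of_le_toReal
  linarith [Real.add_one_le_exp (-x.toReal)]

/-- This inequality is what makes the adjusted clocks a submartingale after exponentiation. -/
lemma psi_le (c : ℝ≥0∞) : psi c ≤ c := by
  by_cases hc : c = ∞
  · simp [hc]
  rw [psi, tsub_le_iff_right]
  have h1 : (1 + c) * (1 + c)⁻¹ = 1 :=
    ENNReal.mul_inv_cancel (by simp) (by simp [hc])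
  calc (1 : ℝ≥0∞) = (1 + c) * (1 + c)⁻¹ := h1.symm
    _ = (1 + c)⁻¹ + c * (1 + c)⁻¹ := by rw [add_mul, one_mul]
    _ ≤ (1 + c)⁻¹ + c * 1 := by
        gcongr
        exact ENNReal.inv_le_one.2 (by simp)
    _ = c + (1 + c)⁻¹ := by rw [mul_one, add_comm]

lemma psi_le_one (c : ℝ≥0∞) : psi c ≤ 1 := tsub_le_self

@[simp] lemma psi_zero : psi 0 = 0 := by simp [psi]

lemma measurable_psi : Measurable psi := by unfold psi; fun_prop

lemma psi_ofReal {x : ℝ} (hx : 0 ≤ x) :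
    psi (ENNReal.ofReal x) = ENNReal.ofReal (x / (1 + x)) := by
  rw [psi, ← ENNReal.ofReal_one, ← ENNReal.ofReal_add zero_le_one hx,
    ← ENNReal.ofReal_inv_of_pos (by positivity), ← ENNReal.ofReal_sub _ (by positivity)]
  congr 1
  field_simp
  ring

/-! ### Laplace transforms of random variables in `[0, ∞]` -/

section Laplace

variable {Ω : Type*} [MeasurableSpace Ω] {P : Measure Ω} [IsProbabilityMeasure P]

lemma lintegral_expNeg_le_one (f : Ω → ℝ≥0∞) : ∫⁻ ω, expNeg (f ω) ∂P ≤ 1 := by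
  calc ∫⁻ ω, expNeg (f ω) ∂P ≤ ∫⁻ _, 1 ∂P := lintegral_mono fun _ => expNeg_le_one _
    _ = 1 := by simp

lemma tendsto_lintegral_mul_expNeg {g : Ω → ℝ≥0∞} (hg : Measurable g) (hg1 : ∀ ω, g ω ≤ 1)
    {f : ℕ → Ω → ℝ≥0∞} {f' : Ω → ℝ≥0∞}
    (hf : ∀ n, Measurable (f n)) (h : ∀ᵐ ω ∂P, Tendsto (fun n => f n ω) atTop (𝓝 (f' ω))) :
    Tendsto (fun n => ∫⁻ ω, g ω * expNeg (f n ω) ∂P) atTop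
      (𝓝 (∫⁻ ω, g ω * expNeg (f' ω) ∂P)) := by
  refine tendsto_lintegral_of_dominated_convergence (fun _ => 1)
    (fun n => hg.mul (measurable_expNeg.comp (hf n)))
    (fun n => Eventually.of_forall fun ω => mul_le_one' (hg1 ω) (expNeg_le_one _)) (by simp) ?_
  filter_upwards [h] with ω hω
  exact ENNReal.Tendsto.const_mul ((continuous_expNeg.tendsto _).comp hω)
    (Or.inr ((hg1 ω).trans_lt ENNReal.one_lt_top).ne)

lemma tendsto_lintegral_expNeg {f : ℕ → Ω → ℝ≥0∞} {f' : Ω → ℝ≥0∞}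
    (hf : ∀ n, Measurable (f n)) (h : ∀ᵐ ω ∂P, Tendsto (fun n => f n ω) atTop (𝓝 (f' ω))) :
    Tendsto (fun n => ∫⁻ ω, expNeg (f n ω) ∂P) atTop (𝓝 (∫⁻ ω, expNeg (f' ω) ∂P)) := by
  simpa using tendsto_lintegral_mul_expNeg (P := P) (g := fun _ => 1) measurable_const
    (fun _ => le_rfl) hf h

lemma tendsto_inv_natCast_add_one :
    Tendsto (fun j : ℕ => ((j : ℝ≥0∞) + 1)⁻¹) atTop (𝓝 0) := by
  have h := (tendsto_add_atTop_iff_nat 1).2 ENNReal.tendsto_inv_nat_nhds_zero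
  simpa using h

/-- A random variable in `[0, ∞]` is a.s. finite if its Laplace transform tends to `1` at `0`. -/
lemma ae_lt_top_of_laplace {f : Ω → ℝ≥0∞} (hf : Measurable f) {b : ℕ → ℝ≥0∞}
    (hb : Tendsto b atTop (𝓝 1))
    (h : ∀ j : ℕ, b j ≤ ∫⁻ ω, expNeg (((j : ℝ≥0∞) + 1)⁻¹ * f ω) ∂P) :
    ∀ᵐ ω ∂P, f ω < ∞ := by
  -- Where `f = ∞` the product with a positive constant is still `∞`, so the exponential vanishes;
  -- every Laplace transform at a positive argument is therefore at most `P (f < ∞)`.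
  have hle : ∀ j : ℕ, ∀ ω, expNeg (((j : ℝ≥0∞) + 1)⁻¹ * f ω) ≤
      {ω | f ω < ∞}.indicator (fun _ => 1) ω := by
    intro j ω
    by_cases hω : f ω = ∞
    · have h0 : ((j : ℝ≥0∞) + 1)⁻¹ ≠ 0 := by simp
      simp [hω, ENNReal.mul_top h0]
    · simp [Set.indicator, lt_top_iff_ne_top, hω, expNeg_le_one]
  have hm : MeasurableSet {ω | f ω < ∞} := measurableSet_lt hf measurable_const
  have h1 : (1 : ℝ≥0∞) ≤ P {ω | f ω < ∞} := by
    refine le_of_tendsto' hb fun j => (h j).trans ?_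
    calc _ ≤ ∫⁻ ω, {ω | f ω < ∞}.indicator (fun _ => 1) ω ∂P := lintegral_mono (hle j)
      _ = P {ω | f ω < ∞} := by simp [lintegral_indicator hm]
  exact (prob_compl_eq_zero_iff hm).2 (le_antisymm prob_le_one h1)

lemma ae_eq_zero_of_laplace {f : Ω → ℝ≥0∞}
    (h : 1 ≤ ∫⁻ ω, expNeg (f ω) ∂P) : ∀ᵐ ω ∂P, f ω = 0 := by
  have h2 := ae_eq_of_ae_le_of_lintegral_le (μ := P) (f := fun ω => expNeg (f ω)) (g := fun _ => 1)
    (Eventually.of_forall fun ω => expNeg_le_one _)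
    ((lintegral_expNeg_le_one f).trans_lt ENNReal.one_lt_top).ne aemeasurable_const (by simpa using h)
  filter_upwards [h2] with ω hω
  exact expNeg_eq_one_iff.1 hω

end Laplace

/-! ### Independence -/

section Independence

variable {Ω : Type*} {mΩ : MeasurableSpace Ω} {P : Measure Ω} [IsProbabilityMeasure P]

lemma lintegral_of_indepFun {E₁ E₂ : Type*} [MeasurableSpace E₁] [MeasurableSpace E₂]
    {X : Ω → E₁} {Y : Ω → E₂} (hX : Measurable X) (hY : Measurable Y) (h : IndepFun X Y P)
    {F : E₁ → E₂ → ℝ≥0∞} (hF : Measurable (Function.uncurry F)) :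
    ∫⁻ ω, F (X ω) (Y ω) ∂P = ∫⁻ ω, ∫⁻ ω', F (X ω) (Y ω') ∂P ∂P := by
  have hmap := (indepFun_iff_map_prod_eq_prod_map_map hX.aemeasurable hY.aemeasurable).1 h
  have e1 : ∫⁻ ω, F (X ω) (Y ω) ∂P =
      ∫⁻ z, Function.uncurry F z ∂(P.map fun ω => (X ω, Y ω)) := by
    rw [lintegral_map hF (hX.prodMk hY)]
    rfl
  rw [e1, hmap, lintegral_prod _ hF.aemeasurable, lintegral_map hF.lintegral_prod_right' hX]
  refine lintegral_congr fun ω => ?_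
  exact lintegral_map (hF.comp measurable_prodMk_left) hY

/-- Freezing: two independent arguments of an integrand may be integrated one after the other. -/
lemma lintegral_diag_of_indep {m₁ m₂ : MeasurableSpace Ω} (h₁ : m₁ ≤ mΩ) (h₂ : m₂ ≤ mΩ)
    (h : Indep m₁ m₂ P) {F : Ω → Ω → ℝ≥0∞} (hF : Measurable[m₁.prod m₂] (Function.uncurry F)) :
    ∫⁻ ω, F ω ω ∂P = ∫⁻ ω, ∫⁻ ω', F ω ω' ∂P ∂P := by
  -- The identity map is viewed as two random variables, with values in `(Ω, m₁)` and in `(Ω, m₂)`;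
  -- they are independent because `m₁` and `m₂` are.
  refine @lintegral_of_indepFun Ω mΩ P _ Ω Ω m₁ m₂ id id (measurable_id'' h₁)
    (measurable_id'' h₂) ?_ F hF
  refine (@IndepFun_iff_Indep Ω Ω Ω mΩ m₁ m₂ id id P).2 ?_
  rw [MeasurableSpace.comap_id, MeasurableSpace.comap_id]
  exact h

/-- The σ-algebras generated by disjoint groups of independent σ-algebras are independent. -/
lemma iIndep_biSup_of_disjoint {ι κ : Type*} {m : ι → MeasurableSpace Ω} (hle : ∀ i, m i ≤ mΩ)
    (h : iIndep m P) {B : κ → Set ι} (hB : Pairwise fun a b => Disjoint (B a) (B b)) :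
    iIndep (fun a => ⨆ i ∈ B a, m i) P := by
  classical
  rw [iIndep_iff]
  intro s
  induction s using Finset.induction_on with
  | empty => simp
  | insert a s ha ih =>
    intro f hf
    rw [Finset.set_biInter_insert, Finset.prod_insert ha,
      ← ih fun i hi => hf i (Finset.mem_insert_of_mem hi)]
    have hd : Disjoint (B a) (⋃ b ∈ s, B b) := by
      simp only [Set.disjoint_iUnion_right]
      intro b hb
      exact hB fun hab => ha (hab ▸ hb)
    refine (Indep_iff _ _ _).1 (indep_iSup_of_disjoint hle h hd) _ _
      (hf a (Finset.mem_insert_self _ _)) ?_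
    refine Finset.measurableSet_biInter _ fun b hb => ?_
    have hle' : ⨆ i ∈ B b, m i ≤ ⨆ i ∈ ⋃ b ∈ s, B b, m i :=
      biSup_mono fun i hi => Set.mem_biUnion hb hi
    exact hle' _ (hf b (Finset.mem_insert_of_mem hb))

/-- Finite products factor by independence, and dominated convergence along the finite subsets, with
bound `1`, reaches the full sum. Factors are written as `expNeg (c i)` so that the infinite product
is a sum of the `c i`. -/
lemma lintegral_expNeg_tsum {κ : Type*} [Countable κ] {m : κ → MeasurableSpace Ω}
    (hle : ∀ i, m i ≤ mΩ) (h : iIndep m P) {H : κ → Ω → ℝ≥0∞} (hH : ∀ i, Measurable[m i] (H i))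
    {c : κ → ℝ≥0∞} (hc : ∀ i, ∫⁻ ω, expNeg (H i ω) ∂P = expNeg (c i)) :
    ∫⁻ ω, expNeg (∑' i, H i ω) ∂P = expNeg (∑' i, c i) := by
  have hH' : ∀ i, Measurable (H i) := fun i => (hH i).mono (hle i) le_rfl
  have hind : iIndepFun (fun i ω => expNeg (H i ω)) P := by
    rw [iIndepFun_iff_iIndep]
    refine iIndep_of_iIndep_of_le h fun i => ?_
    exact (measurable_expNeg.comp (hH i)).comap_le
  have hfin : ∀ s : Finset κ, ∫⁻ ω, expNeg (∑ i ∈ s, H i ω) ∂P = expNeg (∑ i ∈ s, c i) := by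
    intro s
    simp_rw [expNeg_sum]
    rw [lintegral_prod_eq_prod_lintegral_of_indepFun s _ hind
      fun i => measurable_expNeg.comp (hH' i)]
    exact Finset.prod_congr rfl fun i _ => hc i
  have h1 : Tendsto (fun s : Finset κ => ∫⁻ ω, expNeg (∑ i ∈ s, H i ω) ∂P) atTop
      (𝓝 (∫⁻ ω, expNeg (∑' i, H i ω) ∂P)) := by
    refine tendsto_lintegral_filter_of_dominated_convergence (fun _ => 1)
      (Eventually.of_forall fun s => measurable_expNeg.comp
        (Finset.measurable_sum s fun i _ => hH' i))
      (Eventually.of_forall fun s => Eventually.of_forall fun ω => expNeg_le_one _) (by simp) ?_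
    exact Eventually.of_forall fun ω =>
      (continuous_expNeg.tendsto _).comp ENNReal.summable.hasSum
  have h2 : Tendsto (fun s : Finset κ => expNeg (∑ i ∈ s, c i)) atTop (𝓝 (expNeg (∑' i, c i))) :=
    (continuous_expNeg.tendsto _).comp ENNReal.summable.hasSum
  simp_rw [hfin] at h1
  exact tendsto_nhds_unique h1 h2

end Independence

/-! ### The Laplace functional of a Poisson point process -/

section Poisson

lemma pointCount_eq_tsum {Ω ι : Type*} (p : ι → Ω → ℝ) (A : Set ℝ) (ω : Ω) :
    (pointCount p A ω : ℝ≥0∞) = ∑' i, A.indicator (fun _ => 1) (p i ω) := by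
  rw [pointCount, ← ENNReal.tsum_set_one, tsum_subtype {i | p i ω ∈ A} fun _ => (1 : ℝ≥0∞)]
  rfl

variable {Ω ι : Type*} [MeasurableSpace Ω] {P : Measure Ω} [IsProbabilityMeasure P]

/-- The exponential series in `q = e^{-c}`; the case `c = ∞` is covered as `q = 0`. -/
lemma lintegral_expNeg_mul_poisson (r : ℝ≥0) (c : ℝ≥0∞) :
    ∫⁻ n : ℕ, expNeg (c * n) ∂(poissonMeasure r) = expNeg (r * (1 - expNeg c)) := by
  have hq : ∀ n : ℕ, expNeg (c * n) = expNeg c ^ n := fun n => by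
    rw [mul_comm, ← nsmul_eq_mul, ← Finset.card_range n, ← Finset.sum_const, expNeg_sum]
    simp
  obtain ⟨q, hq0, hq1, hqe⟩ : ∃ q : ℝ, 0 ≤ q ∧ q ≤ 1 ∧ expNeg c = ENNReal.ofReal q :=
    ⟨(expNeg c).toReal, ENNReal.toReal_nonneg, by
      simpa using ENNReal.toReal_mono ENNReal.one_ne_top (expNeg_le_one c),
      (ENNReal.ofReal_toReal (expNeg_ne_top c)).symm⟩
  rw [lintegral_countable']
  have hterm : ∀ n : ℕ, expNeg (c * n) * poissonMeasure r {n} =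
      ENNReal.ofReal (Real.exp (-r) * ((r * q) ^ n / n.factorial)) := by
    intro n
    rw [hq, hqe, poissonMeasure_singleton, ← ENNReal.ofReal_pow hq0,
      ← ENNReal.ofReal_mul (by positivity)]
    congr 1
    rw [mul_pow]
    ring
  simp_rw [hterm]
  have hs : HasSum (fun n : ℕ => Real.exp (-r) * ((r * q) ^ n / n.factorial))
      (Real.exp (-r) * Real.exp (r * q)) := by
    have := NormedSpace.expSeries_div_hasSum_exp (𝔸 := ℝ) ((r : ℝ) * q)
    rw [← Real.exp_eq_exp_ℝ] at this
    exact this.mul_left _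
  rw [← ENNReal.ofReal_tsum_of_nonneg (fun n => by positivity) hs.summable, hs.tsum_eq, hqe,
    ← ENNReal.ofReal_one, ← ENNReal.ofReal_sub _ hq0, ← ENNReal.ofReal_coe_nnreal,
    ← ENNReal.ofReal_mul (NNReal.coe_nonneg r), expNeg_ofReal (mul_nonneg (NNReal.coe_nonneg r) (by linarith)), ← Real.exp_add]
  congr 2
  ring

variable [Countable ι] {p : ι → Ω → ℝ} {μ : Measure ℝ}

lemma measurable_pointCount (hp : ∀ i, Measurable (p i)) {A : Set ℝ} (hA : MeasurableSet A) :
    Measurable fun ω => (pointCount p A ω : ℝ≥0∞) := by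
  simp_rw [pointCount_eq_tsum]
  exact Measurable.tsum fun i => (measurable_const.indicator hA).comp (hp i)

lemma measurableSet_pointCount_eq (hp : ∀ i, Measurable (p i)) {A : Set ℝ} (hA : MeasurableSet A)
    (n : ℕ) : MeasurableSet {ω | pointCount p A ω = n} := by
  convert measurable_pointCount hp hA (measurableSet_singleton (n : ℝ≥0∞)) using 1
  ext ω
  simp only [mem_ofPred_eq, mem_preimage, mem_singleton_iff]
  exact_mod_cast Iff.rfl

lemma IsPoissonPointProcess.laplace_pointCount (h : IsPoissonPointProcess P p μ)
    (hp : ∀ i, Measurable (p i)) {A : Set ℝ} (hA : MeasurableSet A) (c : ℝ≥0∞) :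
    ∫⁻ ω, expNeg (c * pointCount p A ω) ∂P = expNeg (μ A * (1 - expNeg c)) := by
  by_cases hμ : μ A = ∞
  · by_cases hc : c = 0
    · simp [hc]
    have : 1 - expNeg c ≠ 0 := by
      rw [Ne, tsub_eq_zero_iff_le, not_le]
      exact lt_of_le_of_ne (expNeg_le_one c) (mt expNeg_eq_one_iff.1 hc)
    rw [hμ, ENNReal.top_mul this, expNeg_top]
    rw [lintegral_congr_ae (g := fun _ => 0)]
    · simp
    filter_upwards [h.count_top A hA hμ] with ω hω
    simp [hω, ENNReal.mul_top hc]
  · set r := (μ A).toNNReal with hr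
    have hlaw := h.count_law A hA hμ
    have hset := measurableSet_pointCount_eq hp hA
    have hdisj : Pairwise (Function.onFun Disjoint
        fun n : ℕ => {ω | pointCount p A ω = n}) := by
      intro a b hab
      rw [Function.onFun, Set.disjoint_left]
      intro ω h1 h2
      apply hab
      have : (a : ℕ∞) = b := h1.symm.trans h2
      exact_mod_cast this
    -- The probabilities of the finite values sum to `1`, so the count is a.s. finite and `P` splits
    -- over its values.
    have hfull : P (⋃ n : ℕ, {ω | pointCount p A ω = n}) = 1 := by
      rw [measure_iUnion hdisj hset]
      simp_rw [hlaw]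
      rw [← measure_iUnion (fun a b hab => Set.disjoint_singleton.2 hab)
        (fun n => measurableSet_singleton n), Set.iUnion_of_singleton, measure_univ]
    have hres : P = P.restrict (⋃ n : ℕ, {ω | pointCount p A ω = n}) := by
      rw [Measure.restrict_eq_self_of_ae_mem]
      exact (prob_compl_eq_zero_iff (MeasurableSet.iUnion hset)).2 hfull
    rw [hres, lintegral_iUnion hset hdisj]
    have hterm : ∀ n : ℕ, ∫⁻ ω in {ω | pointCount p A ω = n}, expNeg (c * pointCount p A ω) ∂P =
        expNeg (c * n) * poissonMeasure r {n} := by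
      intro n
      rw [← hlaw, setLIntegral_congr_fun (g := fun _ => expNeg (c * n)) (hset n)]
      · simp
      · intro ω hω
        have h' : pointCount p A ω = n := hω
        simp [h']
    simp_rw [hterm]
    rw [← lintegral_countable' fun n : ℕ => expNeg (c * n), lintegral_expNeg_mul_poisson, hr,
      ENNReal.coe_toNNReal hμ]

/-- The level sets of `f` are disjoint, so the sum over the points is a linear combination of
independent counts. -/
lemma IsPoissonPointProcess.laplace_simpleFunc (h : IsPoissonPointProcess P p μ)
    (hp : ∀ i, Measurable (p i)) (f : SimpleFunc ℝ ℝ≥0∞) :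
    ∫⁻ ω, expNeg (∑' i, f (p i ω)) ∂P = expNeg (∫⁻ x, 1 - expNeg (f x) ∂μ) := by
  classical
  set e := f.range.equivFin with he
  set A : Fin f.range.card → Set ℝ := fun i => f ⁻¹' {((e.symm i : f.range) : ℝ≥0∞)} with hAdef
  have hA : ∀ i, MeasurableSet (A i) := fun i => f.measurableSet_fiber _
  have hdisj : Pairwise fun i j => Disjoint (A i) (A j) := by
    intro i j hij
    refine Disjoint.preimage _ (Set.disjoint_singleton.2 fun hne => hij ?_)
    exact e.symm.injective (Subtype.ext hne)
  have hsum : ∀ x, f x = ∑ i, ((e.symm i : f.range) : ℝ≥0∞) * (A i).indicator (fun _ => 1) x := by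
    intro x
    rw [Finset.sum_eq_single (e ⟨f x, f.mem_range_self x⟩)]
    · simp [hAdef]
    · intro b _ hb
      rw [Set.indicator_of_notMem, mul_zero]
      intro hx
      apply hb
      rw [← e.symm_apply_eq]
      exact Subtype.ext hx.symm
    · simp
  have hpath : ∀ ω, ∑' i, f (p i ω) =
      ∑ j, ((e.symm j : f.range) : ℝ≥0∞) * pointCount p (A j) ω := by
    intro ω
    simp_rw [pointCount_eq_tsum, ← ENNReal.tsum_mul_left]
    rw [← Summable.tsum_finsetSum fun _ _ => ENNReal.summable]
    exact tsum_congr fun i => hsum _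
  have hind := h.count_indep _ A hA hdisj
  have hind' : iIndepFun (fun j ω => expNeg (((e.symm j : f.range) : ℝ≥0∞) *
      pointCount p (A j) ω)) P :=
    hind.comp (fun j (n : ℕ∞) => expNeg (((e.symm j : f.range) : ℝ≥0∞) * n))
      fun j => measurable_of_countable _
  simp_rw [hpath, expNeg_sum]
  rw [lintegral_prod_eq_prod_lintegral_of_indepFun _ _ hind' fun j =>
    measurable_expNeg.comp ((measurable_pointCount hp (hA j)).const_mul _)]
  simp_rw [h.laplace_pointCount hp (hA _)]
  rw [← expNeg_sum]
  congr 1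
  have h1 : ∫⁻ x, 1 - expNeg (f x) ∂μ = (f.map fun y => 1 - expNeg y).lintegral μ := by
    rw [← SimpleFunc.lintegral_eq_lintegral]
    rfl
  rw [h1, SimpleFunc.map_lintegral, ← Finset.sum_coe_sort f.range, ← e.symm.sum_comp]
  exact Finset.sum_congr rfl fun j _ => mul_comm _ _

/-- The Laplace functional of a Poisson point process. -/
theorem IsPoissonPointProcess.laplace (h : IsPoissonPointProcess P p μ)
    (hp : ∀ i, Measurable (p i)) {f : ℝ → ℝ≥0∞} (hf : Measurable f) :
    ∫⁻ ω, expNeg (∑' i, f (p i ω)) ∂P = expNeg (∫⁻ x, 1 - expNeg (f x) ∂μ) := by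
  have hmono := SimpleFunc.monotone_eapprox f
  have hsup : ∀ x, Tendsto (fun n => SimpleFunc.eapprox f n x) atTop (𝓝 (f x)) := fun x =>
    SimpleFunc.tendsto_eapprox hf x
  have htsum : ∀ ω, Tendsto (fun n => ∑' i, SimpleFunc.eapprox f n (p i ω)) atTop
      (𝓝 (∑' i, f (p i ω))) := by
    intro ω
    -- With the discrete σ-algebra on the index set the sum is an integral against the counting
    -- measure, and monotone convergence applies.
    let _ : MeasurableSpace ι := ⊤
    simp_rw [← lintegral_count]
    exact lintegral_tendsto_of_tendsto_of_monotone (fun n => (measurable_from_top).aemeasurable)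
      (Eventually.of_forall fun i a b hab => hmono hab _) (Eventually.of_forall fun i => hsup _)
  have h1 := tendsto_lintegral_expNeg (P := P)
    (f := fun n ω => ∑' i, SimpleFunc.eapprox f n (p i ω))
    (fun n => Measurable.tsum fun i => (SimpleFunc.measurable _).comp (hp i))
    (Eventually.of_forall htsum)
  simp_rw [h.laplace_simpleFunc hp] at h1
  refine tendsto_nhds_unique h1 ((continuous_expNeg.tendsto _).comp ?_)
  refine lintegral_tendsto_of_tendsto_of_monotone
    (fun n => (measurable_const.sub (measurable_expNeg.comp
      (SimpleFunc.measurable _))).aemeasurable)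
    (Eventually.of_forall fun x a b hab => ?_) (Eventually.of_forall fun x => ?_)
  · exact tsub_le_tsub_left (expNeg_antitone (hmono hab x)) _
  · exact ENNReal.Tendsto.sub tendsto_const_nhds ((continuous_expNeg.tendsto _).comp (hsup x))
      (Or.inl ENNReal.one_ne_top)

end Poisson

/-! ### Integrals -/

lemma lintegral_rpow_mul_exp_neg_mul_Ioi {a r : ℝ} (ha : 0 < a) (hr : 0 < r) :
    ∫⁻ x in Ioi (0 : ℝ), ENNReal.ofReal (x ^ (a - 1) * Real.exp (-(r * x))) =
      ENNReal.ofReal ((1 / r) ^ a * Real.Gamma a) := by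
  rw [← Real.integral_rpow_mul_exp_neg_mul_Ioi ha hr, ofReal_integral_eq_lintegral_ofReal]
  -- A non-integrable function would have Bochner integral `0`, whereas the known value is positive.
  · by_contra h
    have h0 := Real.integral_rpow_mul_exp_neg_mul_Ioi ha hr
    rw [integral_undef h] at h0
    have : 0 < (1 / r) ^ a * Real.Gamma a :=
      mul_pos (Real.rpow_pos_of_pos (by positivity) _) (Real.Gamma_pos_of_pos ha)
    exact this.ne h0
  · filter_upwards [ae_restrict_mem measurableSet_Ioi] with x hx
    have : (0 : ℝ) < x := hx
    simp only [Pi.zero_apply]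
    positivity

/-- The Laplace transform of the exponential distribution. -/
lemma lintegral_expNeg_expMeasure (c : ℝ≥0∞) :
    ∫⁻ x, expNeg (c * ENNReal.ofReal x) ∂(expMeasure 1) = (1 + c)⁻¹ := by
  have hdens : ∀ f : ℝ → ℝ≥0∞, Measurable f → ∫⁻ x, f x ∂(expMeasure 1) =
      ∫⁻ x in Ioi (0 : ℝ), ENNReal.ofReal (Real.exp (-x)) * f x := by
    intro f hf
    rw [expMeasure, gammaMeasure, lintegral_withDensity_eq_lintegral_mul _
      (show Measurable (gammaPDF 1 1) from (measurable_gammaPDFReal 1 1).ennreal_ofReal) hf, ← lintegral_indicator measurableSet_Ioi,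
      -- The null point `0` is split off because the two densities may differ there.
      ← lintegral_add_compl _ (measurableSet_singleton (0 : ℝ)),
      ← lintegral_add_compl (fun x => (Ioi (0 : ℝ)).indicator _ x)
        (measurableSet_singleton (0 : ℝ))]
    congr 1
    · simp
    · refine setLIntegral_congr_fun (measurableSet_singleton _).compl fun x hx => ?_
      rcases lt_or_gt_of_ne (show x ≠ 0 from hx) with h | h
      · simp [gammaPDF_of_neg h, h.le]
      · simp [Set.indicator, h, gammaPDF_of_nonneg h.le]
  have hm : Measurable fun x : ℝ => expNeg (c * ENNReal.ofReal x) :=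
    measurable_expNeg.comp (ENNReal.measurable_ofReal.const_mul c)
  rw [hdens _ hm]
  by_cases hc : c = ∞
  · rw [setLIntegral_congr_fun (g := fun _ => 0) measurableSet_Ioi]
    · simp [hc]
    · intro x hx
      have : ENNReal.ofReal x ≠ 0 := by simpa using hx
      simp [hc, ENNReal.top_mul this]
  · obtain ⟨r, hr, rfl⟩ : ∃ r : ℝ, 0 ≤ r ∧ c = ENNReal.ofReal r :=
      ⟨c.toReal, ENNReal.toReal_nonneg, (ENNReal.ofReal_toReal hc).symm⟩
    have := lintegral_rpow_mul_exp_neg_mul_Ioi (a := 1) (r := 1 + r) one_pos (by linarith)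
    rw [setLIntegral_congr_fun
      (g := fun x => ENNReal.ofReal (x ^ ((1 : ℝ) - 1) * Real.exp (-((1 + r) * x))))
      measurableSet_Ioi, this]
    · rw [Real.Gamma_one, Real.rpow_one, mul_one, one_div,
        ENNReal.ofReal_inv_of_pos (by linarith), ENNReal.ofReal_add zero_le_one hr,
        ENNReal.ofReal_one]
    · intro x hx
      have hx' : (0 : ℝ) < x := hx
      simp only
      rw [← ENNReal.ofReal_mul hr, expNeg_ofReal (by positivity),
        ← ENNReal.ofReal_mul (Real.exp_pos _).le, ← Real.exp_add, sub_self, Real.rpow_zero, one_mul]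
      congr 2
      ring

/-- Write `1 - e^{-z}` as the integral of `e^{-s}` over `(0, z)` and exchange integrals; the tail of
`z^{-(1+a)}` beyond `s` is `s^{-a} / a`, and a Gamma integral remains. -/
lemma lintegral_one_sub_expNeg_Ioi {a : ℝ} (ha : 0 < a) (ha1 : a < 1) :
    ∫⁻ z in Ioi (0 : ℝ), (1 - expNeg (ENNReal.ofReal z)) * ENNReal.ofReal (z ^ (-(1 + a))) =
      ENNReal.ofReal (Real.Gamma (1 - a) / a) := by
  have h1 : ∀ z : ℝ, 0 < z → 1 - expNeg (ENNReal.ofReal z) =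
      ∫⁻ s in Ioi (0 : ℝ), (Iio z).indicator (fun s => ENNReal.ofReal (Real.exp (-s))) s := by
    intro z hz
    rw [lintegral_indicator measurableSet_Iio, Measure.restrict_restrict measurableSet_Iio,
      Set.inter_comm, Ioi_inter_Iio, restrict_Ioo_eq_restrict_Ioc,
      ← ofReal_integral_eq_lintegral_ofReal, ← intervalIntegral.integral_of_le hz.le]
    · rw [intervalIntegral.integral_comp_neg fun x => Real.exp x, integral_exp, neg_zero,
        Real.exp_zero, expNeg_ofReal hz.le, ENNReal.ofReal_sub _ (Real.exp_pos _).le,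
        ENNReal.ofReal_one]
    · exact (Continuous.integrableOn_Ioc (by fun_prop))
    · exact Eventually.of_forall fun x => (Real.exp_pos _).le
  have h2 : ∀ s : ℝ, 0 < s → ∫⁻ z in Ioi s, ENNReal.ofReal (z ^ (-(1 + a))) =
      ENNReal.ofReal (s ^ (-a) / a) := by
    intro s hs
    rw [← ofReal_integral_eq_lintegral_ofReal (integrableOn_Ioi_rpow_of_lt (by linarith) hs),
      integral_Ioi_rpow_of_lt (by linarith) hs]
    · congr 1
      rw [show -(1 + a) + 1 = -a by ring, neg_div_neg_eq]
    · filter_upwards [ae_restrict_mem measurableSet_Ioi] with x hx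
      exact Real.rpow_nonneg (hs.le.trans (le_of_lt hx)) _
  calc ∫⁻ z in Ioi (0 : ℝ), (1 - expNeg (ENNReal.ofReal z)) * ENNReal.ofReal (z ^ (-(1 + a)))
      = ∫⁻ z in Ioi (0 : ℝ), ∫⁻ s in Ioi (0 : ℝ),
          (Iio z).indicator (fun s => ENNReal.ofReal (Real.exp (-s))) s *
            ENNReal.ofReal (z ^ (-(1 + a))) := by
        refine setLIntegral_congr_fun measurableSet_Ioi fun z hz => ?_
        rw [h1 z hz, lintegral_mul_const]
        exact (Measurable.ennreal_ofReal (by fun_prop)).indicator measurableSet_Iio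
    _ = ∫⁻ s in Ioi (0 : ℝ), ∫⁻ z in Ioi (0 : ℝ),
          (Iio z).indicator (fun s => ENNReal.ofReal (Real.exp (-s))) s *
            ENNReal.ofReal (z ^ (-(1 + a))) := by
        refine lintegral_lintegral_swap (Measurable.aemeasurable ?_)
        have : (Function.uncurry fun z s : ℝ => (Iio z).indicator
            (fun s => ENNReal.ofReal (Real.exp (-s))) s * ENNReal.ofReal (z ^ (-(1 + a)))) =
            fun q => {q : ℝ × ℝ | q.2 < q.1}.indicator (fun q =>
              ENNReal.ofReal (Real.exp (-q.2)) * ENNReal.ofReal (q.1 ^ (-(1 + a)))) q := by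
          ext ⟨z, s⟩
          by_cases h : s < z <;> simp [Set.indicator, h]
        rw [this]
        exact Measurable.indicator (by fun_prop) (measurableSet_lt measurable_snd measurable_fst)
    _ = ∫⁻ s in Ioi (0 : ℝ), ENNReal.ofReal (Real.exp (-s)) * ENNReal.ofReal (s ^ (-a) / a) := by
        refine setLIntegral_congr_fun measurableSet_Ioi fun s hs => ?_
        rw [← h2 s hs, ← lintegral_const_mul _ (by fun_prop), ← lintegral_indicator measurableSet_Ioi,
          ← lintegral_indicator measurableSet_Ioi]
        refine lintegral_congr fun z => ?_
        by_cases hsz : s < z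
        · have : 0 < z := lt_trans hs hsz
          simp [Set.indicator, hsz, this]
        · simp [Set.indicator, hsz]
    _ = ∫⁻ s in Ioi (0 : ℝ), ENNReal.ofReal (1 / a) *
          ENNReal.ofReal (s ^ ((1 - a) - 1) * Real.exp (-(1 * s))) := by
        refine setLIntegral_congr_fun measurableSet_Ioi fun s hs => ?_
        have hs' : (0 : ℝ) < s := hs
        rw [← ENNReal.ofReal_mul (Real.exp_pos _).le, ← ENNReal.ofReal_mul (by positivity)]
        congr 1
        rw [show 1 - a - 1 = -a by ring, one_mul]
        ring
    _ = ENNReal.ofReal (Real.Gamma (1 - a) / a) := by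
        rw [lintegral_const_mul _ (by fun_prop),
          lintegral_rpow_mul_exp_neg_mul_Ioi (by linarith) one_pos,
          ← ENNReal.ofReal_mul (by positivity)]
        congr 1
        simp
        ring

/-! ### The intensity measures and their stable normalization -/

section Intensity

variable {α : ℕ → ℝ}

lemma IsParameter.ratio_pos (hα : IsParameter α) {n : ℕ} (hn : 1 ≤ n) :
    0 < α n / α (n + 1) := div_pos (hα.pos n hn) (hα.pos _ (by omega))

lemma IsParameter.ratio_lt_one (hα : IsParameter α) {n : ℕ} (hn : 1 ≤ n) :
    α n / α (n + 1) < 1 := (div_lt_one (hα.pos _ (by omega))).2 (hα.strictMono n hn)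

lemma lintegral_intensity (α : ℕ → ℝ) (n : ℕ) {f : ℝ → ℝ≥0∞} (hf : Measurable f) :
    ∫⁻ u, f u ∂(intensity α n) = ∫⁻ u in Ioi (0 : ℝ),
      ENNReal.ofReal (intensityConst α n / u ^ (1 + α n)) * f u := by
  rw [intensity, lintegral_withDensity_eq_lintegral_mul _ (by fun_prop) hf]
  rfl

/-- The normalization of the intensities: the sum of the `α_{n+1}`-th powers of the marks of level
`n` is a standard stable variable of index `α_n / α_{n+1}`. -/
lemma lintegral_intensity_stable (hα : IsParameter α) {n : ℕ} (hn : 1 ≤ n) {x : ℝ≥0∞}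
    (hx : x ≠ ∞) :
    ∫⁻ u, 1 - expNeg ((x * ENNReal.ofReal u) ^ α (n + 1)) ∂(intensity α n) = x ^ α n := by
  have hβ := hα.pos (n + 1) (by omega)
  have hαn := hα.pos n hn
  have ha0 := hα.ratio_pos hn
  have ha1 := hα.ratio_lt_one hn
  set β := α (n + 1) with hβdef
  set a := α n / β with hadef
  have haβ : a * β = α n := div_mul_cancel₀ _ hβ.ne'
  rcases eq_or_ne x 0 with rfl | hx0
  · simp [hβ, hαn]
  obtain ⟨y, hy, rfl⟩ : ∃ y : ℝ, 0 < y ∧ x = ENNReal.ofReal y :=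
    ⟨x.toReal, ENNReal.toReal_pos hx0 hx, (ENNReal.ofReal_toReal hx).symm⟩
  rw [lintegral_intensity α n (by
    exact measurable_const.sub (measurable_expNeg.comp (by fun_prop)))]
  -- The substitution `z = (y u)^β` turns the power law of index `α n` into one of index `a = α n /
  -- β`, the index appearing in the Gamma factor of `intensityConst`.
  have hcv := lintegral_image_eq_lintegral_abs_deriv_mul (s := Ioi (0 : ℝ))
    (f := fun u : ℝ => (y * u) ^ β) (f' := fun u => y * β * (y * u) ^ (β - 1)) measurableSet_Ioi
    (fun u hu => by
      have hu' : (0 : ℝ) < u := hu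
      have h := ((hasDerivAt_id u).const_mul y).rpow_const (p := β)
        (Or.inl (by simp only [id]; positivity))
      simpa using h.hasDerivWithinAt)
    (fun u hu w hw h => by
      have hu' : (0 : ℝ) < u := hu
      have hw' : (0 : ℝ) < w := hw
      have := (Real.rpow_left_inj (by positivity) (by positivity) hβ.ne').1 h
      exact mul_left_cancel₀ hy.ne' this)
    (fun z => (1 - expNeg (ENNReal.ofReal z)) * ENNReal.ofReal (z ^ (-(1 + a))))
  have himg : (fun u : ℝ => (y * u) ^ β) '' Ioi (0 : ℝ) = Ioi 0 := by
    ext z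
    constructor
    · rintro ⟨u, hu, rfl⟩
      have hu' : (0 : ℝ) < u := hu
      exact Real.rpow_pos_of_pos (by positivity) _
    · intro hz
      have hz' : (0 : ℝ) < z := hz
      refine ⟨z ^ (1 / β) / y, div_pos (Real.rpow_pos_of_pos hz' _) hy, ?_⟩
      simp only
      rw [mul_div_cancel₀ _ hy.ne', ← Real.rpow_mul hz'.le, one_div, inv_mul_cancel₀ hβ.ne',
        Real.rpow_one]
  rw [himg, lintegral_one_sub_expNeg_Ioi ha0 ha1] at hcv
  have hΓ : 0 < Real.Gamma (1 - a) := Real.Gamma_pos_of_pos (by linarith)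
  have hconst : ENNReal.ofReal y ^ α n = ENNReal.ofReal (y ^ α n * a / Real.Gamma (1 - a)) *
      ENNReal.ofReal (Real.Gamma (1 - a) / a) := by
    rw [← ENNReal.ofReal_mul (by positivity), ENNReal.ofReal_rpow_of_pos hy]
    congr 1
    field_simp
  rw [hconst, hcv, ← lintegral_const_mul']
  swap
  · exact ENNReal.ofReal_ne_top
  refine setLIntegral_congr_fun measurableSet_Ioi fun u hu => ?_
  have hu' : (0 : ℝ) < u := hu
  have hyu : 0 < y * u := by positivity
  rw [← ENNReal.ofReal_mul hy.le, ENNReal.ofReal_rpow_of_pos hyu, mul_comm (1 - expNeg _),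
    ← mul_assoc, ← mul_assoc, ← ENNReal.ofReal_mul (by positivity),
    ← ENNReal.ofReal_mul (by positivity)]
  congr 2
  rw [abs_of_nonneg (by positivity), intensityConst, ← hβdef, ← hadef, ← Real.rpow_mul hyu.le]
  have e1 : (y * u) ^ (β - 1) * (y * u) ^ (β * -(1 + a)) = y ^ (-(1 + α n)) * u ^ (-(1 + α n)) := by
    rw [← Real.rpow_add hyu, ← Real.mul_rpow hy.le hu'.le]
    congr 1
    linear_combination -haβ
  have e2 : y ^ α n * (y * y ^ (-(1 + α n))) = 1 := by
    nth_rw 2 [← Real.rpow_one y]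
    rw [← Real.rpow_add hy, ← Real.rpow_add hy]
    simp
  have e3 : u ^ (-(1 + α n)) = (u ^ (1 + α n))⁻¹ := Real.rpow_neg hu'.le _
  calc α n / Real.Gamma (1 - a) / u ^ (1 + α n)
      = (y ^ α n * (y * y ^ (-(1 + α n)))) * (a * β) / Real.Gamma (1 - a) *
          u ^ (-(1 + α n)) := by rw [e2, e3, haβ]; ring
    _ = y ^ α n * a / Real.Gamma (1 - a) * (y * β * ((y * u) ^ (β - 1) *
          (y * u) ^ (β * -(1 + a)))) := by rw [e1]; ring
    _ = _ := by ring

end Intensity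

/-! ### Windows of clocks -/

/-- A node, as a possible state of the process. -/
def toState {k : ℕ} (v : Fin k → ℕ+) : Fin k → WithTop ℕ+ := fun i => (v i : WithTop ℕ+)

lemma toState_injective {k : ℕ} : Function.Injective (toState (k := k)) := fun v w h => by
  funext i
  exact WithTop.coe_injective (congrFun h i)

lemma exists_toState_eq_iff {k : ℕ} (s : Fin k → WithTop ℕ+) :
    (∃ v, s = toState v) ↔ ∀ i, s i ≠ ⊤ := by
  constructor
  · rintro ⟨v, rfl⟩ i
    exact WithTop.coe_ne_top
  · intro h
    refine ⟨fun i => (s i).untop (h i), funext fun i => ?_⟩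
    simp [toState]

lemma extendZero_toState {k : ℕ} (f : (Fin k → ℕ+) → ℝ≥0∞) (v : Fin k → ℕ+) :
    extendZero f (toState v) = f v := by
  simp [extendZero, toState]

/-- A sum over the countable set of nodes; states with an infinite coordinate drop out.
Measurability and the regrouping of marks by node both go through this form. -/
lemma extendZero_eq_tsum {k : ℕ} (f : (Fin k → ℕ+) → ℝ≥0∞) (s : Fin k → WithTop ℕ+) :
    extendZero f s = ∑' v, open Classical in if s = toState v then f v else 0 := by
  classical
  by_cases h : ∃ v, s = toState v
  · obtain ⟨v, rfl⟩ := h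
    rw [extendZero_toState, tsum_eq_single v]
    · simp
    · intro w hw
      rw [if_neg fun h => hw (toState_injective h).symm]
  · have h0 : ∀ v, (open Classical in if s = toState v then f v else 0) = 0 := fun v =>
      if_neg fun hv => h ⟨v, hv⟩
    rw [extendZero, if_neg (by rwa [exists_toState_eq_iff] at h)]
    simp [h0]

/-- The part of `clockSum` that comes from the marks in `(a, b]`. -/
def windowSum (R : Input) {k : ℕ} (Y : ℝ≥0∞ → (Fin k → WithTop ℕ+))
    (w : (Fin (k + 1) → ℕ+) → ℝ≥0∞) (a b : ℝ≥0∞) : ℝ≥0∞ :=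
  ∑' (x : ℕ+) (i : ℕ+), (Ioc a b).indicator
    (fun s => extendZero (fun v => w (Fin.snoc v x)) (Y s)) (ENNReal.ofReal (R.σ (k + 1) x i)) *
      ENNReal.ofReal (R.T (k + 1) x i)

section Clock

variable {R : Input} {k : ℕ} {Y : ℝ≥0∞ → (Fin k → WithTop ℕ+)} {w : (Fin (k + 1) → ℕ+) → ℝ≥0∞}

lemma clockSum_mono : Monotone (clockSum R Y w) := by
  intro s t h
  unfold clockSum
  gcongr with x i
  split_ifs with h1 h2
  · exact le_rfl
  · exact absurd (h1.trans h) h2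
  · exact zero_le
  · exact le_rfl

lemma clockSum_add_windowSum {a b : ℝ≥0∞} (h : a ≤ b) :
    clockSum R Y w b = clockSum R Y w a + windowSum R Y w a b := by
  unfold clockSum windowSum
  rw [← ENNReal.tsum_add]
  refine tsum_congr fun x => ?_
  rw [← ENNReal.tsum_add]
  refine tsum_congr fun i => ?_
  by_cases h1 : ENNReal.ofReal (R.σ (k + 1) x i) ≤ a
  · simp [h1, h1.trans h, Set.indicator, h1.not_gt]
  · by_cases h2 : ENNReal.ofReal (R.σ (k + 1) x i) ≤ b
    · simp [h1, h2, Set.indicator, not_le.1 h1]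
    · simp [h1, h2, Set.indicator]

lemma clockSum_zero (hσ : ∀ x i, 0 < R.σ (k + 1) x i) : clockSum R Y w 0 = 0 := by
  simp [clockSum, hσ]

lemma clockSum_eq_windowSum (hσ : ∀ x i, 0 < R.σ (k + 1) x i) (t : ℝ≥0∞) :
    clockSum R Y w t = windowSum R Y w 0 t := by
  rw [clockSum_add_windowSum (zero_le (a := t)), clockSum_zero hσ, zero_add]

lemma windowSum_mul (c : ℝ≥0∞) (a b : ℝ≥0∞) :
    windowSum R Y (fun v => c * w v) a b = c * windowSum R Y w a b := by
  unfold windowSum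
  rw [← ENNReal.tsum_mul_left]
  refine tsum_congr fun x => ?_
  rw [← ENNReal.tsum_mul_left]
  refine tsum_congr fun i => ?_
  rw [← mul_assoc]
  congr 1
  simp only [Set.indicator]
  split_ifs
  · unfold extendZero
    split_ifs <;> simp
  · simp

lemma windowSum_mono_right {a b b' : ℝ≥0∞} (h : b ≤ b') :
    windowSum R Y w a b ≤ windowSum R Y w a b' := by
  unfold windowSum
  gcongr with x i

/-- The total of the times `T_i^{k+1,x}` of the marks in `(a, b]` at which the process is at `v`. -/
def visitTime (R : Input) {k : ℕ} (Y : ℝ≥0∞ → (Fin k → WithTop ℕ+)) (a b : ℝ≥0∞)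
    (v : Fin k → ℕ+) (x : ℕ+) : ℝ≥0∞ :=
  ∑' i : ℕ+, (Ioc a b ∩ {s | Y s = toState v}).indicator 1 (ENNReal.ofReal (R.σ (k + 1) x i)) *
    ENNReal.ofReal (R.T (k + 1) x i)

/-- Regrouping the marks by the node that they find. In this form the window can be compared with
the occupation times of the next process, which are the same visit times multiplied by the marks
`γ`. -/
lemma windowSum_eq_visitTime (a b : ℝ≥0∞) :
    windowSum R Y w a b =
      ∑' (v : Fin k → ℕ+) (x : ℕ+), w (Fin.snoc v x) * visitTime R Y a b v x := by
  classical
  unfold windowSum visitTime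
  rw [ENNReal.tsum_comm]
  rw [ENNReal.tsum_comm (f := fun v x => w (Fin.snoc v x) * _)]
  rw [ENNReal.tsum_comm]
  refine tsum_congr fun x => ?_
  simp_rw [← ENNReal.tsum_mul_left]
  rw [ENNReal.tsum_comm (α := Fin k → ℕ+)]
  refine tsum_congr fun i => ?_
  simp_rw [← mul_assoc]
  rw [ENNReal.tsum_mul_right]
  congr 1
  by_cases h : ENNReal.ofReal (R.σ (k + 1) x i) ∈ Ioc a b
  · rw [Set.indicator_of_mem h, extendZero_eq_tsum]
    refine tsum_congr fun v => ?_
    simp only [Set.indicator, Set.mem_inter_iff, h, true_and, mem_ofPred_eq]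
    split_ifs <;> simp
  · rw [Set.indicator_of_notMem h]
    symm
    rw [ENNReal.tsum_eq_zero]
    intro v
    rw [Set.indicator_of_notMem fun h' => h h'.1, mul_zero]

end Clock

/-! ### Measurability -/

section Measurability

variable {Ω : Type*} [MeasurableSpace Ω]

lemma measurable_extendZero {k : ℕ} {s : Ω → Fin k → WithTop ℕ+} {f : Ω → (Fin k → ℕ+) → ℝ≥0∞}
    (hs : ∀ v, MeasurableSet {ω | s ω = toState v}) (hf : ∀ v, Measurable fun ω => f ω v) :
    Measurable fun ω => extendZero (f ω) (s ω) := by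
  simp_rw [extendZero_eq_tsum]
  exact Measurable.tsum fun v => Measurable.ite (hs v) (hf v) measurable_const

/-- The dependence on time and on the realization of a process of nodes is jointly measurable. -/
def JointlyMeasurable {k : ℕ} (Y : Ω → ℝ≥0∞ → (Fin k → WithTop ℕ+)) : Prop :=
  ∀ v, MeasurableSet {p : Ω × ℝ≥0∞ | Y p.1 p.2 = toState v}

/-- The input of the levels `1, …, n` is measurable. -/
structure MeasurableUpTo (n : ℕ) (Q : Ω → Input) : Prop where
  γ : ∀ k < n, ∀ v, Measurable fun ω => (Q ω).γ (k + 1) v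
  σ : ∀ k < n, ∀ x i, Measurable fun ω => (Q ω).σ (k + 1) x i
  T : ∀ k < n, ∀ x i, Measurable fun ω => (Q ω).T (k + 1) x i

lemma MeasurableUpTo.mono {m n : ℕ} {Q : Ω → Input} (h : MeasurableUpTo n Q) (hmn : m ≤ n) :
    MeasurableUpTo m Q :=
  ⟨fun k hk => h.γ k (by omega), fun k hk => h.σ k (by omega), fun k hk => h.T k (by omega)⟩

lemma MeasurableUpTo.comp {Ω' : Type*} [MeasurableSpace Ω'] {n : ℕ} {Q : Ω → Input}
    (h : MeasurableUpTo n Q) {f : Ω' → Ω} (hf : Measurable f) : MeasurableUpTo n (Q ∘ f) :=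
  ⟨fun k hk v => (h.γ k hk v).comp hf, fun k hk x i => (h.σ k hk x i).comp hf,
    fun k hk x i => (h.T k hk x i).comp hf⟩

lemma JointlyMeasurable.measurableSet {k : ℕ} {Y : Ω → ℝ≥0∞ → (Fin k → WithTop ℕ+)}
    (hY : JointlyMeasurable Y) {Ω' : Type*} [MeasurableSpace Ω'] {f : Ω' → Ω} {t : Ω' → ℝ≥0∞}
    (hf : Measurable f) (ht : Measurable t) (v : Fin k → ℕ+) :
    MeasurableSet {ω | Y (f ω) (t ω) = toState v} :=
  (hf.prodMk ht) (hY v)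

variable {k : ℕ} {Q : Ω → Input} {Y : Ω → ℝ≥0∞ → (Fin k → WithTop ℕ+)}
  {w : Ω → (Fin (k + 1) → ℕ+) → ℝ≥0∞}

lemma measurable_clockSum (hσ : ∀ x i, Measurable fun ω => (Q ω).σ (k + 1) x i)
    (hT : ∀ x i, Measurable fun ω => (Q ω).T (k + 1) x i) (hY : JointlyMeasurable Y)
    (hw : ∀ v, Measurable fun ω => w ω v) {t : Ω → ℝ≥0∞} (ht : Measurable t) :
    Measurable fun ω => clockSum (Q ω) (Y ω) (w ω) (t ω) := by
  unfold clockSum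
  refine Measurable.tsum fun x => Measurable.tsum fun i => ?_
  have hs : Measurable fun ω => ENNReal.ofReal ((Q ω).σ (k + 1) x i) := (hσ x i).ennreal_ofReal
  refine Measurable.ite (measurableSet_le hs ht) ?_ measurable_const
  exact (measurable_extendZero (fun v => hY.measurableSet measurable_id hs v)
    fun v => hw _).mul (hT x i).ennreal_ofReal

lemma measurable_windowSum (hσ : ∀ x i, Measurable fun ω => (Q ω).σ (k + 1) x i)
    (hT : ∀ x i, Measurable fun ω => (Q ω).T (k + 1) x i) (hY : JointlyMeasurable Y)
    (hw : ∀ v, Measurable fun ω => w ω v) {a b : Ω → ℝ≥0∞} (ha : Measurable a)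
    (hb : Measurable b) :
    Measurable fun ω => windowSum (Q ω) (Y ω) (w ω) (a ω) (b ω) := by
  unfold windowSum
  refine Measurable.tsum fun x => Measurable.tsum fun i => ?_
  have hs : Measurable fun ω => ENNReal.ofReal ((Q ω).σ (k + 1) x i) := (hσ x i).ennreal_ofReal
  simp only [Set.indicator, Set.mem_Ioc]
  refine Measurable.mul (Measurable.ite
    ((measurableSet_lt ha hs).inter (measurableSet_le hs hb)) ?_ measurable_const)
    (hT x i).ennreal_ofReal
  exact measurable_extendZero (fun v => hY.measurableSet measurable_id hs v) fun v => hw _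

/-- The rational points of `[0, ∞]`. -/
def ratPt (q : ℚ) : ℝ≥0∞ := (Real.toNNReal q : ℝ≥0)

lemma exists_ratPt_btwn {a b : ℝ≥0∞} (h : a < b) : ∃ q, a < ratPt q ∧ ratPt q < b := by
  obtain ⟨q, -, h1, h2⟩ := ENNReal.lt_iff_exists_rat_btwn.1 h
  exact ⟨q, h1, h2⟩

/-- By monotonicity, the infimum is below `c` exactly when some rational point below `c` already
belongs to the set. -/
lemma measurable_genInv {f : Ω → ℝ≥0∞ → ℝ≥0∞} (hmono : ∀ ω, Monotone (f ω))
    (hf : ∀ r, Measurable fun ω => f ω r) {t : Ω → ℝ≥0∞} (ht : Measurable t) :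
    Measurable fun ω => genInv (f ω) (t ω) := by
  refine measurable_of_Iio fun c => ?_
  have : (fun ω => genInv (f ω) (t ω)) ⁻¹' Iio c =
      ⋃ q : ℚ, {ω | ratPt q < c ∧ t ω < f ω (ratPt q)} := by
    ext ω
    simp only [genInv, mem_preimage, mem_Iio, sInf_lt_iff, mem_ofPred_eq, mem_iUnion]
    constructor
    · rintro ⟨r, hr, hrc⟩
      obtain ⟨q, h1, h2⟩ := exists_ratPt_btwn hrc
      exact ⟨q, h2, lt_of_lt_of_le hr (hmono ω h1.le)⟩
    · rintro ⟨q, h1, h2⟩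
      exact ⟨_, h2, h1⟩
  rw [this]
  exact MeasurableSet.iUnion fun q =>
    (MeasurableSet.const (ratPt q < c)).inter (measurableSet_lt ht (hf _))

/-- For monotone `f` and `s > 0` the left limit is the supremum over `r < s`, so bounding it bounds
all these values. At `s = 0` there is nothing to the left, `leftLim` is `f 0` by convention, and the
interval is empty. -/
lemma leftLim_le_and_lt_iff {f : ℝ≥0∞ → ℝ≥0∞} (hf : Monotone f) (s t : ℝ≥0∞) :
    (Function.leftLim f s ≤ t ∧ t < f s) ↔ 0 < s ∧ (∀ r < s, f r ≤ t) ∧ t < f s := by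
  rcases eq_or_ne s 0 with rfl | hs
  · have h0 : 𝓝[<] (0 : ℝ≥0∞) = ⊥ := by
      rw [show Iio (0 : ℝ≥0∞) = ∅ by ext; simp, nhdsWithin_empty]
    rw [leftLim_eq_of_eq_bot f h0]
    simp
  · have hs' : 0 < s := pos_iff_ne_zero.2 hs
    have hne : (𝓝[<] s).NeBot := nhdsLT_neBot_of_exists_lt ⟨0, hs'⟩
    rw [hf.leftLim_eq_sSup]
    simp [hs']

lemma inInterval_iff {R : Input} {k : ℕ} {f : ℝ≥0∞ → ℝ≥0∞} (hf : Monotone f) (t : ℝ≥0∞) (x : ℕ+) :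
    InInterval R k f t x ↔ ∃ i : ℕ+, 0 < ENNReal.ofReal (R.σ k x i) ∧
      (∀ r < ENNReal.ofReal (R.σ k x i), f r ≤ t) ∧ t < f (ENNReal.ofReal (R.σ k x i)) :=
  exists_congr fun _ => leftLim_le_and_lt_iff hf _ _

lemma lastCoord_eq_coe_iff {R : Input} {k : ℕ} {f : ℝ≥0∞ → ℝ≥0∞} {t : ℝ≥0∞} {x : ℕ+} :
    lastCoord R k f t = (x : WithTop ℕ+) ↔
      InInterval R k f t x ∧ ∀ y < x, ¬ InInterval R k f t y := by
  classical
  unfold lastCoord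
  split_ifs with h
  · rw [WithTop.coe_inj, PNat.find_eq_iff]
  · simp only [WithTop.top_ne_coe, false_iff, not_and]
    exact fun hx => absurd ⟨x, hx⟩ h

lemma X_succ (R : Input) (k : ℕ) (t : ℝ≥0∞) :
    X R (k + 1) t = Fin.snoc (X R k (genInv (Xi R (k + 1)) t))
      (lastCoord R (k + 1) (Xi R (k + 1)) t) := rfl

lemma X_succ_eq_iff (R : Input) (k : ℕ) (t : ℝ≥0∞) (v : Fin k → ℕ+) (x : ℕ+) :
    X R (k + 1) t = toState (Fin.snoc v x : Fin (k + 1) → ℕ+) ↔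
      X R k (genInv (Xi R (k + 1)) t) = toState v ∧
        lastCoord R (k + 1) (Xi R (k + 1)) t = (x : WithTop ℕ+) := by
  have : toState (Fin.snoc v x : Fin (k + 1) → ℕ+) =
      (Fin.snoc (toState v) (x : WithTop ℕ+) : Fin (k + 1) → WithTop ℕ+) := by
    funext i
    refine Fin.lastCases ?_ (fun j => ?_) i <;> simp [toState]
  rw [X_succ, this]
  constructor
  · intro h
    exact ⟨by simpa using congrArg (Fin.init (α := fun _ => WithTop ℕ+)) h,
      by simpa using congrFun h (Fin.last k)⟩
  · rintro ⟨h1, h2⟩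
    rw [h1, h2]

lemma Xi_mono (R : Input) (k : ℕ) : Monotone (Xi R k) := by
  cases k with
  | zero => exact monotone_id
  | succ k =>
    exact clockSum_mono (R := R) (Y := X R k) (w := fun v => ENNReal.ofReal (R.γ (k + 1) v))

lemma measurable_Xi_of_jointlyMeasurable {k n : ℕ} {Q : Ω → Input} (hQ : MeasurableUpTo n Q)
    (hk : k < n) (hX : JointlyMeasurable fun ω => X (Q ω) k) {t : Ω → ℝ≥0∞} (ht : Measurable t) :
    Measurable fun ω => Xi (Q ω) (k + 1) (t ω) :=
  measurable_clockSum (hQ.σ k hk) (hQ.T k hk) hX (fun v => (hQ.γ k hk v).ennreal_ofReal) ht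

lemma measurableSet_inInterval {k : ℕ} {Q : Ω → Input} {f : Ω → ℝ≥0∞ → ℝ≥0∞} {x : ℕ+}
    (hσ : ∀ i, Measurable fun ω => (Q ω).σ k x i) (hmono : ∀ ω, Monotone (f ω))
    (hf : ∀ s : Ω → ℝ≥0∞, Measurable s → Measurable fun ω => f ω (s ω)) {t : Ω → ℝ≥0∞}
    (ht : Measurable t) : MeasurableSet {ω | InInterval (Q ω) k (f ω) (t ω) x} := by
  have : {ω | InInterval (Q ω) k (f ω) (t ω) x} = ⋃ i : ℕ+,
      ({ω | 0 < ENNReal.ofReal ((Q ω).σ k x i)} ∩ (⋂ q : ℚ,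
        ({ω | ratPt q < ENNReal.ofReal ((Q ω).σ k x i)}ᶜ ∪ {ω | f ω (ratPt q) ≤ t ω})) ∩
          {ω | t ω < f ω (ENNReal.ofReal ((Q ω).σ k x i))}) := by
    ext ω
    simp only [mem_ofPred_eq, inInterval_iff (hmono ω), mem_iUnion, mem_inter_iff, mem_iInter,
      mem_union, mem_compl_iff, and_assoc]
    refine exists_congr fun i => and_congr_right fun _ => and_congr_left fun _ => ?_
    constructor
    · intro h q
      by_cases hq : ratPt q < ENNReal.ofReal ((Q ω).σ k x i)
      · exact Or.inr (h _ hq)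
      · exact Or.inl hq
    · intro h r hr
      obtain ⟨q, h1, h2⟩ := exists_ratPt_btwn hr
      exact (hmono ω h1.le).trans ((h q).resolve_left (not_not.2 h2))
  rw [this]
  have hs : ∀ i, Measurable fun ω => ENNReal.ofReal ((Q ω).σ k x i) :=
    fun i => (hσ i).ennreal_ofReal
  refine MeasurableSet.iUnion fun i => ((measurableSet_lt measurable_const (hs i)).inter
    (MeasurableSet.iInter fun q => ?_)).inter (measurableSet_lt ht (hf _ (hs i)))
  exact (measurableSet_lt measurable_const (hs i)).compl.union
    (measurableSet_le (hf _ measurable_const) ht)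

/-- The next process looks up the previous one at a random time, the inverse of a clock, so the
induction has to be joint in the realization and in time. -/
lemma jointlyMeasurable_X {n : ℕ} {Q : Ω → Input} (hQ : MeasurableUpTo n Q) {k : ℕ} (hk : k ≤ n) :
    JointlyMeasurable fun ω => X (Q ω) k := by
  induction k with
  | zero =>
    intro v
    have : {p : Ω × ℝ≥0∞ | X (Q p.1) 0 p.2 = toState v} = univ :=
      Set.eq_univ_of_forall fun p => Subsingleton.elim (α := Fin 0 → WithTop ℕ+) _ _
    rw [this]
    exact MeasurableSet.univ
  | succ k ih =>
    have hk' : k < n := hk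
    have ihk := ih hk'.le
    intro v
    obtain ⟨v, x, rfl⟩ : ∃ v' x, v = (Fin.snoc v' x : Fin (k + 1) → ℕ+) :=
      ⟨Fin.init v, v (Fin.last k), (Fin.snoc_init_self v).symm⟩
    have hXi : ∀ s : Ω × ℝ≥0∞ → ℝ≥0∞, Measurable s →
        Measurable fun p : Ω × ℝ≥0∞ => Xi (Q p.1) (k + 1) (s p) := by
      intro s hs
      refine measurable_Xi_of_jointlyMeasurable (hQ.comp measurable_fst) hk' ?_ hs
      intro v
      exact ihk.measurableSet (measurable_fst.comp measurable_fst) measurable_snd v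
    have hinv : Measurable fun p : Ω × ℝ≥0∞ => genInv (Xi (Q p.1) (k + 1)) p.2 :=
      measurable_genInv (fun p => Xi_mono _ _) (fun r => hXi _ measurable_const) measurable_snd
    have hin : ∀ y : ℕ+, MeasurableSet
        {p : Ω × ℝ≥0∞ | InInterval (Q p.1) (k + 1) (Xi (Q p.1) (k + 1)) p.2 y} := fun y =>
      measurableSet_inInterval (Q := fun p : Ω × ℝ≥0∞ => Q p.1)
        (fun i => (hQ.σ k hk' y i).comp measurable_fst) (fun p => Xi_mono _ _) hXi measurable_snd
    simp only [X_succ_eq_iff, lastCoord_eq_coe_iff]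
    have hlt : MeasurableSet
        {p : Ω × ℝ≥0∞ | ∀ y < x, ¬ InInterval (Q p.1) (k + 1) (Xi (Q p.1) (k + 1)) p.2 y} := by
      have : {p : Ω × ℝ≥0∞ | ∀ y < x, ¬ InInterval (Q p.1) (k + 1) (Xi (Q p.1) (k + 1)) p.2 y} =
          ⋂ y : ℕ+, ⋂ _ : y < x,
            {p : Ω × ℝ≥0∞ | InInterval (Q p.1) (k + 1) (Xi (Q p.1) (k + 1)) p.2 y}ᶜ := by
        ext p
        simp
      rw [this]
      exact MeasurableSet.iInter fun y => MeasurableSet.iInter fun _ => (hin y).compl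
    exact (ihk.measurableSet measurable_fst hinv v).inter ((hin x).inter hlt)

lemma measurable_Xi {n : ℕ} {Q : Ω → Input} (hQ : MeasurableUpTo n Q) {k : ℕ} (hk : k ≤ n)
    {t : Ω → ℝ≥0∞} (ht : Measurable t) : Measurable fun ω => Xi (Q ω) k (t ω) := by
  cases k with
  | zero => exact ht
  | succ k =>
    exact measurable_Xi_of_jointlyMeasurable hQ hk (jointlyMeasurable_X hQ (by omega)) ht

lemma theta_succ_of_le (R : Input) {k n : ℕ} (h : k ≤ n + 1) (t : ℝ≥0∞) :
    theta R k (n + 1) t = Xi R (n + 1) (theta R k n t) := by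
  simp [theta, h]

lemma theta_of_lt (R : Input) {k n : ℕ} (h : n < k) (t : ℝ≥0∞) : theta R k n t = t := by
  cases n with
  | zero => rfl
  | succ n => simp [theta, not_le.2 h]

lemma theta_mono (R : Input) (k n : ℕ) : Monotone (theta R k n) := by
  induction n with
  | zero => exact monotone_id
  | succ n ih =>
    by_cases h : k ≤ n + 1
    · intro s t hst
      rw [theta_succ_of_le R h, theta_succ_of_le R h]
      exact Xi_mono _ _ (ih hst)
    · intro s t hst
      rwa [theta_of_lt R (not_le.1 h), theta_of_lt R (not_le.1 h)]

lemma measurable_theta {n : ℕ} {Q : Ω → Input} (hQ : MeasurableUpTo n Q) (k : ℕ) (t : ℝ≥0∞) :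
    Measurable fun ω => theta (Q ω) k n t := by
  induction n with
  | zero => exact measurable_const
  | succ n ih =>
    by_cases h : k ≤ n + 1
    · simp_rw [theta_succ_of_le _ h]
      exact measurable_Xi hQ le_rfl (ih (hQ.mono (by omega)))
    · simp_rw [theta_of_lt _ (not_le.1 h)]
      exact measurable_const

end Measurability

/-! ### The independent blocks of the input -/

/-- The index of a block of the input: the marks of the offspring of a node, the marks of one of the
Poisson processes, or one of the exponential variables. -/
abbrev BlockIndex : Type := ((k : ℕ) × (Fin k → ℕ+)) ⊕ (ℕ × ℕ+) ⊕ (ℕ × ℕ+ × ℕ+)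

/-- The σ-algebra of a block. -/
abbrev block {Ω : Type*} (R : Ω → Input) : BlockIndex → MeasurableSpace Ω :=
  Sum.elim
    (fun p : (k : ℕ) × (Fin k → ℕ+) =>
      MeasurableSpace.comap
        (fun ω (x : ℕ+) => (R ω).γ (p.1 + 1) (Fin.snoc p.2 x)) inferInstance)
    (Sum.elim
      (fun p : ℕ × ℕ+ =>
        MeasurableSpace.comap (fun ω (i : ℕ+) => (R ω).σ (p.1 + 1) p.2 i) inferInstance)
      (fun p : ℕ × ℕ+ × ℕ+ =>
        MeasurableSpace.comap (fun ω => (R ω).T (p.1 + 1) p.2.1 p.2.2) inferInstance))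

/-- The σ-algebra of a set of blocks. -/
abbrev blocks {Ω : Type*} (R : Ω → Input) (S : Set BlockIndex) : MeasurableSpace Ω :=
  ⨆ i ∈ S, block R i

lemma blocks_mono {Ω : Type*} (R : Ω → Input) {S S' : Set BlockIndex} (h : S ⊆ S') :
    blocks R S ≤ blocks R S' := biSup_mono h

lemma block_le_blocks {Ω : Type*} (R : Ω → Input) {S : Set BlockIndex} {i : BlockIndex}
    (h : i ∈ S) : block R i ≤ blocks R S := le_biSup (block R) h

lemma measurable_block_γ {Ω : Type*} (R : Ω → Input) {k : ℕ} (v : Fin k → ℕ+) (x : ℕ+) :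
    Measurable[block R (Sum.inl ⟨k, v⟩)] fun ω => (R ω).γ (k + 1) (Fin.snoc v x) :=
  (measurable_pi_apply x).comp
    (comap_measurable fun ω (x : ℕ+) => (R ω).γ (k + 1) (Fin.snoc v x))

lemma measurable_block_σ {Ω : Type*} (R : Ω → Input) (k : ℕ) (x i : ℕ+) :
    Measurable[block R (Sum.inr (Sum.inl (k, x)))] fun ω => (R ω).σ (k + 1) x i :=
  (measurable_pi_apply i).comp (comap_measurable fun ω (i : ℕ+) => (R ω).σ (k + 1) x i)

lemma measurable_block_T {Ω : Type*} (R : Ω → Input) (k : ℕ) (x i : ℕ+) :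
    Measurable[block R (Sum.inr (Sum.inr (k, x, i)))] fun ω => (R ω).T (k + 1) x i :=
  comap_measurable _

lemma measurable_blocks_γ {Ω : Type*} (R : Ω → Input) {S : Set BlockIndex} {k : ℕ}
    {v : Fin k → ℕ+} (h : Sum.inl ⟨k, v⟩ ∈ S) (x : ℕ+) :
    Measurable[blocks R S] fun ω => (R ω).γ (k + 1) (Fin.snoc v x) :=
  (measurable_block_γ R v x).mono (block_le_blocks R h) le_rfl

lemma measurable_blocks_σ {Ω : Type*} (R : Ω → Input) {S : Set BlockIndex} {k : ℕ} {x : ℕ+}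
    (h : Sum.inr (Sum.inl (k, x)) ∈ S) (i : ℕ+) :
    Measurable[blocks R S] fun ω => (R ω).σ (k + 1) x i :=
  (measurable_block_σ R k x i).mono (block_le_blocks R h) le_rfl

lemma measurable_blocks_T {Ω : Type*} (R : Ω → Input) {S : Set BlockIndex} {k : ℕ} {x i : ℕ+}
    (h : Sum.inr (Sum.inr (k, x, i)) ∈ S) :
    Measurable[blocks R S] fun ω => (R ω).T (k + 1) x i :=
  (measurable_block_T R k x i).mono (block_le_blocks R h) le_rfl

/-- The blocks of the marks of the offspring of nodes. -/
def gammaBlocks : Set BlockIndex := range Sum.inl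

/-- The blocks of the Poisson processes and of the exponential variables of level `k + 1`. -/
def visitBlocks (k : ℕ) : Set BlockIndex :=
  {i | match i with
    | Sum.inl _ => False
    | Sum.inr (Sum.inl p) => p.1 = k
    | Sum.inr (Sum.inr p) => p.1 = k}

/-- The blocks of the levels `1, …, n`. -/
def pastBlocks (n : ℕ) : Set BlockIndex :=
  {i | match i with
    | Sum.inl p => p.1 < n
    | Sum.inr (Sum.inl p) => p.1 < n
    | Sum.inr (Sum.inr p) => p.1 < n}

/-- The blocks of the marks of the offspring of the nodes that descend from `v`. -/
def subtreeBlocks {k : ℕ} (v : Fin k → ℕ+) : Set BlockIndex :=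
  {i | ∃ (j : ℕ) (z : Fin j → ℕ+) (h : k ≤ j), i = Sum.inl ⟨j, z⟩ ∧ Fin.take k h z = v}

/-- The blocks of the marks of the offspring of the nodes at depth `n` or more. -/
def gammaBlocksFrom (n : ℕ) : Set BlockIndex :=
  {i | ∃ (j : ℕ) (z : Fin j → ℕ+), n ≤ j ∧ i = Sum.inl ⟨j, z⟩}

/-- The blocks of the marks of the offspring of the nodes at depth `n`. -/
def gammaBlocksAt (n : ℕ) : Set BlockIndex :=
  {i | ∃ z : Fin n → ℕ+, i = Sum.inl ⟨n, z⟩}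

lemma measurableUpTo_blocks {Ω : Type*} (R : Ω → Input) {n : ℕ} {S : Set BlockIndex}
    (hS : pastBlocks n ⊆ S) : @MeasurableUpTo Ω (blocks R S) n R := by
  refine @MeasurableUpTo.mk Ω (blocks R S) n R (fun k hk v => ?_) (fun k hk x i => ?_)
    (fun k hk x i => ?_)
  · rw [← Fin.snoc_init_self v]
    exact measurable_blocks_γ R (hS (show (Sum.inl ⟨k, _⟩ : BlockIndex) ∈ pastBlocks n from hk)) _
  · exact measurable_blocks_σ R
      (hS (show (Sum.inr (Sum.inl (k, x)) : BlockIndex) ∈ pastBlocks n from hk)) _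
  · exact measurable_blocks_T R
      (hS (show (Sum.inr (Sum.inr (k, x, i)) : BlockIndex) ∈ pastBlocks n from hk))

lemma pastBlocks_mono {m n : ℕ} (h : m ≤ n) : pastBlocks m ⊆ pastBlocks n := by
  rintro (p | p | p) hp <;> exact lt_of_lt_of_le hp h

lemma disjoint_past_visit (n : ℕ) : Disjoint (pastBlocks n ∪ gammaBlocks) (visitBlocks n) := by
  rw [Set.disjoint_left]
  rintro (p | p | p) (hp | hp) hp'
  · exact hp'
  · exact hp'
  · exact (ne_of_lt hp) hp'
  · obtain ⟨q, hq⟩ := hp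
    cases hq
  · exact (ne_of_lt hp) hp'
  · obtain ⟨q, hq⟩ := hp
    cases hq

lemma gammaBlocksFrom_subset (n : ℕ) : gammaBlocksFrom n ⊆ gammaBlocks := by
  rintro _ ⟨j, z, -, rfl⟩
  exact mem_range_self _

lemma disjoint_past_gammaBlocksFrom (n : ℕ) :
    Disjoint (pastBlocks n) (gammaBlocksFrom n) := by
  rw [Set.disjoint_left]
  rintro _ hp ⟨j, z, hj, rfl⟩
  exact absurd hj (not_le.2 hp)

lemma subtreeBlocks_subset {k : ℕ} (v : Fin k → ℕ+) : subtreeBlocks v ⊆ gammaBlocksFrom k := by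
  rintro _ ⟨j, z, h, rfl, -⟩
  exact ⟨j, z, h, rfl⟩

lemma gammaBlocksAt_subset (k : ℕ) : gammaBlocksAt k ⊆ gammaBlocksFrom k := by
  rintro _ ⟨z, rfl⟩
  exact ⟨k, z, le_rfl, rfl⟩

lemma gammaBlocksFrom_anti {m n : ℕ} (h : m ≤ n) : gammaBlocksFrom n ⊆ gammaBlocksFrom m := by
  rintro _ ⟨j, z, hj, rfl⟩
  exact ⟨j, z, h.trans hj, rfl⟩

lemma disjoint_gammaBlocksAt_from (k : ℕ) :
    Disjoint (gammaBlocksAt k) (gammaBlocksFrom (k + 1)) := by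
  rw [Set.disjoint_left]
  rintro _ ⟨z, rfl⟩ ⟨j, z', hj, h⟩
  have := congrArg Sigma.fst (Sum.inl_injective h)
  simp only at this
  omega

lemma disjoint_subtreeBlocks {k : ℕ} {v w : Fin k → ℕ+} (h : v ≠ w) :
    Disjoint (subtreeBlocks v) (subtreeBlocks w) := by
  rw [Set.disjoint_left]
  rintro _ ⟨j, z, hj, rfl, hz⟩ ⟨j', z', hj', he, hz'⟩
  cases Sum.inl_injective he
  exact h (hz.symm.trans hz')

namespace IsRandomInput

variable {Ω : Type*} {mΩ : MeasurableSpace Ω} {P : Measure Ω} {α : ℕ → ℝ} {R : Ω → Input}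

lemma block_le (hR : IsRandomInput P α R) (i : BlockIndex) : block R i ≤ mΩ := by
  rcases i with p | p | p
  · exact (measurable_pi_lambda _ fun x => hR.measurable_γ _ _).comap_le
  · exact (measurable_pi_lambda _ fun x => hR.measurable_σ _ _ _).comap_le
  · exact (hR.measurable_T _ _ _).comap_le

lemma blocks_le (hR : IsRandomInput P α R) (S : Set BlockIndex) : blocks R S ≤ mΩ :=
  iSup₂_le fun i _ => hR.block_le i

lemma iIndep_block (hR : IsRandomInput P α R) : iIndep (block R) P := hR.indep

lemma indep_blocks (hR : IsRandomInput P α R) {S S' : Set BlockIndex} (h : Disjoint S S') :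
    Indep (blocks R S) (blocks R S') P :=
  indep_iSup_of_disjoint hR.block_le hR.iIndep_block h

lemma measurableUpTo (hR : IsRandomInput P α R) (n : ℕ) : MeasurableUpTo n R :=
  ⟨fun _ _ _ => hR.measurable_γ _ _, fun _ _ _ _ => hR.measurable_σ _ _ _,
    fun _ _ _ _ => hR.measurable_T _ _ _⟩

end IsRandomInput

/-! ### Integrating out the Poisson processes and the exponential variables of a level -/

/-- The time in `(a, b]` that the process spends at `v`. -/
def occupation {k : ℕ} (Y : ℝ≥0∞ → (Fin k → WithTop ℕ+)) (a b : ℝ≥0∞) (v : Fin k → ℕ+) : ℝ≥0∞ :=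
  volume (Ioi 0 ∩ ENNReal.ofReal ⁻¹' (Ioc a b ∩ {r | Y r = toState v}))

/-- Since `psi 0 = 0`, only the times in the window spent at genuine nodes contribute, and the
integrand is constant on the times spent at each node. -/
lemma lintegral_psi_window {k : ℕ} {Y : ℝ≥0∞ → (Fin k → WithTop ℕ+)}
    (hY : ∀ v, MeasurableSet {r | Y r = toState v}) (f : (Fin k → ℕ+) → ℝ≥0∞) (a b : ℝ≥0∞) :
    ∫⁻ s in Ioi (0 : ℝ), psi ((Ioc a b).indicator (fun r => extendZero f (Y r))
      (ENNReal.ofReal s)) = ∑' v, occupation Y a b v * psi (f v) := by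
  have hm : ∀ v, MeasurableSet (ENNReal.ofReal ⁻¹' (Ioc a b ∩ {r | Y r = toState v})) := fun v =>
    ENNReal.measurable_ofReal (measurableSet_Ioc.inter (hY v))
  have h1 : ∀ s : ℝ, psi ((Ioc a b).indicator (fun r => extendZero f (Y r)) (ENNReal.ofReal s)) =
      ∑' v, (ENNReal.ofReal ⁻¹' (Ioc a b ∩ {r | Y r = toState v})).indicator
        (fun _ => psi (f v)) s := by
    intro s
    by_cases hs : ENNReal.ofReal s ∈ Ioc a b
    · rw [Set.indicator_of_mem hs]
      by_cases hv : ∃ v, Y (ENNReal.ofReal s) = toState v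
      · obtain ⟨v, hv⟩ := hv
        rw [hv, extendZero_toState, tsum_eq_single v]
        · rw [Set.indicator_of_mem]
          exact ⟨hs, hv⟩
        · intro w hw
          rw [Set.indicator_of_notMem]
          rintro ⟨-, h⟩
          exact hw (toState_injective (h.symm.trans hv))
      · rw [extendZero, if_neg (by rwa [← exists_toState_eq_iff]), psi_zero]
        symm
        rw [ENNReal.tsum_eq_zero]
        intro v
        rw [Set.indicator_of_notMem]
        rintro ⟨-, h⟩
        exact hv ⟨v, h⟩
    · rw [Set.indicator_of_notMem hs, psi_zero]
      symm
      rw [ENNReal.tsum_eq_zero]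
      intro v
      rw [Set.indicator_of_notMem]
      rintro ⟨h, -⟩
      exact hs h
  simp_rw [h1]
  rw [lintegral_tsum fun v => (measurable_const.indicator (hm v)).aemeasurable]
  refine tsum_congr fun v => ?_
  rw [lintegral_indicator_const (hm v), Measure.restrict_apply (hm v), mul_comm, Set.inter_comm]
  rfl

/-- The two arguments live on separate spaces so that `Ω` can later be inserted twice with different
σ-algebras, as `lintegral_diag_of_indep` requires. -/
lemma measurable_expNeg_coupled {Ω₁ Ω₂ : Type*} [MeasurableSpace Ω₁] [MeasurableSpace Ω₂]
    {c : ℕ+ → ℝ → ℝ≥0∞} {σ : Ω₁ → ℕ+ → ℕ+ → ℝ} {T : Ω₂ → ℕ+ → ℕ+ → ℝ}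
    (hc : ∀ x, Measurable (c x)) (hσ : ∀ x i, Measurable fun ω => σ ω x i)
    (hT : ∀ x i, Measurable fun ω => T ω x i) :
    Measurable (Function.uncurry fun ω ω' =>
      expNeg (∑' (x : ℕ+) (i : ℕ+), c x (σ ω x i) * ENNReal.ofReal (T ω' x i))) := by
  refine measurable_expNeg.comp
    (Measurable.tsum fun x => Measurable.tsum fun i => Measurable.mul ?_ ?_)
  · exact (hc x).comp ((hσ x i).comp measurable_fst)
  · exact ((hT x i).comp measurable_snd).ennreal_ofReal

lemma measurable_tsum_comp {Ω : Type*} [MeasurableSpace Ω] {f : ℝ → ℝ≥0∞} {p : ℕ+ → Ω → ℝ}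
    (hf : Measurable f) (hp : ∀ i, Measurable (p i)) : Measurable fun ω => ∑' i, f (p i ω) :=
  Measurable.tsum fun i => hf.comp (hp i)

lemma measurable_mul_expNeg_coupled {Ω₁ Ω₂ : Type*} [MeasurableSpace Ω₁] [MeasurableSpace Ω₂]
    {g : Ω₁ → ℝ≥0∞} {c : Ω₁ → ℕ+ → ℝ → ℝ≥0∞} {σ T : Ω₂ → ℕ+ → ℕ+ → ℝ} (hg : Measurable g)
    (hc : ∀ x, Measurable fun p : Ω₁ × ℝ => c p.1 x p.2)
    (hσ : ∀ x i, Measurable fun ω => σ ω x i) (hT : ∀ x i, Measurable fun ω => T ω x i) :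
    Measurable (Function.uncurry fun ω ω' =>
      g ω * expNeg (∑' (x : ℕ+) (i : ℕ+), c ω x (σ ω' x i) * ENNReal.ofReal (T ω' x i))) := by
  refine (hg.comp measurable_fst).mul (measurable_expNeg.comp
    (Measurable.tsum fun x => Measurable.tsum fun i => Measurable.mul ?_ ?_))
  · exact (hc x).comp (measurable_fst.prodMk ((hσ x i).comp measurable_snd))
  · exact ((hT x i).comp measurable_snd).ennreal_ofReal

namespace IsRandomInput

variable {Ω : Type*} {mΩ : MeasurableSpace Ω} {P : Measure Ω} [IsProbabilityMeasure P]
  {α : ℕ → ℝ} {R : Ω → Input}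

/-- With the marks `σ` frozen, each exponential variable contributes a factor `(1 + c)⁻¹`. The
product is `e^{-f}` summed over the Poisson points with `f = -log (1 + c)⁻¹`, and in the Laplace
functional `1 - e^{-f}` is exactly `psi c`. -/
lemma lintegral_expNeg_visits (hR : IsRandomInput P α R) (k : ℕ) {c : ℕ+ → ℝ → ℝ≥0∞}
    (hc : ∀ x, Measurable (c x)) :
    ∫⁻ ω, expNeg (∑' (x : ℕ+) (i : ℕ+),
      c x ((R ω).σ (k + 1) x i) * ENNReal.ofReal ((R ω).T (k + 1) x i)) ∂P =
        expNeg (∑' x, ∫⁻ s in Ioi (0 : ℝ), psi (c x s)) := by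
  set S₁ : Set BlockIndex := range fun p : ℕ+ => Sum.inr (Sum.inl (k, p)) with hS₁
  set S₂ : Set BlockIndex := range fun p : ℕ+ × ℕ+ => Sum.inr (Sum.inr (k, p)) with hS₂
  have hdisj : Disjoint S₁ S₂ := by
    rw [Set.disjoint_left]
    rintro _ ⟨p, rfl⟩ ⟨q, hq⟩
    cases hq
  have hσ₁ : ∀ x i, Measurable[blocks R S₁] fun ω => (R ω).σ (k + 1) x i := fun x i =>
    measurable_blocks_σ R (S := S₁) ⟨x, rfl⟩ i
  have hT₂ : ∀ x i, Measurable[blocks R S₂] fun ω => (R ω).T (k + 1) x i := fun x i =>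
    measurable_blocks_T R (S := S₂) ⟨(x, i), rfl⟩
  have hmeas : Measurable[(blocks R S₁).prod (blocks R S₂)] (Function.uncurry fun ω ω' =>
      expNeg (∑' (x : ℕ+) (i : ℕ+),
        c x ((R ω).σ (k + 1) x i) * ENNReal.ofReal ((R ω').T (k + 1) x i))) := by
    exact @measurable_expNeg_coupled Ω Ω (blocks R S₁) (blocks R S₂) c _ _ hc hσ₁ hT₂
  rw [lintegral_diag_of_indep (hR.blocks_le S₁) (hR.blocks_le S₂) (hR.indep_blocks hdisj) hmeas]
  have hlog : Measurable fun y : ℝ≥0∞ => negLog (1 + y)⁻¹ := by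
    unfold negLog
    exact measurable_ereal_toENNReal.comp
      (ENNReal.measurable_log.comp (by fun_prop)).neg
  have hle : ∀ y : ℝ≥0∞, (1 + y)⁻¹ ≤ 1 := fun y => ENNReal.inv_le_one.2 (by simp)
  have hinner : ∀ ω, ∫⁻ ω', expNeg (∑' (x : ℕ+) (i : ℕ+),
      c x ((R ω).σ (k + 1) x i) * ENNReal.ofReal ((R ω').T (k + 1) x i)) ∂P =
      expNeg (∑' (x : ℕ+) (i : ℕ+), negLog (1 + c x ((R ω).σ (k + 1) x i))⁻¹) := by
    intro ω
    simp_rw [← ENNReal.tsum_prod]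
    refine lintegral_expNeg_tsum (m := fun p : ℕ+ × ℕ+ => block R (Sum.inr (Sum.inr (k, p))))
      (fun p => hR.block_le _) (hR.iIndep_block.precomp fun p q h => by simpa using h)
      (fun p => (measurable_block_T R k p.1 p.2).ennreal_ofReal.const_mul _) fun p => ?_
    rw [expNeg_negLog (hle _), ← lintegral_expNeg_expMeasure, ← hR.T_law k p.1 p.2]
    exact (lintegral_map (measurable_expNeg.comp (ENNReal.measurable_ofReal.const_mul _))
      (hR.measurable_T _ _ _)).symm
  simp_rw [hinner]
  refine lintegral_expNeg_tsum (m := fun x : ℕ+ => block R (Sum.inr (Sum.inl (k, x))))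
    (fun p => hR.block_le _) (hR.iIndep_block.precomp fun p q h => by simpa using h)
    (fun x => @measurable_tsum_comp Ω (block R (Sum.inr (Sum.inl (k, x)))) _ _
      (hlog.comp (hc x)) (measurable_block_σ R k x)) fun x => ?_
  refine ((hR.σ_poisson k x).laplace (fun i => hR.measurable_σ _ _ _)
    (hlog.comp (hc x))).trans ?_
  congr 1
  refine lintegral_congr fun s => ?_
  rw [Function.comp_apply, expNeg_negLog (hle _), psi]

/-- The conditional Laplace transform of a window of a clock given everything but the Poisson
processes and the exponential variables of its level. -/
theorem lintegral_expNeg_windowSum (hR : IsRandomInput P α R) {k : ℕ} {S : Set BlockIndex}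
    (hS : Disjoint S (visitBlocks k)) {Y : Ω → ℝ≥0∞ → (Fin k → WithTop ℕ+)}
    (hY : @JointlyMeasurable Ω (blocks R S) k Y) {w : Ω → (Fin (k + 1) → ℕ+) → ℝ≥0∞}
    (hw : ∀ v, Measurable[blocks R S] fun ω => w ω v) {a b g : Ω → ℝ≥0∞}
    (ha : Measurable[blocks R S] a) (hb : Measurable[blocks R S] b)
    (hg : Measurable[blocks R S] g) :
    ∫⁻ ω, g ω * expNeg (windowSum (R ω) (Y ω) (w ω) (a ω) (b ω)) ∂P =
      ∫⁻ ω, g ω * expNeg (∑' (v : Fin k → ℕ+),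
        occupation (Y ω) (a ω) (b ω) v * ∑' x, psi (w ω (Fin.snoc v x))) ∂P := by
  set c : Ω → ℕ+ → ℝ → ℝ≥0∞ := fun ω x s => (Ioc (a ω) (b ω)).indicator
    (fun s => extendZero (fun v => w ω (Fin.snoc v x)) (Y ω s)) (ENNReal.ofReal s) with hcdef
  have hYω : ∀ ω v, MeasurableSet {r | Y ω r = toState v} := by
    intro ω v
    exact @JointlyMeasurable.measurableSet Ω (blocks R S) k Y hY ℝ≥0∞ _ (fun _ => ω) id
      measurable_const measurable_id v
  have hc : ∀ x, Measurable[(blocks R S).prod inferInstance] fun p : Ω × ℝ => c p.1 x p.2 := by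
    intro x
    let _ : MeasurableSpace Ω := blocks R S
    have hs : Measurable fun p : Ω × ℝ => ENNReal.ofReal p.2 := by fun_prop
    simp only [hcdef, Set.indicator, Set.mem_Ioc]
    refine Measurable.ite ((measurableSet_lt (ha.comp measurable_fst) hs).inter
      (measurableSet_le hs (hb.comp measurable_fst))) ?_ measurable_const
    exact measurable_extendZero (fun v => hY.measurableSet measurable_fst hs v)
      fun v => (hw _).comp measurable_fst
  have hF := @measurable_mul_expNeg_coupled Ω Ω (blocks R S) (blocks R (visitBlocks k)) g c
    (fun ω => (R ω).σ (k + 1)) (fun ω => (R ω).T (k + 1)) hg hc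
    (fun x i => measurable_blocks_σ R (S := visitBlocks k) (k := k) rfl i)
    (fun x i => measurable_blocks_T R (S := visitBlocks k) (k := k) rfl)
  have h1 := lintegral_diag_of_indep (hR.blocks_le S) (hR.blocks_le (visitBlocks k))
    (hR.indep_blocks hS) hF
  refine h1.trans (lintegral_congr fun ω => ?_)
  have hcω : ∀ x, Measurable (c ω x) := fun x => by
    exact (hc x).comp (@measurable_prodMk_left Ω ℝ (blocks R S) _ ω)
  rw [lintegral_const_mul _ (by
    refine measurable_expNeg.comp (Measurable.tsum fun x => Measurable.tsum fun i => ?_)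
    exact ((hcω x).comp (hR.measurable_σ _ _ _)).mul (hR.measurable_T _ _ _).ennreal_ofReal),
    hR.lintegral_expNeg_visits k hcω]
  congr 2
  simp_rw [hcdef, lintegral_psi_window (hYω ω)]
  rw [ENNReal.tsum_comm]
  exact tsum_congr fun v => ENNReal.tsum_mul_left

end IsRandomInput

/-! ### Convergence of submartingales of the form `e^{-D_n}` -/

/-- A submartingale bounded by `1` converges a.s.; `expNeg` is inverted on its limit in `[0, 1]`,
the value `0` corresponding to `c = ∞`. -/
lemma ae_exists_tendsto_of_expNeg_submartingale {Ω : Type*} {mΩ : MeasurableSpace Ω}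
    {P : Measure Ω} [IsProbabilityMeasure P] {𝓢 : ℕ → MeasurableSpace Ω} (hmono : Monotone 𝓢)
    (hle : ∀ n, 𝓢 n ≤ mΩ) {D : ℕ → Ω → ℝ≥0∞} (hD : ∀ n, Measurable[𝓢 n] (D n))
    (h : ∀ n A, MeasurableSet[𝓢 n] A →
      ∫⁻ ω in A, expNeg (D n ω) ∂P ≤ ∫⁻ ω in A, expNeg (D (n + 1) ω) ∂P) :
    ∀ᵐ ω ∂P, ∃ c, Tendsto (fun n => D n ω) atTop (𝓝 c) := by
  set ℱ : Filtration ℕ mΩ := ⟨𝓢, hmono, hle⟩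
  set f : ℕ → Ω → ℝ := fun n ω => (expNeg (D n ω)).toReal with hf
  have hfm : ∀ n, Measurable[𝓢 n] (f n) := fun n =>
    (measurable_expNeg.comp (hD n)).ennreal_toReal
  have hf1 : ∀ n ω, f n ω ≤ 1 := fun n ω => by
    simpa using ENNReal.toReal_mono ENNReal.one_ne_top (expNeg_le_one (D n ω))
  have hint : ∀ n, Integrable (f n) P := fun n =>
    Integrable.of_bound ((hfm n).mono (hle n) le_rfl).aestronglyMeasurable 1
      (Eventually.of_forall fun ω => by
        rw [Real.norm_of_nonneg ENNReal.toReal_nonneg]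
        exact hf1 n ω)
  have hset : ∀ n A, ∫ ω in A, f n ω ∂P = (∫⁻ ω in A, expNeg (D n ω) ∂P).toReal := by
    intro n A
    rw [integral_toReal]
    · exact ((measurable_expNeg.comp (hD n)).mono (hle n) le_rfl).aemeasurable
    · exact Eventually.of_forall fun ω => (expNeg_le_one _).trans_lt ENNReal.one_lt_top
  have hsub : Submartingale f ℱ P := by
    refine submartingale_of_setIntegral_le_succ (fun n => (hfm n).stronglyMeasurable) hint ?_
    intro n A hA
    rw [hset, hset]
    refine ENNReal.toReal_mono ?_ (h n A hA)
    refine ne_top_of_le_ne_top (b := ∫⁻ ω in A, 1 ∂P) ?_ (lintegral_mono fun ω => expNeg_le_one _)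
    simp
  have hconv := hsub.exists_ae_tendsto_of_bdd (R := 1) fun n => by
    have := eLpNorm_le_of_ae_bound (p := 1) (μ := P) (f := f n) (C := 1)
      (Eventually.of_forall fun ω => by
        rw [Real.norm_of_nonneg ENNReal.toReal_nonneg]
        exact hf1 n ω)
    simpa using this
  filter_upwards [hconv] with ω hω
  obtain ⟨c, hc⟩ := hω
  have hc1 : c ≤ 1 := le_of_tendsto' hc fun n => hf1 n ω
  have hlim := ENNReal.tendsto_ofReal hc
  simp only [hf, ENNReal.ofReal_toReal (expNeg_ne_top _)] at hlim
  rw [← expNeg_negLog (p := ENNReal.ofReal c) (by simpa using hc1), tendsto_expNeg_iff] at hlim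
  exact ⟨_, hlim⟩

/-! ### Sums over subtrees -/

/-- The sum of `(γ_{k+1}(y|_{k+1}) ⋯ γ_{k+m}(y)) ^ β * f y` over the nodes `y` at depth `k + m` that
descend from the node `v` at depth `k`. -/
def subtreeSum (R : Input) (β : ℝ) (f : (k : ℕ) → (Fin k → ℕ+) → ℝ≥0∞) :
    ℕ → (k : ℕ) → (Fin k → ℕ+) → ℝ≥0∞
  | 0 => fun k v => f k v
  | m + 1 => fun k v => ∑' x : ℕ+, ENNReal.ofReal (R.γ (k + 1) (Fin.snoc v x)) ^ β *
      subtreeSum R β f m (k + 1) (Fin.snoc v x)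

/-- The sum of `γ_{k+1}(v x) ^ β * f (v x)` over the offspring `v x` of `v`. -/
def offspringSum (R : Input) (β : ℝ) (f : (k : ℕ) → (Fin k → ℕ+) → ℝ≥0∞) (k : ℕ)
    (v : Fin k → ℕ+) : ℝ≥0∞ :=
  ∑' x : ℕ+, ENNReal.ofReal (R.γ (k + 1) (Fin.snoc v x)) ^ β * f (k + 1) (Fin.snoc v x)

/-- The recursion defining `subtreeSum` splits off the first generation; here the last one is split
off, which is the one that the martingale argument integrates out. -/
lemma subtreeSum_succ (R : Input) (β : ℝ) (f : (k : ℕ) → (Fin k → ℕ+) → ℝ≥0∞) (m k : ℕ)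
    (v : Fin k → ℕ+) :
    subtreeSum R β f (m + 1) k v = subtreeSum R β (offspringSum R β f) m k v := by
  induction m generalizing k v with
  | zero => rfl
  | succ m ih =>
    rw [subtreeSum]
    simp_rw [ih]
    rfl

/-- The limit of the sums over the subtree of `v`, which is `W(v)` if the marks are positive. -/
def subtreeLimit (α : ℕ → ℝ) (R : Input) {k : ℕ} (v : Fin k → ℕ+) : ℝ≥0∞ :=
  limsup (fun m : ℕ => subtreeSum R (α (k + m + 1)) (fun _ _ => 1) m k v) atTop

lemma gammaBar_snoc (R : Input) {k : ℕ} (v : Fin k → ℕ+) (x : ℕ+) :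
    gammaBar R (Fin.snoc v x : Fin (k + 1) → ℕ+) =
      gammaBar R v * R.γ (k + 1) (Fin.snoc v x) := by
  unfold gammaBar
  rw [Fin.prod_univ_castSucc]
  congr 1
  · refine Finset.prod_congr rfl fun j _ => ?_
    congr 1
    funext i
    have : (Fin.castLE (Nat.succ_le_of_lt (Fin.castSucc j).isLt) i : Fin (k + 1)) =
      Fin.castSucc (Fin.castLE (Nat.succ_le_of_lt j.isLt) i) := rfl
    simp only [Fin.take]
    rw [this, Fin.snoc_castSucc]

/-- The nodes at depth `n + 1` that descend from `v` are the offspring of those at depth `n`. -/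
def descendantsSuccEquiv {k n : ℕ} (h : k ≤ n) (h' : k ≤ n + 1) (v : Fin k → ℕ+) :
    {y : Fin (n + 1) → ℕ+ // Fin.take k h' y = v} ≃
      {y : Fin n → ℕ+ // Fin.take k h y = v} × ℕ+ where
  toFun y := (⟨Fin.init y.1,
    (show Fin.take k h (Fin.init y.1) = Fin.take k h' y.1 from rfl).trans y.2⟩, y.1 (Fin.last n))
  invFun p := ⟨Fin.snoc p.1.1 p.2, by
    refine Eq.trans ?_ p.1.2
    funext i
    have : (Fin.castLE h' i : Fin (n + 1)) = Fin.castSucc (Fin.castLE h i) := rfl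
    simp only [Fin.take]
    rw [this, Fin.snoc_castSucc]⟩
  left_inv y := Subtype.ext (Fin.snoc_init_self y.1)
  right_inv p := by
    refine Prod.ext (Subtype.ext ?_) ?_
    · exact Fin.init_snoc (α := fun _ => ℕ+) p.2 p.1.1
    · exact Fin.snoc_last (α := fun _ => ℕ+) p.2 p.1.1

/-- Induction on the last generation, with `f` general because each step replaces it by its
offspring sums. Positivity of the marks lets the power of the quotient factor along a path. -/
lemma tsum_descendants_eq_subtreeSum {R : Input}
    (hγ : ∀ (k : ℕ) (v : Fin k → ℕ+) (x : ℕ+), 0 < R.γ (k + 1) (Fin.snoc v x)) (β : ℝ)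
    (f : (k : ℕ) → (Fin k → ℕ+) → ℝ≥0∞) (m k : ℕ) (v : Fin k → ℕ+) :
    ∑' y : {y : Fin (k + m) → ℕ+ // Fin.take k (Nat.le_add_right k m) y = v},
      ENNReal.ofReal ((gammaBar R y.1 / gammaBar R v) ^ β) * f (k + m) y.1 =
        subtreeSum R β f m k v := by
  have hpos : ∀ (n : ℕ) (y : Fin n → ℕ+), 0 < gammaBar R y := by
    intro n y
    refine Finset.prod_pos fun j _ => ?_
    rw [← Fin.snoc_init_self (Fin.take (j + 1) (Nat.succ_le_of_lt j.isLt) y)]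
    exact hγ _ _ _
  induction m generalizing f with
  | zero =>
    rw [tsum_eq_single ⟨v, rfl⟩]
    · simp [subtreeSum, div_self (hpos k v).ne']
    · rintro ⟨y, hy⟩ hne
      exact absurd (Subtype.ext hy) hne
  | succ m ih =>
    rw [subtreeSum_succ, ← ih]
    refine ((descendantsSuccEquiv (Nat.le_add_right k m)
      (Nat.le_add_right k (m + 1)) v).symm.tsum_eq _).symm.trans ?_
    rw [ENNReal.tsum_prod']
    refine tsum_congr fun y => ?_
    rw [offspringSum, ← ENNReal.tsum_mul_left]
    refine tsum_congr fun x => ?_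
    have e : ((descendantsSuccEquiv (Nat.le_add_right k m) (Nat.le_add_right k (m + 1)) v).symm
        (y, x)).1 = (Fin.snoc y.1 x : Fin (k + m + 1) → ℕ+) := rfl
    rw [e, ← mul_assoc]
    have h1 : 0 < R.γ (k + m + 1) (Fin.snoc y.1 x) := hγ _ _ _
    have h2 : 0 < gammaBar R y.1 / gammaBar R v := div_pos (hpos _ _) (hpos _ _)
    congr 1
    rw [show gammaBar R (Fin.snoc y.1 x : Fin (k + m + 1) → ℕ+) = _ from gammaBar_snoc R y.1 x,
      mul_div_right_comm, Real.mul_rpow h2.le h1.le, ENNReal.ofReal_mul (Real.rpow_nonneg h2.le _),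
      ENNReal.ofReal_rpow_of_pos h1]

lemma W_eq_subtreeLimit {R : Input}
    (hγ : ∀ (k : ℕ) (v : Fin k → ℕ+) (x : ℕ+), 0 < R.γ (k + 1) (Fin.snoc v x)) (α : ℕ → ℝ)
    {k : ℕ} (v : Fin k → ℕ+) : W α R v = subtreeLimit α R v := by
  unfold W subtreeLimit
  congr 1
  funext m
  rw [← tsum_descendants_eq_subtreeSum hγ]
  simp

/-! ### Measurability of the sums over subtrees -/

/-- Only marks below `v` are required to be measurable, so the sum is measurable for the blocks of
its own subtree. The depth enters as `n = k + m` to avoid transport between `k + (m + 1)` and `k + 1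
+ m`. -/
lemma measurable_subtreeSum {E : Type*} [MeasurableSpace E] {Q : E → Input} {β : ℝ}
    {f : E → (k : ℕ) → (Fin k → ℕ+) → ℝ≥0∞} (m k : ℕ) (v : Fin k → ℕ+)
    (hQ : ∀ j, j < k + m → ∀ (z : Fin j → ℕ+) (x : ℕ+) (h : k ≤ j), Fin.take k h z = v →
      Measurable fun e => (Q e).γ (j + 1) (Fin.snoc z x))
    (hf : ∀ n, n = k + m → ∀ (z : Fin n → ℕ+) (h : k ≤ n), Fin.take k h z = v →
      Measurable fun e => f e n z) :
    Measurable fun e => subtreeSum (Q e) β (f e) m k v := by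
  induction m generalizing k v with
  | zero => exact hf k rfl v le_rfl (by simp)
  | succ m ih =>
    have htake : ∀ {j : ℕ} (h : k + 1 ≤ j) (z : Fin j → ℕ+) (x : ℕ+),
        Fin.take (k + 1) h z = (Fin.snoc v x : Fin (k + 1) → ℕ+) →
        Fin.take k (by omega) z = v := by
      intro j h z x hz
      funext i
      have := congrFun hz (Fin.castSucc i)
      simpa [Fin.take] using this
    refine Measurable.tsum fun x => Measurable.mul ?_ ?_
    · exact (hQ k (by omega) v x le_rfl (by simp)).ennreal_ofReal.pow_const β
    · refine ih (k + 1) (Fin.snoc v x) ?_ ?_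
      · intro j hj z y h hz
        exact hQ j (by omega) z y (by omega) (htake h z x hz)
      · intro n hn z h hz
        exact hf n (by omega) z (by omega) (htake h z x hz)

lemma measurable_subtreeSum_blocks {Ω : Type*} {R : Ω → Input} {β : ℝ} {m k : ℕ}
    (v : Fin k → ℕ+) {S : Set BlockIndex}
    (hS : ∀ (j : ℕ) (z : Fin j → ℕ+) (h : k ≤ j), j < k + m → Fin.take k h z = v →
      Sum.inl ⟨j, z⟩ ∈ S) :
    Measurable[blocks R S] fun ω => subtreeSum (R ω) β (fun _ _ => 1) m k v :=
  @measurable_subtreeSum Ω (blocks R S) R β (fun _ _ _ => 1) m k v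
    (fun j hj z x h hz => measurable_blocks_γ R (hS j z h hj hz) x)
    (fun _ _ _ _ _ => measurable_const)

lemma measurable_subtreeLimit {Ω : Type*} (α : ℕ → ℝ) (R : Ω → Input) {k : ℕ} (v : Fin k → ℕ+) :
    Measurable[blocks R (subtreeBlocks v)] fun ω => subtreeLimit α (R ω) v := by
  let _ : MeasurableSpace Ω := blocks R (subtreeBlocks v)
  exact Measurable.limsup fun m => measurable_subtreeSum_blocks (S := subtreeBlocks v) v
    fun j z h _ hz => ⟨j, z, h, rfl, hz⟩

/-- The `β`-sums over the offspring, for the marks of a second realization. -/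
lemma measurable_offspringSum_blocks {Ω : Type*} {R : Ω → Input} {β : ℝ} {n : ℕ}
    (z : Fin n → ℕ+) {S : Set BlockIndex} (hS : Sum.inl ⟨n, z⟩ ∈ S) :
    Measurable[blocks R S] fun ω => offspringSum (R ω) β (fun _ _ => 1) n z := by
  let _ : MeasurableSpace Ω := blocks R S
  exact Measurable.tsum fun x =>
    ((measurable_blocks_γ R hS x).ennreal_ofReal.pow_const β).mul measurable_const

lemma snoc_right_injective {k : ℕ} (v : Fin k → ℕ+) :
    Function.Injective fun x : ℕ+ => (Fin.snoc v x : Fin (k + 1) → ℕ+) := fun x y h => by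
  simpa using congrFun h (Fin.last k)

lemma snoc_injective {k : ℕ} :
    Function.Injective fun p : (Fin k → ℕ+) × ℕ+ => (Fin.snoc p.1 p.2 : Fin (k + 1) → ℕ+) := by
  rintro ⟨v, x⟩ ⟨w, y⟩ h
  have h1 := congrArg (Fin.init (α := fun _ => ℕ+)) h
  have h2 := congrFun h (Fin.last k)
  simp at h1 h2
  rw [h1, h2]

/-! ### The law of the limits `W(v)` and the branching inequality -/

namespace IsRandomInput

section

variable {Ω : Type*} {mΩ : MeasurableSpace Ω} {P : Measure Ω} {α : ℕ → ℝ} {R : Ω → Input}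

lemma ae_γ_pos (hR : IsRandomInput P α R) : ∀ᵐ ω ∂P, ∀ (k : ℕ) (v : Fin k → ℕ+) (x : ℕ+),
    0 < (R ω).γ (k + 1) (Fin.snoc v x) := by
  rw [ae_all_iff]
  intro k
  rw [ae_all_iff]
  intro v
  filter_upwards [hR.γ_ordered k v] with ω hω using hω.2

lemma ae_W_eq (hR : IsRandomInput P α R) : ∀ᵐ ω ∂P, ∀ (k : ℕ) (v : Fin k → ℕ+),
    W α (R ω) v = subtreeLimit α (R ω) v := by
  filter_upwards [hR.ae_γ_pos] with ω hω k v using W_eq_subtreeLimit hω α v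

lemma measurable_subtreeSum' (hR : IsRandomInput P α R) (β : ℝ) (m k : ℕ) (v : Fin k → ℕ+) :
    Measurable fun ω => subtreeSum (R ω) β (fun _ _ => 1) m k v :=
  (measurable_subtreeSum_blocks (S := subtreeBlocks v) v
    fun j z h _ hz => ⟨j, z, h, rfl, hz⟩).mono (hR.blocks_le _) le_rfl

end

variable {Ω : Type*} {mΩ : MeasurableSpace Ω} {P : Measure Ω} [IsProbabilityMeasure P]
  {α : ℕ → ℝ} {R : Ω → Input}

lemma iIndep_subtrees (hR : IsRandomInput P α R) {k : ℕ} {κ : Type*} {f : κ → Fin k → ℕ+}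
    (hf : Function.Injective f) : iIndep (fun a => blocks R (subtreeBlocks (f a))) P :=
  iIndep_biSup_of_disjoint hR.block_le hR.iIndep_block
    fun _ _ hab => disjoint_subtreeBlocks (hf.ne hab)

/-- The Laplace functional of the marks of the offspring of a node. -/
lemma laplace_offspring (hR : IsRandomInput P α R) {k : ℕ} (v : Fin k → ℕ+) {f : ℝ → ℝ≥0∞}
    (hf : Measurable f) :
    ∫⁻ ω, expNeg (∑' x : ℕ+, f ((R ω).γ (k + 1) (Fin.snoc v x))) ∂P =
      expNeg (∫⁻ u, 1 - expNeg (f u) ∂(intensity α (k + 1))) :=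
  (hR.γ_poisson k v).laplace (fun _ => hR.measurable_γ _ _) hf

/-- Integrating out the last level of the sums over a subtree. -/
lemma lintegral_expNeg_subtreeSum_offspringSum (hR : IsRandomInput P α R) (hα : IsParameter α)
    (R₀ : Input) {m k n : ℕ} (hn : k + m = n) (v : Fin k → ℕ+) {x : ℝ≥0∞} (hx : x ≠ ∞) :
    ∫⁻ ω, expNeg (x ^ α (n + 2) *
      subtreeSum R₀ (α (n + 2)) (offspringSum (R ω) (α (n + 2)) fun _ _ => 1) m k v) ∂P =
        expNeg (x ^ α (n + 1) * subtreeSum R₀ (α (n + 1)) (fun _ _ => 1) m k v) := by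
  have hβ := hα.pos (n + 2) (by omega)
  have hβ' := hα.pos (n + 1) (by omega)
  induction m generalizing k v x with
  | zero =>
    obtain rfl : k = n := hn
    simp only [subtreeSum, offspringSum, mul_one]
    have hf : Measurable fun u : ℝ => (x * ENNReal.ofReal u) ^ α (k + 2) := by fun_prop
    have h := hR.laplace_offspring v hf
    -- One generation lowers the exponent from `α (k + 2)` to `α (k + 1)`.
    rw [lintegral_intensity_stable hα (by omega) hx] at h
    rw [← h]
    refine lintegral_congr fun ω => ?_
    rw [← ENNReal.tsum_mul_left]
    congr 1
    refine tsum_congr fun y => ?_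
    rw [ENNReal.mul_rpow_of_nonneg _ _ hβ.le]
  | succ m ih =>
    simp only [subtreeSum]
    simp_rw [← ENNReal.tsum_mul_left, ← mul_assoc]
    -- The first-generation mark is absorbed into `x`, which is why `x` is general in the induction;
    -- the subtrees of different children are independent.
    rw [← funext fun y : ℕ+ => congrArg₂ (· * ·) (ENNReal.mul_rpow_of_nonneg x
      (ENNReal.ofReal (R₀.γ (k + 1) (Fin.snoc v y))) hβ'.le) rfl]
    refine lintegral_expNeg_tsum
      (m := fun y : ℕ+ => blocks R (subtreeBlocks (Fin.snoc v y : Fin (k + 1) → ℕ+)))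
      (fun y => hR.blocks_le _) (hR.iIndep_subtrees (snoc_right_injective v)) (fun y => ?_)
      fun y => ?_
    · refine Measurable.const_mul ?_ _
      refine @measurable_subtreeSum Ω (blocks R _) (fun _ => R₀) _ _ m (k + 1) _
        (fun _ _ _ _ _ _ => measurable_const) fun n' hn' z h hz => ?_
      exact measurable_offspringSum_blocks z ⟨n', z, h, rfl, hz⟩
    · rw [← ENNReal.mul_rpow_of_nonneg _ _ hβ.le]
      exact ih (by omega) (Fin.snoc v y) (ENNReal.mul_ne_top hx ENNReal.ofReal_ne_top)

/-- The sums over a subtree form a martingale after taking Laplace transforms. -/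
lemma lintegral_mul_expNeg_subtreeSum (hR : IsRandomInput P α R) (hα : IsParameter α) (m k : ℕ)
    (v : Fin k → ℕ+) {x : ℝ≥0∞} (hx : x ≠ ∞) {g : Ω → ℝ≥0∞}
    (hg : Measurable[blocks R (pastBlocks (k + m))] g) :
    ∫⁻ ω, g ω * expNeg (x ^ α (k + (m + 1) + 1) *
      subtreeSum (R ω) (α (k + (m + 1) + 1)) (fun _ _ => 1) (m + 1) k v) ∂P =
    ∫⁻ ω, g ω * expNeg (x ^ α (k + m + 1) *
      subtreeSum (R ω) (α (k + m + 1)) (fun _ _ => 1) m k v) ∂P := by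
  set β := α (k + m + 2) with hβ
  have hdisj : Disjoint (pastBlocks (k + m)) (gammaBlocksAt (k + m)) :=
    (disjoint_past_gammaBlocksFrom (k + m)).mono_right (gammaBlocksAt_subset _)
  have hF : Measurable[(blocks R (pastBlocks (k + m))).prod (blocks R (gammaBlocksAt (k + m)))]
      (Function.uncurry fun ω ω' => g ω * expNeg (x ^ β *
        subtreeSum (R ω) β (offspringSum (R ω') β fun _ _ => 1) m k v)) := by
    let _ := (blocks R (pastBlocks (k + m))).prod (blocks R (gammaBlocksAt (k + m)))
    refine (hg.comp (@measurable_fst Ω Ω (_) (_))).mul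
      (measurable_expNeg.comp (Measurable.const_mul ?_ _))
    refine measurable_subtreeSum (Q := fun p : Ω × Ω => R p.1)
      (f := fun p : Ω × Ω => offspringSum (R p.2) β fun _ _ => 1) m k v
      (fun j hj z y h hz => ?_) fun n hn z h hz => ?_
    · exact (measurable_blocks_γ R (S := pastBlocks (k + m)) (k := j) hj y).comp
        (@measurable_fst Ω Ω (_) (_))
    · subst hn
      exact (measurable_offspringSum_blocks (S := gammaBlocksAt (k + m)) z ⟨z, rfl⟩).comp
        (@measurable_snd Ω Ω (_) (_))
  have h := lintegral_diag_of_indep (hR.blocks_le _) (hR.blocks_le _) (hR.indep_blocks hdisj) hF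
  simp_rw [subtreeSum_succ]
  refine h.trans (lintegral_congr fun ω => ?_)
  rw [lintegral_const_mul, hR.lintegral_expNeg_subtreeSum_offspringSum hα (R ω) rfl v hx]
  refine measurable_expNeg.comp (Measurable.const_mul ?_ _)
  exact measurable_subtreeSum (Q := fun _ : Ω => R ω)
    (f := fun ω' => offspringSum (R ω') β fun _ _ => 1) m k v
    (fun _ _ _ _ _ _ => measurable_const) fun n _ z _ _ =>
      (measurable_offspringSum_blocks (S := gammaBlocksAt n) z ⟨z, rfl⟩).mono (hR.blocks_le _) le_rfl

/-- The sums over a subtree converge a.s. -/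
theorem ae_tendsto_subtreeSum (hR : IsRandomInput P α R) (hα : IsParameter α) {k : ℕ}
    (v : Fin k → ℕ+) : ∀ᵐ ω ∂P, Tendsto
      (fun m => subtreeSum (R ω) (α (k + m + 1)) (fun _ _ => 1) m k v) atTop
        (𝓝 (subtreeLimit α (R ω) v)) := by
  have h := ae_exists_tendsto_of_expNeg_submartingale (P := P)
    (𝓢 := fun m => blocks R (pastBlocks (k + m)))
    (fun a b hab => blocks_mono R (pastBlocks_mono (by omega)))
    (fun m => hR.blocks_le _)
    (D := fun m ω => subtreeSum (R ω) (α (k + m + 1)) (fun _ _ => 1) m k v)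
    (fun m => measurable_subtreeSum_blocks v fun j z h hj hz => hj) ?_
  · filter_upwards [h] with ω hω
    obtain ⟨c, hc⟩ := hω
    rw [subtreeLimit, hc.limsup_eq]
    exact hc
  · intro m A hA
    have := hR.lintegral_mul_expNeg_subtreeSum hα m k v (x := 1) ENNReal.one_ne_top
      (g := A.indicator 1) (by
        let _ : MeasurableSpace Ω := blocks R (pastBlocks (k + m))
        exact measurable_one.indicator hA)
    simp only [ENNReal.one_rpow, one_mul] at this
    have hA' : MeasurableSet A := hR.blocks_le _ A hA
    have hind : ∀ f : Ω → ℝ≥0∞, ∫⁻ ω, A.indicator 1 ω * f ω ∂P = ∫⁻ ω in A, f ω ∂P := by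
      intro f
      rw [← lintegral_indicator hA']
      refine lintegral_congr fun ω => ?_
      by_cases hω : ω ∈ A <;> simp [hω]
    rw [hind, hind] at this
    exact this.ge

lemma tendsto_rpow_param (hα : IsParameter α) (k : ℕ) {x : ℝ≥0∞} (hx0 : x ≠ 0) (hx : x ≠ ∞) :
    Tendsto (fun m : ℕ => x ^ α (k + m + 1)) atTop (𝓝 x) := by
  obtain ⟨y, hy, rfl⟩ : ∃ y : ℝ, 0 < y ∧ x = ENNReal.ofReal y :=
    ⟨x.toReal, ENNReal.toReal_pos hx0 hx, (ENNReal.ofReal_toReal hx).symm⟩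
  simp_rw [ENNReal.ofReal_rpow_of_pos hy]
  refine (ENNReal.continuous_ofReal.tendsto _).comp ?_
  have h1 : Tendsto (fun m : ℕ => α (k + m + 1)) atTop (𝓝 1) :=
    hα.tendsto.comp (tendsto_atTop_mono (fun m => by simp only [id]; omega) tendsto_id)
  have h2 := (Real.continuousAt_const_rpow hy.ne' (b := 1)).tendsto
  rw [Real.rpow_one] at h2
  exact h2.comp h1

/-- The law of `W(v)`: a standard stable law. -/
theorem laplace_subtreeLimit (hR : IsRandomInput P α R) (hα : IsParameter α) {k : ℕ}
    (v : Fin k → ℕ+) {x : ℝ≥0∞} (hx : x ≠ ∞) :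
    ∫⁻ ω, expNeg (x * subtreeLimit α (R ω) v) ∂P = expNeg (x ^ α (k + 1)) := by
  rcases eq_or_ne x 0 with rfl | hx0
  · simp [hα.pos (k + 1) (by omega)]
  -- At the arguments `x ^ α (k + m + 1)` the transforms do not depend on `m`, and at `m = 0` the
  -- sum is `1`. These arguments tend to `x` because the exponents tend to `1`.
  have hconst : ∀ m : ℕ, ∫⁻ ω, expNeg (x ^ α (k + m + 1) *
      subtreeSum (R ω) (α (k + m + 1)) (fun _ _ => 1) m k v) ∂P = expNeg (x ^ α (k + 1)) := by
    intro m
    induction m with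
    | zero => simp [subtreeSum]
    | succ m ih =>
      have := hR.lintegral_mul_expNeg_subtreeSum hα m k v hx (g := fun _ => 1) measurable_const
      simp only [one_mul] at this
      rw [this, ih]
  have hlim := tendsto_lintegral_expNeg (P := P)
    (f := fun m ω => x ^ α (k + m + 1) *
      subtreeSum (R ω) (α (k + m + 1)) (fun _ _ => 1) m k v)
    (f' := fun ω => x * subtreeLimit α (R ω) v)
    (fun m => (hR.measurable_subtreeSum' _ m k v).const_mul _) (by
      filter_upwards [hR.ae_tendsto_subtreeSum hα v] with ω hω
      exact ENNReal.Tendsto.mul (tendsto_rpow_param hα k hx0 hx) (Or.inl hx0) hω (Or.inr hx))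
  simp_rw [hconst] at hlim
  exact tendsto_nhds_unique hlim tendsto_const_nhds

/-- The branching inequality for `W`. -/
theorem ae_tsum_subtreeLimit_le (hR : IsRandomInput P α R) (hα : IsParameter α) :
    ∀ᵐ ω ∂P, ∀ (k : ℕ) (v : Fin k → ℕ+),
      ∑' x : ℕ+, subtreeLimit α (R ω) (Fin.snoc v x : Fin (k + 1) → ℕ+) *
        ENNReal.ofReal ((R ω).γ (k + 1) (Fin.snoc v x)) ≤ subtreeLimit α (R ω) v := by
  have h : ∀ᵐ ω ∂P, ∀ (k : ℕ) (v : Fin k → ℕ+), Tendsto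
      (fun m => subtreeSum (R ω) (α (k + m + 1)) (fun _ _ => 1) m k v) atTop
        (𝓝 (subtreeLimit α (R ω) v)) := by
    rw [ae_all_iff]
    intro k
    rw [ae_all_iff]
    exact fun v => hR.ae_tendsto_subtreeSum hα v
  filter_upwards [h, hR.ae_γ_pos] with ω hω hpos k v
  rw [ENNReal.tsum_eq_iSup_sum]
  -- Each child's term converges, so finite sums pass to the limit; over all children only the Fatou
  -- inequality survives, and it is enough.
  refine iSup_le fun s => ?_
  have hx : ∀ x : ℕ+, Tendsto (fun m : ℕ =>
      ENNReal.ofReal ((R ω).γ (k + 1) (Fin.snoc v x)) ^ α (k + (m + 1) + 1) *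
        subtreeSum (R ω) (α (k + (m + 1) + 1)) (fun _ _ => 1) m (k + 1) (Fin.snoc v x)) atTop
      (𝓝 (subtreeLimit α (R ω) (Fin.snoc v x : Fin (k + 1) → ℕ+) *
        ENNReal.ofReal ((R ω).γ (k + 1) (Fin.snoc v x)))) := by
    intro x
    have hγ0 : ENNReal.ofReal ((R ω).γ (k + 1) (Fin.snoc v x)) ≠ 0 := by simpa using hpos k v x
    have h1 := hω (k + 1) (Fin.snoc v x)
    have h2 := tendsto_rpow_param hα (k + 1) hγ0 ENNReal.ofReal_ne_top
    have e : ∀ m : ℕ, k + 1 + m + 1 = k + (m + 1) + 1 := fun m => by omega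
    simp_rw [e] at h1 h2
    rw [mul_comm]
    exact ENNReal.Tendsto.mul h2 (Or.inl hγ0) h1 (Or.inr ENNReal.ofReal_ne_top)
  refine le_of_tendsto_of_tendsto' (tendsto_finsetSum s fun x _ => hx x)
    ((tendsto_add_atTop_iff_nat 1).2 (hω k v)) fun m => ?_
  rw [subtreeSum]
  exact ENNReal.sum_le_tsum s

end IsRandomInput

/-! ### Occupation times -/

lemma measurable_occupation {E : Type*} [MeasurableSpace E] {k : ℕ}
    {Y : E → ℝ≥0∞ → (Fin k → WithTop ℕ+)} (hY : JointlyMeasurable Y) {a b : E → ℝ≥0∞}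
    (ha : Measurable a) (hb : Measurable b) (v : Fin k → ℕ+) :
    Measurable fun e => occupation (Y e) (a e) (b e) v := by
  have hs : Measurable fun p : E × ℝ => ENNReal.ofReal p.2 := by fun_prop
  have h : MeasurableSet {p : E × ℝ | p.2 ∈ Ioi (0 : ℝ) ∧ (a p.1 < ENNReal.ofReal p.2 ∧
      ENNReal.ofReal p.2 ≤ b p.1) ∧ Y p.1 (ENNReal.ofReal p.2) = toState v} :=
    (measurable_snd measurableSet_Ioi).inter
      (((measurableSet_lt (ha.comp measurable_fst) hs).inter
        (measurableSet_le hs (hb.comp measurable_fst))).inter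
        (hY.measurableSet measurable_fst hs v))
  exact measurable_measure_prodMk_left h

lemma volume_window_le (a b : ℝ≥0∞) :
    volume (Ioi (0 : ℝ) ∩ ENNReal.ofReal ⁻¹' Ioc a b) ≤ b - a := by
  rcases eq_or_ne a ∞ with rfl | ha
  · simp
  rcases eq_or_ne b ∞ with rfl | hb
  · rw [ENNReal.top_sub ha]
    exact le_top
  have hsub : Ioi (0 : ℝ) ∩ ENNReal.ofReal ⁻¹' Ioc a b ⊆ Ioc a.toReal b.toReal := by
    rintro s ⟨hs, h1, h2⟩
    exact ⟨(ENNReal.lt_ofReal_iff_toReal_lt ha).1 h1, (ENNReal.ofReal_le_iff_le_toReal hb).1 h2⟩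
  calc volume (Ioi (0 : ℝ) ∩ ENNReal.ofReal ⁻¹' Ioc a b)
      ≤ volume (Ioc a.toReal b.toReal) := measure_mono hsub
    _ = b - a := by
      rw [Real.volume_Ioc, ENNReal.ofReal_sub _ ENNReal.toReal_nonneg, ENNReal.ofReal_toReal ha,
        ENNReal.ofReal_toReal hb]

/-- Time spent at states with an infinite coordinate is not counted, hence only an inequality. -/
lemma tsum_occupation_le {k : ℕ} {Y : ℝ≥0∞ → (Fin k → WithTop ℕ+)}
    (hY : ∀ v, MeasurableSet {r | Y r = toState v}) (a b : ℝ≥0∞) :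
    ∑' v, occupation Y a b v ≤ b - a := by
  unfold occupation
  rw [← measure_iUnion]
  · refine (measure_mono ?_).trans (volume_window_le a b)
    exact Set.iUnion_subset fun v => Set.inter_subset_inter_right _
      (Set.preimage_mono Set.inter_subset_left)
  · intro v w hvw
    rw [Function.onFun, Set.disjoint_left]
    rintro s ⟨-, -, h1⟩ ⟨-, -, h2⟩
    exact hvw (toState_injective (h1.symm.trans h2))
  · exact fun v => measurableSet_Ioi.inter
      (ENNReal.measurable_ofReal (measurableSet_Ioc.inter (hY v)))

/-! ### Compound Poisson variables with exponential jumps -/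

section CompoundPoisson

variable {Ω : Type*} [MeasurableSpace Ω] {P : Measure Ω} [IsProbabilityMeasure P] {G : Ω → ℝ≥0∞}
  {L : ℝ≥0∞}

/-- The derivative of `c ↦ 1 - e^{-cx}` at `0`; it recovers a mean from Laplace transforms. -/
lemma tendsto_mul_one_sub_expNeg {x : ℝ≥0∞} (hx : x ≠ ∞) :
    Tendsto (fun j : ℕ => ((j : ℝ≥0∞) + 1) * (1 - expNeg (((j : ℝ≥0∞) + 1)⁻¹ * x))) atTop
      (𝓝 x) := by
  obtain ⟨y, hy, rfl⟩ : ∃ y : ℝ, 0 ≤ y ∧ x = ENNReal.ofReal y :=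
    ⟨x.toReal, ENNReal.toReal_nonneg, (ENNReal.ofReal_toReal hx).symm⟩
  have hd : HasDerivAt (fun c : ℝ => 1 - Real.exp (-(c * y))) y 0 := by
    have h := ((((hasDerivAt_id (0 : ℝ)).mul_const y).neg).exp).const_sub 1
    simpa using h
  have hslope := (hasDerivAt_iff_tendsto_slope_zero.1 hd).comp
    (f := fun j : ℕ => 1 / ((j : ℝ) + 1)) (x := atTop) (tendsto_nhdsWithin_iff.2
      ⟨tendsto_one_div_add_atTop_nhds_zero_nat, Eventually.of_forall fun j => by
        simp only [mem_compl_iff, mem_singleton_iff]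
        positivity⟩)
  refine ((ENNReal.continuous_ofReal.tendsto y).comp hslope).congr fun j => ?_
  have hj : (0 : ℝ) < (j : ℝ) + 1 := by positivity
  have e1 : ((j : ℝ≥0∞) + 1) = ENNReal.ofReal ((j : ℝ) + 1) := by
    rw [ENNReal.ofReal_add (by positivity) zero_le_one]
    simp
  rw [e1, ← ENNReal.ofReal_inv_of_pos hj, ← ENNReal.ofReal_mul (by positivity),
    expNeg_ofReal (by positivity), ← ENNReal.ofReal_one, ← ENNReal.ofReal_sub _ (Real.exp_pos _).le,
    ← ENNReal.ofReal_mul hj.le]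
  simp

lemma ae_lt_top_of_laplace_eq (hGm : Measurable G)
    (hG : ∀ c, ∫⁻ ω, expNeg (c * G ω) ∂P = expNeg (L * psi c)) (hL : L ≠ ∞) :
    ∀ᵐ ω ∂P, G ω < ∞ := by
  refine ae_lt_top_of_laplace hGm (b := fun j => expNeg (L * ((j : ℝ≥0∞) + 1)⁻¹)) ?_ fun j => ?_
  · have h := ENNReal.Tendsto.const_mul (a := L) tendsto_inv_natCast_add_one (Or.inr hL)
    rw [mul_zero] at h
    have h2 := (continuous_expNeg.tendsto 0).comp h
    rw [expNeg_zero] at h2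
    exact h2
  · rw [hG]
    exact expNeg_antitone (mul_le_mul_right (psi_le _) _)

/-- The difference quotients `(1 - E e^{-cG}) / c` are at most `L`; Fatou's lemma along `c = 1 / (j
+ 1)` bounds the mean. -/
lemma lintegral_le_of_laplace_eq (hGm : Measurable G)
    (hG : ∀ c, ∫⁻ ω, expNeg (c * G ω) ∂P = expNeg (L * psi c)) (hL : L ≠ ∞) :
    ∫⁻ ω, G ω ∂P ≤ L := by
  have hfin := ae_lt_top_of_laplace_eq hGm hG hL
  have hm : ∀ j : ℕ, Measurable fun ω => expNeg (((j : ℝ≥0∞) + 1)⁻¹ * G ω) := fun j =>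
    measurable_expNeg.comp (hGm.const_mul _)
  have hle : ∀ j : ℕ, ∫⁻ ω, ((j : ℝ≥0∞) + 1) * (1 - expNeg (((j : ℝ≥0∞) + 1)⁻¹ * G ω)) ∂P ≤ L := by
    intro j
    rw [lintegral_const_mul _ ((hm j).const_sub 1), lintegral_sub (hm j)
      ((lintegral_expNeg_le_one _).trans_lt ENNReal.one_lt_top).ne
      (Eventually.of_forall fun ω => expNeg_le_one _), hG]
    simp only [lintegral_const, measure_univ, mul_one]
    calc ((j : ℝ≥0∞) + 1) * (1 - expNeg (L * psi ((j : ℝ≥0∞) + 1)⁻¹))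
        ≤ ((j : ℝ≥0∞) + 1) * (L * ((j : ℝ≥0∞) + 1)⁻¹) := by
          gcongr
          exact (one_sub_expNeg_le _).trans (mul_le_mul_right (psi_le _) _)
      _ = L * (((j : ℝ≥0∞) + 1) * ((j : ℝ≥0∞) + 1)⁻¹) := by ring
      _ = L := by rw [ENNReal.mul_inv_cancel (by simp) (by simp), mul_one]
  calc ∫⁻ ω, G ω ∂P
      = ∫⁻ ω, liminf (fun j : ℕ => ((j : ℝ≥0∞) + 1) *
          (1 - expNeg (((j : ℝ≥0∞) + 1)⁻¹ * G ω))) atTop ∂P := by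
        refine lintegral_congr_ae ?_
        filter_upwards [hfin] with ω hω
        exact (tendsto_mul_one_sub_expNeg hω.ne).liminf_eq.symm
    _ ≤ liminf (fun j : ℕ => ∫⁻ ω, ((j : ℝ≥0∞) + 1) *
          (1 - expNeg (((j : ℝ≥0∞) + 1)⁻¹ * G ω)) ∂P) atTop :=
        lintegral_liminf_le fun j => ((hm j).const_sub 1).const_mul _
    _ ≤ L := by
        refine (liminf_le_liminf (Eventually.of_forall hle)).trans ?_
        simp

/-- Weighted arithmetic-geometric mean of `x` and `1`. The factor `1 - expNeg (∞ * x)` is the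
indicator of `x ≠ 0`, written so that its expectation is a Laplace transform at `c = ∞`. -/
lemma rpow_le_add_indicator {a : ℝ} (ha : 0 < a) (ha1 : a < 1) (x : ℝ≥0∞) :
    x ^ a ≤ ENNReal.ofReal a * x + ENNReal.ofReal (1 - a) * (1 - expNeg (∞ * x)) := by
  rcases eq_or_ne x 0 with rfl | hx0
  · simp [ha]
  rcases eq_or_ne x ∞ with rfl | hx
  · simp [ha, ENNReal.mul_top]
  rw [ENNReal.top_mul hx0, expNeg_top, tsub_zero, mul_one]
  obtain ⟨y, hy, rfl⟩ : ∃ y : ℝ, 0 < y ∧ x = ENNReal.ofReal y :=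
    ⟨x.toReal, ENNReal.toReal_pos hx0 hx, (ENNReal.ofReal_toReal hx).symm⟩
  rw [ENNReal.ofReal_rpow_of_pos hy, ← ENNReal.ofReal_mul ha.le, ← ENNReal.ofReal_add
    (by positivity) (by linarith)]
  apply ENNReal.ofReal_le_ofReal
  have := Real.geom_mean_le_arith_mean2_weighted ha.le (sub_nonneg.2 ha1.le) hy.le zero_le_one
    (by ring)
  simpa using this

/-- Both `E[G]` and `P (G > 0) = 1 - e^{-L}` are at most `L`; interpolate between them. -/
lemma lintegral_rpow_le_of_laplace_eq (hGm : Measurable G)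
    (hG : ∀ c, ∫⁻ ω, expNeg (c * G ω) ∂P = expNeg (L * psi c)) (hL : L ≠ ∞) {a : ℝ} (ha : 0 < a)
    (ha1 : a < 1) : ∫⁻ ω, G ω ^ a ∂P ≤ L := by
  have hm : Measurable fun ω => expNeg (∞ * G ω) := measurable_expNeg.comp (hGm.const_mul _)
  have h0 : ∫⁻ ω, 1 - expNeg (∞ * G ω) ∂P ≤ L := by
    rw [lintegral_sub hm ((lintegral_expNeg_le_one _).trans_lt ENNReal.one_lt_top).ne
      (Eventually.of_forall fun ω => expNeg_le_one _), hG]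
    simp only [lintegral_const, measure_univ, mul_one]
    exact (one_sub_expNeg_le _).trans (mul_le_of_le_one_right' (psi_le_one _))
  calc ∫⁻ ω, G ω ^ a ∂P
      ≤ ∫⁻ ω, ENNReal.ofReal a * G ω + ENNReal.ofReal (1 - a) * (1 - expNeg (∞ * G ω)) ∂P :=
        lintegral_mono fun ω => rpow_le_add_indicator ha ha1 _
    _ = ENNReal.ofReal a * ∫⁻ ω, G ω ∂P +
          ENNReal.ofReal (1 - a) * ∫⁻ ω, 1 - expNeg (∞ * G ω) ∂P := by
        rw [lintegral_add_left (hGm.const_mul _), lintegral_const_mul _ hGm,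
          lintegral_const_mul _ (hm.const_sub 1)]
    _ ≤ ENNReal.ofReal a * L + ENNReal.ofReal (1 - a) * L := by
        gcongr
        exact lintegral_le_of_laplace_eq hGm hG hL
    _ = L := by
        rw [← add_mul, ← ENNReal.ofReal_add ha.le (by linarith)]
        simp

lemma one_sub_expNeg_le_rpow {a : ℝ} (ha : 0 < a) (ha1 : a < 1) (x : ℝ≥0∞) :
    1 - expNeg x ≤ x ^ a := by
  rcases le_total 1 x with h | h
  · exact tsub_le_self.trans (ENNReal.one_le_rpow h ha)
  · refine (one_sub_expNeg_le x).trans ?_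
    calc x = x ^ (1 : ℝ) := (ENNReal.rpow_one x).symm
      _ ≤ x ^ a := ENNReal.rpow_le_rpow_of_exponent_ge h ha1.le

/-- The lower bound `E[G^a] ≥ κ L` for `L ≤ K`, where `κ → 1` as `a → 1` and then `δ → 0`. -/
lemma le_lintegral_rpow_of_laplace_eq (hGm : Measurable G)
    (hG : ∀ c, ∫⁻ ω, expNeg (c * G ω) ∂P = expNeg (L * psi c)) {K : ℝ} (hK : 0 ≤ K)
    (hL : L ≤ ENNReal.ofReal K) {a δ : ℝ} (ha : 0 < a) (ha1 : a < 1) (hδ : 0 < δ) :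
    ENNReal.ofReal (δ ^ (1 - a) / ((1 + δ) * (1 + K * δ))) * L ≤ ∫⁻ ω, G ω ^ a ∂P := by
  obtain ⟨l, hl, hlK, rfl⟩ : ∃ l : ℝ, 0 ≤ l ∧ l ≤ K ∧ L = ENNReal.ofReal l :=
    ⟨L.toReal, ENNReal.toReal_nonneg, ENNReal.toReal_le_of_le_ofReal hK hL,
      (ENNReal.ofReal_toReal (ne_top_of_le_ne_top ENNReal.ofReal_ne_top hL)).symm⟩
  have hm : Measurable fun ω => expNeg (ENNReal.ofReal δ * G ω) :=
    measurable_expNeg.comp (hGm.const_mul _)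
  -- Integrating `1 - e^{-δG} ≤ (δG)^a` bounds the moment from below by a Laplace transform at `δ`.
  have h1 : 1 - expNeg (ENNReal.ofReal l * psi (ENNReal.ofReal δ)) ≤
      ENNReal.ofReal (δ ^ a) * ∫⁻ ω, G ω ^ a ∂P := by
    rw [← hG, ← lintegral_const_mul _ (hGm.pow_const a)]
    calc 1 - ∫⁻ ω, expNeg (ENNReal.ofReal δ * G ω) ∂P
        = ∫⁻ ω, 1 - expNeg (ENNReal.ofReal δ * G ω) ∂P := by
          rw [lintegral_sub hm ((lintegral_expNeg_le_one _).trans_lt ENNReal.one_lt_top).ne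
            (Eventually.of_forall fun ω => expNeg_le_one _)]
          simp
      _ ≤ ∫⁻ ω, ENNReal.ofReal (δ ^ a) * G ω ^ a ∂P := by
          refine lintegral_mono fun ω => ?_
          rw [← ENNReal.ofReal_rpow_of_pos hδ, ← ENNReal.mul_rpow_of_nonneg _ _ ha.le]
          exact one_sub_expNeg_le_rpow ha ha1 _
  have hδa : 0 < δ ^ a := Real.rpow_pos_of_pos hδ a
  -- With `y = l δ / (1 + δ) ≤ K δ`, use `1 - e^{-y} ≥ y / (1 + y) ≥ y / (1 + K δ)`.
  have h2 : ENNReal.ofReal (δ ^ a) *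
      (ENNReal.ofReal (δ ^ (1 - a) / ((1 + δ) * (1 + K * δ))) * ENNReal.ofReal l) ≤
      1 - expNeg (ENNReal.ofReal l * psi (ENNReal.ofReal δ)) := by
    rw [psi_ofReal hδ.le, ← ENNReal.ofReal_mul hl, expNeg_ofReal (by positivity),
      ← ENNReal.ofReal_one, ← ENNReal.ofReal_sub _ (Real.exp_pos _).le,
      ← ENNReal.ofReal_mul (by positivity), ← ENNReal.ofReal_mul hδa.le]
    apply ENNReal.ofReal_le_ofReal
    set y := l * (δ / (1 + δ)) with hy
    have hy0 : 0 ≤ y := by positivity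
    have hyK : y ≤ K * δ := by
      have : δ / (1 + δ) ≤ δ := div_le_self hδ.le (by linarith)
      exact mul_le_mul hlK this (by positivity) hK
    have e : δ ^ a * (δ ^ (1 - a) / ((1 + δ) * (1 + K * δ)) * l) = y / (1 + K * δ) := by
      have : δ ^ a * δ ^ (1 - a) = δ := by
        rw [← Real.rpow_add hδ]
        simp
      rw [hy]
      field_simp
      linear_combination l * this
    rw [e]
    have h3 : Real.exp (-y) ≤ 1 / (1 + y) := by
      rw [Real.exp_neg, one_div]
      exact inv_anti₀ (by linarith) (by linarith [Real.add_one_le_exp y])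
    calc y / (1 + K * δ) ≤ y / (1 + y) := by
          apply div_le_div_of_nonneg_left hy0 (by linarith) (by linarith)
      _ = 1 - 1 / (1 + y) := by field_simp; ring
      _ ≤ 1 - Real.exp (-y) := by linarith
  have h4 := h2.trans h1
  exact (ENNReal.mul_le_mul_iff_right (by simpa using hδa) ENNReal.ofReal_ne_top).1 h4

end CompoundPoisson

/-! ### Annealed Laplace transforms: averaging over the marks and over `W` -/

lemma measurable_negLog : Measurable negLog := by
  unfold negLog
  exact measurable_ereal_toENNReal.comp ENNReal.measurable_log.neg

instance sFinite_intensity (α : ℕ → ℝ) (n : ℕ) : SFinite (intensity α n) := by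
  unfold intensity
  infer_instance

lemma one_sub_lintegral_expNeg {Ω : Type*} {mΩ : MeasurableSpace Ω} {P : Measure Ω}
    [IsProbabilityMeasure P] {f : Ω → ℝ≥0∞} (hf : Measurable f) :
    1 - ∫⁻ ω, expNeg (f ω) ∂P = ∫⁻ ω, 1 - expNeg (f ω) ∂P := by
  have hm : Measurable fun ω => expNeg (f ω) := measurable_expNeg.comp hf
  rw [lintegral_sub (f := fun _ => 1) hm
    ((lintegral_expNeg_le_one _).trans_lt ENNReal.one_lt_top).ne
    (Eventually.of_forall fun ω => expNeg_le_one _)]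
  simp

namespace IsRandomInput

variable {Ω : Type*} {mΩ : MeasurableSpace Ω} {P : Measure Ω} [IsProbabilityMeasure P]
  {α : ℕ → ℝ} {R : Ω → Input}

/-- The probability space already carries such a variable: sum the exponential times attached to the
marks in `(0, L]` of the process of level `1` and `x = 1`. Only its law matters. It linearizes
`psi`: `e^{-L psi c}` becomes an average of `e^{-cG}`. -/
lemma exists_compoundPoisson (hR : IsRandomInput P α R) (L : ℝ≥0∞) :
    ∃ G : Ω → ℝ≥0∞, Measurable G ∧ ∀ c, ∫⁻ ω, expNeg (c * G ω) ∂P = expNeg (L * psi c) := by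
  classical
  have hs : MeasurableSet {s : ℝ | 0 < s ∧ ENNReal.ofReal s ≤ L} :=
    measurableSet_Ioi.inter (ENNReal.measurable_ofReal measurableSet_Iic)
  set ind : ℕ+ → ℝ → ℝ≥0∞ := fun x s =>
    if x = 1 then {s : ℝ | 0 < s ∧ ENNReal.ofReal s ≤ L}.indicator 1 s else 0 with hind
  have hindm : ∀ x, Measurable (ind x) := by
    intro x
    simp only [hind]
    split_ifs
    · exact measurable_one.indicator hs
    · exact measurable_const
  refine ⟨fun ω => ∑' (x : ℕ+) (i : ℕ+),
    ind x ((R ω).σ (0 + 1) x i) * ENNReal.ofReal ((R ω).T (0 + 1) x i), ?_, fun c => ?_⟩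
  · exact Measurable.tsum fun x => Measurable.tsum fun i =>
      ((hindm x).comp (hR.measurable_σ _ _ _)).mul (hR.measurable_T _ _ _).ennreal_ofReal
  · have h := hR.lintegral_expNeg_visits 0 (c := fun x s => c * ind x s)
      fun x => (hindm x).const_mul c
    simp_rw [← ENNReal.tsum_mul_left, ← mul_assoc]
    rw [h, tsum_eq_single 1]
    · congr 1
      have e : ∀ s, psi (c * ind 1 s) =
          {s : ℝ | 0 < s ∧ ENNReal.ofReal s ≤ L}.indicator (fun _ => psi c) s := by
        intro s
        by_cases hsm : s ∈ {s : ℝ | 0 < s ∧ ENNReal.ofReal s ≤ L}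
        · simp only [hind, if_true, Set.indicator_of_mem hsm, Pi.one_apply, mul_one]
        · simp only [hind, if_true, Set.indicator_of_notMem hsm, mul_zero, psi_zero]
      simp_rw [e]
      rw [lintegral_indicator_const hs, Measure.restrict_apply hs, mul_comm]
      congr 1
      rcases eq_or_ne L ∞ with rfl | hL
      · have : {s : ℝ | 0 < s ∧ ENNReal.ofReal s ≤ ∞} ∩ Ioi 0 = Ioi 0 := by
          ext s; simp
        rw [this, Real.volume_Ioi]
      · have : {s : ℝ | 0 < s ∧ ENNReal.ofReal s ≤ L} ∩ Ioi 0 = Ioc 0 L.toReal := by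
          ext s
          simp only [mem_inter_iff, mem_ofPred_eq, mem_Ioi, mem_Ioc,
            ENNReal.ofReal_le_iff_le_toReal hL]
          tauto
        rw [this, Real.volume_Ioc, sub_zero, ENNReal.ofReal_toReal hL]
    · intro x hx
      simp [hind, hx, psi_zero]

/-- The annealed Laplace transform of the clock given the occupation times. -/
lemma lintegral_expNeg_psi_nodes (hR : IsRandomInput P α R) {k : ℕ} (L : (Fin k → ℕ+) → ℝ≥0∞)
    {M : (Fin (k + 1) → ℕ+) → Ω → ℝ≥0∞} (hM : ∀ y, Measurable[blocks R (subtreeBlocks y)] (M y))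
    {l : ℝ≥0∞} {φ : (Fin k → ℕ+) → ℝ → ℝ≥0∞}
    (hφ : ∀ v x u, ∫⁻ ω, expNeg (L v * psi (l * (M (Fin.snoc v x) ω * ENNReal.ofReal u))) ∂P =
      φ v u) :
    ∫⁻ ω, expNeg (∑' v, L v * ∑' x : ℕ+, psi (l * (M (Fin.snoc v x) ω *
      ENNReal.ofReal ((R ω).γ (k + 1) (Fin.snoc v x))))) ∂P =
        expNeg (∑' v, ∫⁻ u, 1 - φ v u ∂(intensity α (k + 1))) := by
  have hMm : ∀ y, Measurable (M y) := fun y => (hM y).mono (hR.blocks_le _) le_rfl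
  have hφm : ∀ v, Measurable (φ v) := by
    intro v
    have e : φ v = fun u =>
        ∫⁻ ω, expNeg (L v * psi (l * (M (Fin.snoc v 1) ω * ENNReal.ofReal u))) ∂P :=
      funext fun u => (hφ v 1 u).symm
    rw [e]
    refine Measurable.lintegral_prod_right' (f := fun p : ℝ × Ω =>
      expNeg (L v * psi (l * (M (Fin.snoc v 1) p.2 * ENNReal.ofReal p.1)))) ?_
    refine measurable_expNeg.comp ((measurable_psi.comp (Measurable.const_mul ?_ _)).const_mul _)
    exact ((hMm _).comp measurable_snd).mul measurable_fst.ennreal_ofReal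
  have hφ1 : ∀ v u, φ v u ≤ 1 := fun v u => by
    rw [← hφ v 1 u]
    exact lintegral_expNeg_le_one _
  have hF : Measurable[(blocks R (gammaBlocksAt k)).prod (blocks R (gammaBlocksFrom (k + 1)))]
      (Function.uncurry fun ω ω' => expNeg (∑' v, L v * ∑' x : ℕ+, psi (l *
        (M (Fin.snoc v x) ω' * ENNReal.ofReal ((R ω).γ (k + 1) (Fin.snoc v x)))))) := by
    let _ := (blocks R (gammaBlocksAt k)).prod (blocks R (gammaBlocksFrom (k + 1)))
    refine measurable_expNeg.comp (Measurable.tsum fun v => Measurable.const_mul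
      (Measurable.tsum fun x => measurable_psi.comp (Measurable.const_mul ?_ _)) _)
    have h1 : Measurable[blocks R (gammaBlocksFrom (k + 1))] (M (Fin.snoc v x)) :=
      (hM _).mono (blocks_mono R (subtreeBlocks_subset _)) le_rfl
    exact (h1.comp (@measurable_snd Ω Ω (_) (_))).mul
      ((measurable_blocks_γ R (S := gammaBlocksAt k) ⟨v, rfl⟩ x).comp
        (@measurable_fst Ω Ω (_) (_))).ennreal_ofReal
  refine (lintegral_diag_of_indep (hR.blocks_le _) (hR.blocks_le _)
    (hR.indep_blocks (disjoint_gammaBlocksAt_from k)) hF).trans ?_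
  -- With the offspring marks of depth `k` frozen, the factors live on disjoint subtrees. Using
  -- `negLog` leaves a sum over those marks, ready for their Laplace functional.
  have hinner : ∀ ω, ∫⁻ ω', expNeg (∑' v, L v * ∑' x : ℕ+, psi (l *
      (M (Fin.snoc v x) ω' * ENNReal.ofReal ((R ω).γ (k + 1) (Fin.snoc v x))))) ∂P =
      expNeg (∑' (v : Fin k → ℕ+) (x : ℕ+),
        negLog (φ v ((R ω).γ (k + 1) (Fin.snoc v x)))) := by
    intro ω
    simp_rw [← ENNReal.tsum_mul_left, ← ENNReal.tsum_prod]
    refine lintegral_expNeg_tsum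
      (m := fun p : (Fin k → ℕ+) × ℕ+ =>
        blocks R (subtreeBlocks (Fin.snoc p.1 p.2 : Fin (k + 1) → ℕ+)))
      (fun p => hR.blocks_le _) (hR.iIndep_subtrees snoc_injective) (fun p => ?_) fun p => ?_
    · exact (measurable_psi.comp (((hM _).mul_const _).const_mul _)).const_mul _
    · rw [hφ, expNeg_negLog (hφ1 _ _)]
  simp_rw [hinner]
  refine lintegral_expNeg_tsum (m := fun v : Fin k → ℕ+ => block R (Sum.inl ⟨k, v⟩))
    (fun p => hR.block_le _) (hR.iIndep_block.precomp fun p q h => by simpa using h)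
    (fun v => @measurable_tsum_comp Ω (block R (Sum.inl ⟨k, v⟩)) _ _
      (measurable_negLog.comp (hφm v)) (measurable_block_γ R v)) fun v => ?_
  refine (hR.laplace_offspring v (measurable_negLog.comp (hφm v))).trans ?_
  congr 1
  refine lintegral_congr fun u => ?_
  rw [Function.comp_apply, expNeg_negLog (hφ1 _ _)]

/-- The annealed Laplace transform of a window of a clock: only the times spent at the nodes
remain. -/
theorem lintegral_expNeg_windowSum_annealed (hR : IsRandomInput P α R) {k : ℕ}
    {M : (Fin (k + 1) → ℕ+) → Ω → ℝ≥0∞} (hM : ∀ y, Measurable[blocks R (subtreeBlocks y)] (M y))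
    {l : ℝ≥0∞} {φ : ℝ≥0∞ → ℝ → ℝ≥0∞}
    (hφ : ∀ y L u, L ≠ ∞ →
      ∫⁻ ω, expNeg (L * psi (l * (M y ω * ENNReal.ofReal u))) ∂P = φ L u)
    {a b g : Ω → ℝ≥0∞} (ha : Measurable[blocks R (pastBlocks k)] a)
    (hb : Measurable[blocks R (pastBlocks k)] b) (hg : Measurable[blocks R (pastBlocks k)] g)
    (hbt : ∀ᵐ ω ∂P, b ω < ∞) :
    ∫⁻ ω, g ω * expNeg (l * windowSum (R ω) (X (R ω) k)
      (fun y => M y ω * ENNReal.ofReal ((R ω).γ (k + 1) y)) (a ω) (b ω)) ∂P =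
    ∫⁻ ω, g ω * expNeg (∑' v, ∫⁻ u, 1 - φ (occupation (X (R ω) k) (a ω) (b ω) v) u
      ∂(intensity α (k + 1))) ∂P := by
  set S := pastBlocks k ∪ gammaBlocks with hS
  have hpast : pastBlocks k ⊆ S := Set.subset_union_left
  have hmono : blocks R (pastBlocks k) ≤ blocks R S := blocks_mono R hpast
  have hγ : ∀ y : Fin (k + 1) → ℕ+, Measurable[blocks R S] fun ω => (R ω).γ (k + 1) y := by
    intro y
    rw [← Fin.snoc_init_self y]
    exact measurable_blocks_γ R (S := S) (Or.inr ⟨_, rfl⟩) _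
  have hMS : ∀ y, Measurable[blocks R S] (M y) := fun y => (hM y).mono (blocks_mono R
    ((subtreeBlocks_subset y).trans ((gammaBlocksFrom_subset _).trans subset_union_right))) le_rfl
  have h1 := hR.lintegral_expNeg_windowSum (disjoint_past_visit k)
    (Y := fun ω => X (R ω) k)
    (@jointlyMeasurable_X Ω (blocks R S) k R (measurableUpTo_blocks R hpast) k le_rfl)
    (w := fun ω y => l * (M y ω * ENNReal.ofReal ((R ω).γ (k + 1) y)))
    (fun y => ((hMS y).mul (hγ y).ennreal_ofReal).const_mul _)
    (ha.mono hmono le_rfl) (hb.mono hmono le_rfl) (hg.mono hmono le_rfl)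
  simp_rw [windowSum_mul] at h1
  refine h1.trans ?_
  have hF : Measurable[(blocks R (pastBlocks k)).prod (blocks R (gammaBlocksFrom k))]
      (Function.uncurry fun ω ω' => g ω * expNeg (∑' v,
        occupation (X (R ω) k) (a ω) (b ω) v * ∑' x : ℕ+, psi (l *
        (M (Fin.snoc v x) ω' * ENNReal.ofReal ((R ω').γ (k + 1) (Fin.snoc v x)))))) := by
    let _ := (blocks R (pastBlocks k)).prod (blocks R (gammaBlocksFrom k))
    refine (hg.comp (@measurable_fst Ω Ω (_) (_))).mul (measurable_expNeg.comp
      (Measurable.tsum fun v => Measurable.mul ?_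
      (Measurable.tsum fun x => measurable_psi.comp (Measurable.const_mul ?_ _))))
    · exact (@measurable_occupation Ω (blocks R (pastBlocks k)) k (fun ω => X (R ω) k)
        (@jointlyMeasurable_X Ω (blocks R (pastBlocks k)) k R
          (measurableUpTo_blocks R le_rfl) k le_rfl) a b ha hb v).comp
        (@measurable_fst Ω Ω (_) (_))
    · have h1 : Measurable[blocks R (gammaBlocksFrom k)] (M (Fin.snoc v x)) :=
        (hM _).mono (blocks_mono R ((subtreeBlocks_subset _).trans
          (gammaBlocksFrom_anti (Nat.le_succ k)))) le_rfl
      exact (h1.comp (@measurable_snd Ω Ω (_) (_))).mul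
        ((measurable_blocks_γ R (S := gammaBlocksFrom k) ⟨k, v, le_rfl, rfl⟩ x).comp
          (@measurable_snd Ω Ω (_) (_))).ennreal_ofReal
  refine (lintegral_diag_of_indep (hR.blocks_le _) (hR.blocks_le _)
    (hR.indep_blocks (disjoint_past_gammaBlocksFrom k)) hF).trans (lintegral_congr_ae ?_)
  filter_upwards [hbt] with ω hω
  -- The finite horizon keeps the occupation times finite, and `hφ` is available only for such `L`.
  have hocc : ∀ v, occupation (X (R ω) k) (a ω) (b ω) v ≠ ∞ := fun v =>
    ((measure_mono (Set.inter_subset_inter_right _ (Set.preimage_mono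
      Set.inter_subset_left))).trans (volume_window_le (a ω) (b ω))).trans_lt
      (tsub_le_self.trans_lt hω) |>.ne
  rw [lintegral_const_mul, hR.lintegral_expNeg_psi_nodes _ hM fun v x u => hφ _ _ u (hocc v)]
  refine measurable_expNeg.comp (Measurable.tsum fun v => Measurable.const_mul
      (Measurable.tsum fun x => measurable_psi.comp (Measurable.const_mul ?_ _)) _)
  exact ((hM _).mono (hR.blocks_le _) le_rfl).mul (hR.measurable_γ _ _).ennreal_ofReal

/-- Replace `e^{-L psi c}` by the average of `e^{-cG}`, exchange integrals, and apply the stable law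
of `W(y)`, of index `α (k + 2)` as `y` has depth `k + 1`. -/
lemma lintegral_expNeg_psi_subtreeLimit (hR : IsRandomInput P α R) (hα : IsParameter α) {k : ℕ}
    (y : Fin (k + 1) → ℕ+) {l L : ℝ≥0∞} (hl : l ≠ ∞) (hL : L ≠ ∞) {G : Ω → ℝ≥0∞}
    (hGm : Measurable G) (hG : ∀ c, ∫⁻ ω, expNeg (c * G ω) ∂P = expNeg (L * psi c)) (u : ℝ) :
    ∫⁻ ω, expNeg (L * psi (l * (subtreeLimit α (R ω) y * ENNReal.ofReal u))) ∂P =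
      ∫⁻ ω, expNeg ((l * G ω * ENNReal.ofReal u) ^ α (k + 2)) ∂P := by
  have hWm : Measurable fun ω => subtreeLimit α (R ω) y :=
    (measurable_subtreeLimit α R y).mono (hR.blocks_le _) le_rfl
  simp_rw [← hG]
  rw [lintegral_lintegral_swap]
  · refine lintegral_congr_ae ?_
    filter_upwards [ae_lt_top_of_laplace_eq hGm hG hL] with ω' hω'
    rw [← hR.laplace_subtreeLimit hα y (x := l * G ω' * ENNReal.ofReal u)
      (ENNReal.mul_ne_top (ENNReal.mul_ne_top hl hω'.ne) ENNReal.ofReal_ne_top)]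
    refine lintegral_congr fun ω => ?_
    congr 1
    ring
  · refine (measurable_expNeg.comp (Measurable.mul (Measurable.const_mul ?_ _)
      (hGm.comp measurable_snd))).aemeasurable
    exact (hWm.comp measurable_fst).mul_const _

/-- After exchanging integrals, the normalization of the intensity collapses the power `α (k + 2)`
to `α (k + 1)`. -/
lemma lintegral_one_sub_expNeg_rpow (hα : IsParameter α) {k : ℕ} {l : ℝ≥0∞} (hl : l ≠ ∞)
    {G : Ω → ℝ≥0∞} (hGm : Measurable G) (hGfin : ∀ᵐ ω ∂P, G ω < ∞) :
    ∫⁻ u, 1 - ∫⁻ ω, expNeg ((l * G ω * ENNReal.ofReal u) ^ α (k + 2)) ∂P ∂(intensity α (k + 1)) =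
      l ^ α (k + 1) * ∫⁻ ω, G ω ^ α (k + 1) ∂P := by
  have hm2 : Measurable fun p : ℝ × Ω => (l * G p.2 * ENNReal.ofReal p.1) ^ α (k + 2) :=
    (((hGm.comp measurable_snd).const_mul _).mul measurable_fst.ennreal_ofReal).pow_const _
  have h2 : ∀ u : ℝ, 1 - ∫⁻ ω, expNeg ((l * G ω * ENNReal.ofReal u) ^ α (k + 2)) ∂P =
      ∫⁻ ω, 1 - expNeg ((l * G ω * ENNReal.ofReal u) ^ α (k + 2)) ∂P := fun u =>
    one_sub_lintegral_expNeg (hm2.comp measurable_prodMk_left)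
  simp_rw [h2]
  rw [lintegral_lintegral_swap ((measurable_expNeg.comp hm2).const_sub 1).aemeasurable,
    ← lintegral_const_mul _ (hGm.pow_const _)]
  refine lintegral_congr_ae ?_
  filter_upwards [hGfin] with ω hω
  rw [lintegral_intensity_stable hα (by omega) (ENNReal.mul_ne_top hl hω.ne),
    ENNReal.mul_rpow_of_nonneg _ _ (hα.pos (k + 1) (by omega)).le]

end IsRandomInput

/-- The increment over `(a, b]` of the adjusted clock of level `k + 1`. -/
def adjustedWindow (α : ℕ → ℝ) (R : Input) (k : ℕ) (a b : ℝ≥0∞) : ℝ≥0∞ :=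
  windowSum R (X R k) (fun y => subtreeLimit α R y * ENNReal.ofReal (R.γ (k + 1) y)) a b

lemma psi_le_one_sub_expNeg (y : ℝ≥0∞) : psi y ≤ 1 - expNeg y := by
  rcases eq_or_ne y ∞ with rfl | hy
  · rw [expNeg_top, tsub_zero]
    exact psi_le_one _
  obtain ⟨x, hx, rfl⟩ : ∃ x : ℝ, 0 ≤ x ∧ y = ENNReal.ofReal x :=
    ⟨y.toReal, ENNReal.toReal_nonneg, (ENNReal.ofReal_toReal hy).symm⟩
  rw [psi_ofReal hx, expNeg_ofReal hx, ← ENNReal.ofReal_one,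
    ← ENNReal.ofReal_sub _ (Real.exp_pos _).le]
  apply ENNReal.ofReal_le_ofReal
  have h : Real.exp (-x) ≤ 1 / (1 + x) := by
    rw [Real.exp_neg, one_div]
    exact inv_anti₀ (by linarith) (by linarith [Real.add_one_le_exp x])
  have e : x / (1 + x) = 1 - 1 / (1 + x) := by field_simp; ring
  linarith

/-- It replaces `psi`, for which the unadjusted clock offers no stable averaging, by an integrand
whose integral against the intensity is explicit. For `y ≤ 1` use `y ≤ y ^ β`; for `y ≥ 1` both
sides are compared through `psi 1 = 1/2`. -/
lemma psi_le_two_mul {β : ℝ} (hβ : 0 < β) (hβ1 : β < 1) (y : ℝ≥0∞) :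
    psi y ≤ 2 * (1 - expNeg (y ^ β)) := by
  rcases le_total y 1 with h | h
  · have h1 : y ≤ y ^ β := by
      calc y = y ^ (1 : ℝ) := (ENNReal.rpow_one y).symm
        _ ≤ y ^ β := ENNReal.rpow_le_rpow_of_exponent_ge h hβ1.le
    calc psi y ≤ 1 - expNeg y := psi_le_one_sub_expNeg y
      _ ≤ 1 - expNeg (y ^ β) := tsub_le_tsub_left (expNeg_antitone h1) _
      _ ≤ 2 * (1 - expNeg (y ^ β)) := le_mul_of_one_le_left' one_le_two
  · have h1 : (1 : ℝ≥0∞) ≤ y ^ β := ENNReal.one_le_rpow h hβ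
    have h2 : psi 1 ≤ 1 - expNeg (y ^ β) :=
      (psi_le_one_sub_expNeg 1).trans (tsub_le_tsub_left (expNeg_antitone h1) _)
    have h3 : psi 1 = 2⁻¹ := by
      rw [psi, one_add_one_eq_two, ENNReal.one_sub_inv_two]
    rw [h3] at h2
    calc psi y ≤ 1 := psi_le_one y
      _ = 2 * 2⁻¹ := (ENNReal.mul_inv_cancel (by simp) (by simp)).symm
      _ ≤ 2 * (1 - expNeg (y ^ β)) := by gcongr

/-! ### Bounds on the transforms of clock windows, and finiteness of the clocks -/

namespace IsRandomInput

section

variable {Ω : Type*} {mΩ : MeasurableSpace Ω} {P : Measure Ω} {α : ℕ → ℝ} {R : Ω → Input}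

lemma ae_σ_pos (hR : IsRandomInput P α R) :
    ∀ᵐ ω ∂P, ∀ (k : ℕ) (x i : ℕ+), 0 < (R ω).σ (k + 1) x i := by
  rw [ae_all_iff]
  intro k
  rw [ae_all_iff]
  intro x
  filter_upwards [hR.σ_ordered k x] with ω hω using hω.2

lemma measurableSet_X_eq (hR : IsRandomInput P α R) (k : ℕ) (ω : Ω) (v : Fin k → ℕ+) :
    MeasurableSet {r | X (R ω) k r = toState v} :=
  (jointlyMeasurable_X (hR.measurableUpTo k) le_rfl).measurableSet (f := fun _ => ω) (t := id)
    measurable_const measurable_id v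

end

variable {Ω : Type*} {mΩ : MeasurableSpace Ω} {P : Measure Ω} [IsProbabilityMeasure P]
  {α : ℕ → ℝ} {R : Ω → Input}

/-- The Laplace transform of the increments of the adjusted clock. -/
theorem lintegral_expNeg_adjustedWindow (hR : IsRandomInput P α R) (hα : IsParameter α) {k : ℕ}
    {l : ℝ≥0∞} (hl : l ≠ ∞) {a b g : Ω → ℝ≥0∞} (ha : Measurable[blocks R (pastBlocks k)] a)
    (hb : Measurable[blocks R (pastBlocks k)] b) (hg : Measurable[blocks R (pastBlocks k)] g)
    (hbt : ∀ᵐ ω ∂P, b ω < ∞) {G : ℝ≥0∞ → Ω → ℝ≥0∞} (hGm : ∀ L, Measurable (G L))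
    (hG : ∀ L c, ∫⁻ ω, expNeg (c * G L ω) ∂P = expNeg (L * psi c)) :
    ∫⁻ ω, g ω * expNeg (l * adjustedWindow α (R ω) k (a ω) (b ω)) ∂P =
      ∫⁻ ω, g ω * expNeg (l ^ α (k + 1) * ∑' v,
        ∫⁻ ω', G (occupation (X (R ω) k) (a ω) (b ω) v) ω' ^ α (k + 1) ∂P) ∂P := by
  refine (hR.lintegral_expNeg_windowSum_annealed
    (M := fun y ω => subtreeLimit α (R ω) y) (fun y => measurable_subtreeLimit α R y)
    (φ := fun L u => ∫⁻ ω, expNeg ((l * G L ω * ENNReal.ofReal u) ^ α (k + 2)) ∂P)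
    (fun y L u hL => hR.lintegral_expNeg_psi_subtreeLimit hα y hl hL (hGm L) (hG L) u)
    ha hb hg hbt).trans (lintegral_congr_ae ?_)
  filter_upwards [hbt] with ω hω
  have hocc : ∀ v, occupation (X (R ω) k) (a ω) (b ω) v ≠ ∞ := fun v =>
    ((ENNReal.le_tsum v).trans (tsum_occupation_le (hR.measurableSet_X_eq k ω) _ _)).trans_lt
      (tsub_le_self.trans_lt hω) |>.ne
  rw [← ENNReal.tsum_mul_left]
  congr 2
  refine tsum_congr fun v => ?_
  exact lintegral_one_sub_expNeg_rpow hα hl (hGm _)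
    (ae_lt_top_of_laplace_eq (hGm _) (hG _) (hocc v))

/-- From `E[G_L^a] ≤ L` and total occupation at most `b - a`. The weight `g` makes this a bound
given the past; the cross term of the final square uses it. -/
theorem le_lintegral_expNeg_adjustedWindow (hR : IsRandomInput P α R) (hα : IsParameter α) {k : ℕ}
    {l : ℝ≥0∞} (hl : l ≠ ∞) {a b g : Ω → ℝ≥0∞} (ha : Measurable[blocks R (pastBlocks k)] a)
    (hb : Measurable[blocks R (pastBlocks k)] b) (hg : Measurable[blocks R (pastBlocks k)] g)
    (hbt : ∀ᵐ ω ∂P, b ω < ∞) :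
    ∫⁻ ω, g ω * expNeg (l ^ α (k + 1) * (b ω - a ω)) ∂P ≤
      ∫⁻ ω, g ω * expNeg (l * adjustedWindow α (R ω) k (a ω) (b ω)) ∂P := by
  choose G hGm hG using hR.exists_compoundPoisson
  rw [hR.lintegral_expNeg_adjustedWindow hα hl ha hb hg hbt hGm hG]
  refine lintegral_mono_ae ?_
  filter_upwards [hbt] with ω hω
  have hsum := tsum_occupation_le (hR.measurableSet_X_eq k ω) (a ω) (b ω)
  gcongr
  refine expNeg_antitone (mul_le_mul_right ((ENNReal.tsum_le_tsum fun v => ?_).trans hsum) _)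
  exact lintegral_rpow_le_of_laplace_eq (hGm _) (hG _)
    (((ENNReal.le_tsum v).trans hsum).trans_lt (tsub_le_self.trans_lt hω)).ne
    (hα.pos _ (by omega)) (hα.lt_one _ (by omega))

/-- The reverse bound: it needs `b ≤ K` for a uniform moment estimate, and `hocc`, saying that no
time is lost at infinite states. -/
theorem lintegral_expNeg_adjustedWindow_le (hR : IsRandomInput P α R) (hα : IsParameter α) {k : ℕ}
    {l : ℝ≥0∞} (hl : l ≠ ∞) {b : Ω → ℝ≥0∞} (hb : Measurable[blocks R (pastBlocks k)] b) {K : ℝ}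
    (hK : 0 ≤ K) (hbK : ∀ ω, b ω ≤ ENNReal.ofReal K)
    (hocc : ∀ᵐ ω ∂P, b ω ≤ ∑' v, occupation (X (R ω) k) 0 (b ω) v) {δ : ℝ} (hδ : 0 < δ) :
    ∫⁻ ω, expNeg (l * adjustedWindow α (R ω) k 0 (b ω)) ∂P ≤
      ∫⁻ ω, expNeg (l ^ α (k + 1) * (ENNReal.ofReal
        (δ ^ (1 - α (k + 1)) / ((1 + δ) * (1 + K * δ))) * b ω)) ∂P := by
  choose G hGm hG using hR.exists_compoundPoisson
  have h := hR.lintegral_expNeg_adjustedWindow hα hl (a := fun _ => 0) (g := fun _ => 1)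
    measurable_const hb measurable_const
    (Eventually.of_forall fun ω => (hbK ω).trans_lt ENNReal.ofReal_lt_top) hGm hG
  simp only [one_mul] at h
  rw [h]
  refine lintegral_mono_ae ?_
  filter_upwards [hocc] with ω hω
  have hsum := tsum_occupation_le (hR.measurableSet_X_eq k ω) 0 (b ω)
  rw [tsub_zero] at hsum
  refine expNeg_antitone (mul_le_mul_right ((mul_le_mul_right hω _).trans ?_) _)
  rw [← ENNReal.tsum_mul_left]
  exact ENNReal.tsum_le_tsum fun v => le_lintegral_rpow_of_laplace_eq (hGm _) (hG _) hK
    (((ENNReal.le_tsum v).trans hsum).trans (hbK ω)) (hα.pos _ (by omega))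
    (hα.lt_one _ (by omega)) hδ

/-- The plain clock, with weight `1` in place of `W`. The factor `2` from `psi_le_two_mul` is
harmless since only finiteness is wanted. -/
theorem le_lintegral_expNeg_windowSum (hR : IsRandomInput P α R) (hα : IsParameter α) {k : ℕ}
    {l : ℝ≥0∞} (hl : l ≠ ∞) {b : Ω → ℝ≥0∞} (hb : Measurable[blocks R (pastBlocks k)] b)
    (hbt : ∀ᵐ ω ∂P, b ω < ∞) :
    ∫⁻ ω, expNeg (2 * l ^ α (k + 1) * b ω) ∂P ≤ ∫⁻ ω, expNeg (l * windowSum (R ω) (X (R ω) k)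
      (fun y => ENNReal.ofReal ((R ω).γ (k + 1) y)) 0 (b ω)) ∂P := by
  have h := hR.lintegral_expNeg_windowSum_annealed (k := k)
    (M := fun y ω => 1) (fun y => measurable_const) (l := l)
    (φ := fun L u => expNeg (L * psi (l * ENNReal.ofReal u))) (fun y L u hL => by simp)
    (a := fun _ => 0) (g := fun _ => 1) measurable_const hb measurable_const hbt
  simp only [one_mul] at h
  rw [h]
  refine lintegral_mono fun ω => expNeg_antitone ?_
  have hsum := tsum_occupation_le (hR.measurableSet_X_eq k ω) 0 (b ω)
  rw [tsub_zero] at hsum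
  refine le_trans ?_ (mul_le_mul_right hsum _)
  rw [← ENNReal.tsum_mul_left]
  refine ENNReal.tsum_le_tsum fun v => ?_
  set L := occupation (X (R ω) k) 0 (b ω) v
  have hm : Measurable fun u : ℝ => 1 - expNeg ((l * ENNReal.ofReal u) ^ α (k + 2)) :=
    (measurable_expNeg.comp (by fun_prop)).const_sub 1
  calc ∫⁻ u, 1 - expNeg (L * psi (l * ENNReal.ofReal u)) ∂(intensity α (k + 1))
      ≤ ∫⁻ u, (L * 2) * (1 - expNeg ((l * ENNReal.ofReal u) ^ α (k + 2)))
          ∂(intensity α (k + 1)) := by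
        refine lintegral_mono fun u => (one_sub_expNeg_le _).trans ?_
        rw [mul_assoc]
        exact mul_le_mul_right (psi_le_two_mul (hα.pos _ (by omega)) (hα.lt_one _ (by omega)) _) _
    _ = 2 * l ^ α (k + 1) * L := by
        rw [lintegral_const_mul _ hm, lintegral_intensity_stable hα (by omega) hl]
        ring

/-- Let `l → 0` in the preceding bound: the transform tends to `1`, so no mass sits at `∞`. -/
lemma ae_Xi_lt_top (hR : IsRandomInput P α R) (hα : IsParameter α) {k : ℕ} {b : Ω → ℝ≥0∞}
    (hb : Measurable[blocks R (pastBlocks k)] b) (hbt : ∀ᵐ ω ∂P, b ω < ∞) :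
    ∀ᵐ ω ∂P, Xi (R ω) (k + 1) (b ω) < ∞ := by
  have hbm : Measurable b := hb.mono (hR.blocks_le _) le_rfl
  have hα1 := hα.pos (k + 1) (by omega)
  have hm : Measurable fun ω => windowSum (R ω) (X (R ω) k)
      (fun y => ENNReal.ofReal ((R ω).γ (k + 1) y)) 0 (b ω) :=
    measurable_windowSum (hR.measurable_σ _) (hR.measurable_T _)
      (jointlyMeasurable_X (hR.measurableUpTo k) le_rfl)
      (fun v => (hR.measurable_γ _ v).ennreal_ofReal) measurable_const hbm
  have h := ae_lt_top_of_laplace hm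
    (b := fun j => ∫⁻ ω, expNeg (2 * (((j : ℝ≥0∞) + 1)⁻¹) ^ α (k + 1) * b ω) ∂P) ?_ fun j =>
      hR.le_lintegral_expNeg_windowSum hα (by simp) hb hbt
  · filter_upwards [h, hR.ae_σ_pos] with ω hω hσ
    refine lt_of_eq_of_lt ?_ hω
    exact clockSum_eq_windowSum (Y := X (R ω) k)
      (w := fun y => ENNReal.ofReal ((R ω).γ (k + 1) y)) (hσ k) (b ω)
  · have h0 : ∫⁻ _, expNeg 0 ∂P = 1 := by simp
    rw [← h0]
    refine tendsto_lintegral_expNeg (fun j => hbm.const_mul _) ?_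
    filter_upwards [hbt] with ω hω
    have h1 : Tendsto (fun j : ℕ => ((j : ℝ≥0∞) + 1)⁻¹ ^ α (k + 1)) atTop (𝓝 0) := by
      have := (ENNReal.continuous_rpow_const (y := α (k + 1))).tendsto 0 |>.comp
        tendsto_inv_natCast_add_one
      rwa [ENNReal.zero_rpow_of_pos hα1] at this
    have h2 := ENNReal.Tendsto.mul_const (b := b ω)
      (ENNReal.Tendsto.const_mul (a := 2) h1 (Or.inr (by simp))) (Or.inr hω.ne)
    simpa using h2

/-- The clock compositions are finite at each fixed time. -/
theorem ae_theta_lt_top (hR : IsRandomInput P α R) (hα : IsParameter α) (k n : ℕ) (t : ℝ≥0) :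
    ∀ᵐ ω ∂P, theta (R ω) k n t < ∞ := by
  induction n with
  | zero => exact Eventually.of_forall fun ω => ENNReal.coe_lt_top
  | succ n ih =>
    by_cases h : k ≤ n + 1
    · simp_rw [theta_succ_of_le _ h]
      exact hR.ae_Xi_lt_top hα (@measurable_theta Ω (blocks R (pastBlocks n)) n R
        (measurableUpTo_blocks R le_rfl) k t) ih
    · simp_rw [theta_of_lt _ (not_le.1 h)]
      exact Eventually.of_forall fun ω => ENNReal.coe_lt_top

end IsRandomInput

/-! ### Pure jump functions -/

/-- Throughout the jump interval at `s` the inverse equals `s`. Hence the interval determines its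
jump time, and jump intervals at different times are disjoint. -/
lemma genInv_eq {f : ℝ≥0∞ → ℝ≥0∞} {s t : ℝ≥0∞} (h1 : ∀ r < s, f r ≤ t) (h2 : t < f s) :
    genInv f t = s :=
  le_antisymm (sInf_le h2) (le_sInf fun r hr => not_lt.1 fun h => (h1 r h).not_gt hr)

section PureJump

variable {ι : Type*} {τ J : ι → ℝ≥0∞} {f : ℝ≥0∞ → ℝ≥0∞}

lemma jump_eq (hτ : Function.Injective τ) (hτ0 : ∀ p, 0 < τ p)
    (hf : ∀ t, f t = ∑' p, (Iic t).indicator (fun _ => J p) (τ p)) (p : ι) :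
    f (τ p) = (⨆ r : {r // r < τ p}, f r.1) + J p := by
  classical
  apply le_antisymm
  · have h1 : ∀ q, (Iic (τ p)).indicator (fun _ => J q) (τ q) =
        (Iio (τ p)).indicator (fun _ => J q) (τ q) + if q = p then J q else 0 := by
      intro q
      rcases eq_or_ne q p with rfl | h
      · simp
      · rcases lt_or_gt_of_ne (hτ.ne h) with h' | h'
        · simp [Set.indicator, h, h', h'.le]
        · simp [Set.indicator, h, not_le.2 h', not_lt.2 h'.le]
    rw [hf, tsum_congr h1, ENNReal.tsum_add, tsum_ite_eq]
    gcongr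
    rw [ENNReal.tsum_eq_iSup_sum]
    refine iSup_le fun s => ?_
    set u := s.filter fun q => τ q < τ p with hu
    -- Finitely many jump times before `τ p` have a latest one (or `0` if there is none), still
    -- before `τ p`, at which all these jumps have been counted.
    have hr : u.sup τ < τ p := by
      rw [Finset.sup_lt_iff (by simpa using hτ0 p)]
      intro q hq
      exact (Finset.mem_filter.1 hq).2
    refine le_trans ?_ (le_iSup (fun r : {r // r < τ p} => f r.1) ⟨u.sup τ, hr⟩)
    simp only [hf]
    calc ∑ q ∈ s, (Iio (τ p)).indicator (fun _ => J q) (τ q)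
        = ∑ q ∈ u, J q := by
          rw [hu, Finset.sum_filter]
          exact Finset.sum_congr rfl fun q _ => by simp [Set.indicator]
      _ = ∑ q ∈ u, (Iic (u.sup τ)).indicator (fun _ => J q) (τ q) := by
          refine Finset.sum_congr rfl fun q hq => ?_
          rw [Set.indicator_of_mem]
          exact Finset.le_sup (f := τ) hq
      _ ≤ _ := ENNReal.sum_le_tsum u
  · have : Nonempty {r // r < τ p} := ⟨0, hτ0 p⟩
    rw [ENNReal.iSup_add]
    · refine iSup_le fun ⟨r, hr⟩ => ?_
      rw [hf r, hf (τ p), ← tsum_ite_eq p J, ← ENNReal.tsum_add]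
      refine ENNReal.tsum_le_tsum fun q => ?_
      by_cases hq : q = p
      · subst hq
        simp [Set.indicator, not_le.2 hr]
      · simp only [hq, if_false, add_zero]
        exact Set.indicator_le_indicator_of_subset (Iic_subset_Iic.2 hr.le) (fun _ => zero_le) _

lemma volume_jump (hτ : Function.Injective τ) (hτ0 : ∀ p, 0 < τ p)
    (hf : ∀ t, f t = ∑' p, (Iic t).indicator (fun _ => J p) (τ p)) {p : ι} (hp : f (τ p) ≠ ∞) :
    volume {s : ℝ | 0 < s ∧ (∀ r < τ p, f r ≤ ENNReal.ofReal s) ∧ ENNReal.ofReal s < f (τ p)} =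
      J p := by
  set c := ⨆ r : {r // r < τ p}, f r.1 with hc
  have hj : f (τ p) = c + J p := jump_eq hτ hτ0 hf p
  have hct : c ≠ ∞ := ne_top_of_le_ne_top hp (hj ▸ le_self_add)
  have hset : {s : ℝ | 0 < s ∧ (∀ r < τ p, f r ≤ ENNReal.ofReal s) ∧
      ENNReal.ofReal s < f (τ p)} =ᵐ[volume] Ico c.toReal (f (τ p)).toReal := by
    have h0 : ∀ᵐ s : ℝ, s ≠ 0 := by simp [ae_iff]
    filter_upwards [h0] with s hs
    apply propext
    change (0 < s ∧ (∀ r < τ p, f r ≤ ENNReal.ofReal s) ∧ ENNReal.ofReal s < f (τ p)) ↔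
      (c.toReal ≤ s ∧ s < (f (τ p)).toReal)
    have h1 : (∀ r < τ p, f r ≤ ENNReal.ofReal s) ↔ c ≤ ENNReal.ofReal s := by
      rw [hc, iSup_le_iff, Subtype.forall]
    rw [h1]
    constructor
    · rintro ⟨hs0, h2, h3⟩
      exact ⟨(ENNReal.le_ofReal_iff_toReal_le hct hs0.le).1 h2,
        (ENNReal.ofReal_lt_iff_lt_toReal hs0.le hp).1 h3⟩
    · rintro ⟨h2, h3⟩
      have hs0 : 0 ≤ s := ENNReal.toReal_nonneg.trans h2
      exact ⟨lt_of_le_of_ne hs0 hs.symm, (ENNReal.le_ofReal_iff_toReal_le hct hs0).2 h2,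
        (ENNReal.ofReal_lt_iff_lt_toReal hs0 hp).2 h3⟩
  rw [measure_congr hset, Real.volume_Ico, ENNReal.ofReal_sub _ ENNReal.toReal_nonneg,
    ENNReal.ofReal_toReal hct, ENNReal.ofReal_toReal hp, hj, ENNReal.add_sub_cancel_left hct]

/-- Up to the two endpoints `f a` and `f b`, the set is the disjoint union of the intervals of the
jumps with index in `A` and time in `(a, b]`; each has the length of its jump. -/
lemma volume_jumps [Countable ι] (hτ : Function.Injective τ) (hτ0 : ∀ p, 0 < τ p)
    (hf : ∀ t, f t = ∑' p, (Iic t).indicator (fun _ => J p) (τ p)) (hmono : Monotone f)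
    (A : Set ι) {a b : ℝ≥0∞} (hb : f b ≠ ∞) :
    volume (Ioi 0 ∩ ENNReal.ofReal ⁻¹' (Ioc (f a) (f b) ∩
      {t | ∃ p ∈ A, (∀ r < τ p, f r ≤ t) ∧ t < f (τ p)})) =
        ∑' p, (A ∩ τ ⁻¹' Ioc a b).indicator J p := by
  classical
  set B : ι → Set ℝ := fun p => {s : ℝ | (p ∈ A ∧ τ p ∈ Ioc a b) ∧
    0 < s ∧ (∀ r < τ p, f r ≤ ENNReal.ofReal s) ∧ ENNReal.ofReal s < f (τ p)} with hB
  have hset : (Ioi 0 ∩ ENNReal.ofReal ⁻¹' (Ioc (f a) (f b) ∩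
      {t | ∃ p ∈ A, (∀ r < τ p, f r ≤ t) ∧ t < f (τ p)}) : Set ℝ) =ᵐ[volume] ⋃ p, B p := by
    have h0 : ∀ c : ℝ, ∀ᵐ s : ℝ, s ≠ c := fun c => by simp [ae_iff]
    filter_upwards [h0 (f a).toReal, h0 (f b).toReal] with s hs1 hs2
    apply propext
    change s ∈ (Ioi 0 ∩ ENNReal.ofReal ⁻¹' (Ioc (f a) (f b) ∩
      {t | ∃ p ∈ A, (∀ r < τ p, f r ≤ t) ∧ t < f (τ p)}) : Set ℝ) ↔ s ∈ ⋃ p, B p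
    simp only [mem_inter_iff, mem_Ioi, mem_preimage, mem_Ioc, mem_ofPred_eq, mem_iUnion, hB]
    constructor
    · rintro ⟨hs0, ⟨h1, h2⟩, p, hpA, h3, h4⟩
      refine ⟨p, ⟨hpA, ?_, ?_⟩, hs0, h3, h4⟩
      · by_contra! h
        exact (h4.trans_le (hmono h)).not_gt h1
      · by_contra! h
        have e : ENNReal.ofReal s = f b := le_antisymm h2 (h3 b h)
        exact hs2 (by rw [← e, ENNReal.toReal_ofReal hs0.le])
    · rintro ⟨p, ⟨hpA, h1, h2⟩, hs0, h3, h4⟩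
      refine ⟨hs0, ⟨lt_of_le_of_ne (h3 a h1) fun e => hs1 ?_, h4.le.trans (hmono h2)⟩,
        p, hpA, h3, h4⟩
      rw [e, ENNReal.toReal_ofReal hs0.le]
  have hBm : ∀ p, MeasurableSet (B p) := by
    intro p
    have e : B p = {s : ℝ | p ∈ A ∧ τ p ∈ Ioc a b} ∩ (Ioi 0 ∩ ENNReal.ofReal ⁻¹'
        (Ici (⨆ r : {r // r < τ p}, f r.1) ∩ Iio (f (τ p)))) := by
      ext s
      simp only [hB, mem_inter_iff, mem_ofPred_eq, mem_Ioi, mem_preimage, mem_Ici, mem_Iio,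
        iSup_le_iff, Subtype.forall]
    rw [e]
    exact (MeasurableSet.const _).inter (measurableSet_Ioi.inter
      (ENNReal.measurable_ofReal (measurableSet_Ici.inter measurableSet_Iio)))
  rw [measure_congr hset, measure_iUnion _ hBm]
  · refine tsum_congr fun p => ?_
    by_cases hp : p ∈ A ∧ τ p ∈ Ioc a b
    · rw [Set.indicator_of_mem (by exact hp), ← volume_jump hτ hτ0 hf
        (ne_top_of_le_ne_top hb (hmono hp.2.2))]
      simp only [hB, hp, true_and]
    · rw [Set.indicator_of_notMem (by exact hp)]
      have e : B p = ∅ := Set.eq_empty_of_forall_notMem fun s hs => hp hs.1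
      rw [e, measure_empty]
  · intro p q hpq
    rw [Function.onFun, Set.disjoint_left]
    rintro s ⟨-, -, h1, h2⟩ ⟨-, -, h3, h4⟩
    exact hpq (hτ ((genInv_eq h1 h2).symm.trans (genInv_eq h3 h4)))

end PureJump

/-! ### Occupation times of the next level -/

section Occupation

variable {R : Input} {k : ℕ}

lemma Xi_succ_eq_tsum (R : Input) (k : ℕ) (t : ℝ≥0∞) :
    Xi R (k + 1) t = ∑' p : ℕ+ × ℕ+, (Iic t).indicator (fun _ =>
      extendZero (fun v => ENNReal.ofReal (R.γ (k + 1) (Fin.snoc v p.1)))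
        (X R k (ENNReal.ofReal (R.σ (k + 1) p.1 p.2))) * ENNReal.ofReal (R.T (k + 1) p.1 p.2))
      (ENNReal.ofReal (R.σ (k + 1) p.1 p.2)) := by
  rw [ENNReal.tsum_prod']
  simp only [Xi, clockSum, Set.indicator, mem_Iic]

/-- The time spent at a node by the next process is the sum of the corresponding jumps. -/
theorem occupation_snoc (hpos : ∀ x i, 0 < R.σ (k + 1) x i)
    (hinj : Function.Injective fun p : ℕ+ × ℕ+ => R.σ (k + 1) p.1 p.2) {a b : ℝ≥0∞}
    (hb : Xi R (k + 1) b ≠ ∞) (v : Fin k → ℕ+) (x : ℕ+) :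
    occupation (X R (k + 1)) (Xi R (k + 1) a) (Xi R (k + 1) b) (Fin.snoc v x) =
      ENNReal.ofReal (R.γ (k + 1) (Fin.snoc v x)) * visitTime R (X R k) a b v x := by
  set τ : ℕ+ × ℕ+ → ℝ≥0∞ := fun p => ENNReal.ofReal (R.σ (k + 1) p.1 p.2) with hτdef
  have hτ0 : ∀ p, 0 < τ p := fun p => ENNReal.ofReal_pos.2 (hpos p.1 p.2)
  have hτ : Function.Injective τ := fun p q h =>
    hinj ((ENNReal.ofReal_eq_ofReal_iff (hpos _ _).le (hpos _ _).le).1 h)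
  set f := Xi R (k + 1) with hfdef
  have hmono : Monotone f := Xi_mono R (k + 1)
  set A : Set (ℕ+ × ℕ+) := {p | p.1 = x ∧ X R k (τ p) = toState v} with hA
  have hin : ∀ t y, InInterval R (k + 1) f t y ↔
      ∃ i, (∀ r < τ (y, i), f r ≤ t) ∧ t < f (τ (y, i)) := by
    intro t y
    rw [inInterval_iff hmono]
    exact exists_congr fun i => ⟨fun h => h.2, fun h => ⟨hτ0 (y, i), h⟩⟩
  have hset : {t | X R (k + 1) t = toState (Fin.snoc v x : Fin (k + 1) → ℕ+)} =
      {t | ∃ p ∈ A, (∀ r < τ p, f r ≤ t) ∧ t < f (τ p)} := by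
    ext t
    rw [mem_ofPred_eq, X_succ_eq_iff, lastCoord_eq_coe_iff]
    constructor
    · rintro ⟨h1, h2, -⟩
      obtain ⟨i, h3, h4⟩ := (hin t x).1 h2
      refine ⟨(x, i), ⟨rfl, ?_⟩, h3, h4⟩
      rw [← genInv_eq h3 h4]
      exact h1
    · rintro ⟨⟨y, i⟩, ⟨rfl, h1⟩, h3, h4⟩
      refine ⟨?_, (hin t y).2 ⟨i, h3, h4⟩, fun z hz h => ?_⟩
      · rw [← hfdef, genInv_eq h3 h4]
        exact h1
      -- A smaller coordinate would give a second jump interval containing `t`, at a different mark.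
      · obtain ⟨j, h5, h6⟩ := (hin t z).1 h
        have := hτ ((genInv_eq h3 h4).symm.trans (genInv_eq h5 h6))
        exact hz.ne (congrArg Prod.fst this).symm
  rw [occupation, hset, volume_jumps hτ hτ0 (Xi_succ_eq_tsum R k) hmono A hb, visitTime,
    ← ENNReal.tsum_mul_left, ENNReal.tsum_prod', tsum_eq_single x]
  · refine tsum_congr fun i => ?_
    by_cases h : X R k (τ (x, i)) = toState v
    · by_cases h' : τ (x, i) ∈ Ioc a b
      · rw [Set.indicator_of_mem (show (x, i) ∈ A ∩ τ ⁻¹' Ioc a b from ⟨⟨rfl, h⟩, h'⟩),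
          Set.indicator_of_mem (by exact ⟨h', h⟩), Pi.one_apply, one_mul]
        simp only [hτdef] at h
        simp only [h, extendZero_toState]
      · rw [Set.indicator_of_notMem (fun hh => h' hh.2), Set.indicator_of_notMem
          (fun hh => h' hh.1), zero_mul, mul_zero]
    · rw [Set.indicator_of_notMem (fun hh => h hh.1.2), Set.indicator_of_notMem
          (fun hh => h hh.2), zero_mul, mul_zero]
  · intro y hy
    rw [ENNReal.tsum_eq_zero]
    intro i
    exact Set.indicator_of_notMem (fun hh => hy hh.1.1) _

lemma tsum_snoc (F : (Fin (k + 1) → ℕ+) → ℝ≥0∞) :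
    ∑' y, F y = ∑' (v : Fin k → ℕ+) (x : ℕ+), F (Fin.snoc v x) := by
  rw [← (Fin.snocEquiv fun _ => ℕ+).tsum_eq F, ENNReal.tsum_prod', ENNReal.tsum_comm]
  rfl

/-- The link between consecutive levels: `c = W` turns the exponent at one depth into the adjusted
window of the level before, and `c = 1` gives the total time at nodes. -/
lemma tsum_occupation_mul (hpos : ∀ x i, 0 < R.σ (k + 1) x i)
    (hinj : Function.Injective fun p : ℕ+ × ℕ+ => R.σ (k + 1) p.1 p.2) {a b : ℝ≥0∞}
    (hb : Xi R (k + 1) b ≠ ∞) (c : (Fin (k + 1) → ℕ+) → ℝ≥0∞) :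
    ∑' y, occupation (X R (k + 1)) (Xi R (k + 1) a) (Xi R (k + 1) b) y * c y =
      windowSum R (X R k) (fun y => c y * ENNReal.ofReal (R.γ (k + 1) y)) a b := by
  rw [tsum_snoc, windowSum_eq_visitTime]
  refine tsum_congr fun v => tsum_congr fun x => ?_
  rw [occupation_snoc hpos hinj hb]
  ring

lemma occupation_le_add {Y : ℝ≥0∞ → (Fin k → WithTop ℕ+)} (a b c : ℝ≥0∞) (v : Fin k → ℕ+) :
    occupation Y a c v ≤ occupation Y a b v + occupation Y b c v := by
  refine (measure_mono ?_).trans (measure_union_le _ _)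
  rintro s ⟨h0, ⟨h1, h2⟩, h3⟩
  rcases le_or_gt (ENNReal.ofReal s) b with h | h
  · exact Or.inl ⟨h0, ⟨h1, h⟩, h3⟩
  · exact Or.inr ⟨h0, ⟨h, h2⟩, h3⟩

/-- The next process is a.e. at a node up to the total of the jumps. -/
lemma le_tsum_occupation (hpos : ∀ x i, 0 < R.σ (k + 1) x i)
    (hinj : Function.Injective fun p : ℕ+ × ℕ+ => R.σ (k + 1) p.1 p.2)
    (hX : ∀ v, MeasurableSet {r | X R (k + 1) r = toState v}) {b c : ℝ≥0∞}
    (hb : Xi R (k + 1) b ≠ ∞) (hc : c ≤ Xi R (k + 1) b) :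
    c ≤ ∑' v, occupation (X R (k + 1)) 0 c v := by
  have h0 : Xi R (k + 1) 0 = 0 := clockSum_zero (Y := X R k)
    (w := fun v => ENNReal.ofReal (R.γ (k + 1) v)) hpos
  have h1 := tsum_occupation_mul hpos hinj (a := 0) hb fun _ => 1
  simp only [mul_one, one_mul, h0] at h1
  have h2 : windowSum R (X R k) (fun y => ENNReal.ofReal (R.γ (k + 1) y)) 0 b =
      Xi R (k + 1) b := (clockSum_eq_windowSum (Y := X R k)
    (w := fun v => ENNReal.ofReal (R.γ (k + 1) v)) hpos b).symm
  rw [h2] at h1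
  -- Up to `Ξ(b)` the occupation is complete, and the piece beyond `c` accounts for at most `Ξ(b) -
  -- c`.
  have h3 : Xi R (k + 1) b ≤
      ∑' v, occupation (X R (k + 1)) 0 c v + (Xi R (k + 1) b - c) := by
    calc Xi R (k + 1) b = ∑' v, occupation (X R (k + 1)) 0 (Xi R (k + 1) b) v := h1.symm
      _ ≤ ∑' v, (occupation (X R (k + 1)) 0 c v +
            occupation (X R (k + 1)) c (Xi R (k + 1) b) v) :=
          ENNReal.tsum_le_tsum fun v => occupation_le_add _ _ _ _
      _ = _ := ENNReal.tsum_add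
      _ ≤ _ := by
          gcongr
          exact tsum_occupation_le hX _ _
  rw [← tsub_le_iff_right, ENNReal.sub_sub_cancel hb hc] at h3
  exact h3

end Occupation

/-! ### Distinct Poisson marks, and the submartingale of adjusted windows -/

namespace IsRandomInput

variable {Ω : Type*} {mΩ : MeasurableSpace Ω} {P : Measure Ω} [IsProbabilityMeasure P]
  {α : ℕ → ℝ} {R : Ω → Input}

/-- The Laplace functional of the indicator of `{s}`, a Lebesgue-null set, equals `1`, so the number
of points at `s` vanishes a.s. -/
lemma ae_σ_ne (hR : IsRandomInput P α R) (k : ℕ) (y : ℕ+) (s : ℝ) :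
    ∀ᵐ ω ∂P, ∀ j, (R ω).σ (k + 1) y j ≠ s := by
  have hf : Measurable (({s} : Set ℝ).indicator fun _ => (1 : ℝ≥0∞)) :=
    measurable_const.indicator (measurableSet_singleton s)
  have h := (hR.σ_poisson k y).laplace (fun i => hR.measurable_σ _ _ _) hf
  have h0 : ∫⁻ u in Ioi (0 : ℝ), 1 - expNeg (({s} : Set ℝ).indicator (fun _ => 1) u) = 0 := by
    rw [← lintegral_zero (μ := volume.restrict (Ioi (0 : ℝ)))]
    refine lintegral_congr_ae ?_
    have h1 : ∀ᵐ u : ℝ, u ≠ s := by simp [ae_iff]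
    filter_upwards [ae_restrict_of_ae h1] with u hu
    simp [hu]
  rw [h0, expNeg_zero] at h
  filter_upwards [ae_eq_zero_of_laplace h.ge] with ω hω j hj
  have := ENNReal.tsum_eq_zero.1 hω j
  simp [hj] at this

/-- The marks of the Poisson processes of a level are a.s. distinct. -/
lemma ae_σ_injective (hR : IsRandomInput P α R) : ∀ᵐ ω ∂P, ∀ k : ℕ,
    Function.Injective fun p : ℕ+ × ℕ+ => (R ω).σ (k + 1) p.1 p.2 := by
  have hne : ∀ (k : ℕ) (x y i j : ℕ+), x ≠ y →
      ∀ᵐ ω ∂P, (R ω).σ (k + 1) x i ≠ (R ω).σ (k + 1) y j := by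
    intro k x y i j hxy
    have hind : Indep (block R (Sum.inr (Sum.inl (k, x)))) (block R (Sum.inr (Sum.inl (k, y)))) P :=
      hR.iIndep_block.indep (by simpa using hxy)
    have hset : MeasurableSet[(block R (Sum.inr (Sum.inl (k, x)))).prod
        (block R (Sum.inr (Sum.inl (k, y))))]
        {p : Ω × Ω | (R p.1).σ (k + 1) x i = (R p.2).σ (k + 1) y j} := by
      let _ := (block R (Sum.inr (Sum.inl (k, x)))).prod (block R (Sum.inr (Sum.inl (k, y))))
      exact measurableSet_eq_fun ((measurable_block_σ R k x i).comp (@measurable_fst Ω Ω (_) (_)))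
        ((measurable_block_σ R k y j).comp (@measurable_snd Ω Ω (_) (_)))
    have h := lintegral_diag_of_indep (P := P) (hR.block_le _) (hR.block_le _) hind
      (F := fun ω ω' => {p : Ω × Ω | (R p.1).σ (k + 1) x i = (R p.2).σ (k + 1) y j}.indicator
        (fun _ => 1) (ω, ω')) (Measurable.indicator measurable_const hset)
    have h0 : ∀ ω, ∫⁻ ω', {p : Ω × Ω | (R p.1).σ (k + 1) x i = (R p.2).σ (k + 1) y j}.indicator
        (fun _ => (1 : ℝ≥0∞)) (ω, ω') ∂P = 0 := by
      intro ω
      rw [← lintegral_zero (μ := P)]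
      refine lintegral_congr_ae ?_
      filter_upwards [hR.ae_σ_ne k y ((R ω).σ (k + 1) x i)] with ω' hω'
      exact Set.indicator_of_notMem (fun h => hω' j (Eq.symm h)) (fun _ => (1 : ℝ≥0∞))
    simp_rw [h0, lintegral_zero] at h
    have hm : Measurable fun ω => {p : Ω × Ω | (R p.1).σ (k + 1) x i =
        (R p.2).σ (k + 1) y j}.indicator (fun _ => (1 : ℝ≥0∞)) (ω, ω) := by
      have e : (fun ω => {p : Ω × Ω | (R p.1).σ (k + 1) x i =
          (R p.2).σ (k + 1) y j}.indicator (fun _ => (1 : ℝ≥0∞)) (ω, ω)) =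
          {ω | (R ω).σ (k + 1) x i = (R ω).σ (k + 1) y j}.indicator fun _ => 1 := rfl
      rw [e]
      exact measurable_const.indicator
        (measurableSet_eq_fun (hR.measurable_σ _ _ _) (hR.measurable_σ _ _ _))
    filter_upwards [(lintegral_eq_zero_iff hm).1 h] with ω hω hσ
    rw [Set.indicator_of_mem (by exact hσ)] at hω
    exact one_ne_zero hω
  have h1 : ∀ᵐ ω ∂P, ∀ (k : ℕ) (x y i j : ℕ+), x ≠ y →
      (R ω).σ (k + 1) x i ≠ (R ω).σ (k + 1) y j := by
    simp_rw [ae_all_iff]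
    exact hne
  have h2 : ∀ᵐ ω ∂P, ∀ (k : ℕ) (x : ℕ+), StrictMono ((R ω).σ (k + 1) x) := by
    simp_rw [ae_all_iff]
    intro k x
    filter_upwards [hR.σ_ordered k x] with ω hω using hω.1
  filter_upwards [h1, h2] with ω hω1 hω2 k
  rintro ⟨x, i⟩ ⟨y, j⟩ h
  by_cases hxy : x = y
  · subst hxy
    exact congrArg (Prod.mk x) ((hω2 k x).injective h)
  · exact absurd h (hω1 k x y i j hxy)

/-! ### The increments of the adjusted clock compositions -/

lemma measurable_adjustedWindow (α : ℕ → ℝ) (R : Ω → Input) (k n : ℕ) (a b : ℝ≥0∞) :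
    Measurable[blocks R (pastBlocks (n + 1) ∪ gammaBlocks)] fun ω =>
      adjustedWindow α (R ω) n (theta (R ω) k n a) (theta (R ω) k n b) := by
  let _ : MeasurableSpace Ω := blocks R (pastBlocks (n + 1) ∪ gammaBlocks)
  have hQ : MeasurableUpTo (n + 1) R := measurableUpTo_blocks R subset_union_left
  have hQ' : MeasurableUpTo n R := hQ.mono (Nat.le_succ n)
  refine measurable_windowSum (hQ.σ n (Nat.lt_succ_self n)) (hQ.T n (Nat.lt_succ_self n))
    (jointlyMeasurable_X hQ' le_rfl) (fun y => ?_) (measurable_theta hQ' k a)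
    (measurable_theta hQ' k b)
  exact ((measurable_subtreeLimit α R y).mono (blocks_mono R ((subtreeBlocks_subset y).trans
    ((gammaBlocksFrom_subset _).trans subset_union_right))) le_rfl).mul
    (hQ.γ n (Nat.lt_succ_self n) y).ennreal_ofReal

/-- The Laplace transforms of the increments of the adjusted clock compositions form a
submartingale. -/
theorem lintegral_expNeg_adjustedWindow_mono (hR : IsRandomInput P α R) (hα : IsParameter α)
    {k n : ℕ} (hkn : k ≤ n + 1) (a b : ℝ≥0) (l : ℝ≥0∞) {g : Ω → ℝ≥0∞}
    (hg : Measurable[blocks R (pastBlocks (n + 1) ∪ gammaBlocks)] g) :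
    ∫⁻ ω, g ω * expNeg (l * adjustedWindow α (R ω) n (theta (R ω) k n a) (theta (R ω) k n b)) ∂P ≤
      ∫⁻ ω, g ω * expNeg (l * adjustedWindow α (R ω) (n + 1)
        (theta (R ω) k (n + 1) a) (theta (R ω) k (n + 1) b)) ∂P := by
  set S := pastBlocks (n + 1) ∪ gammaBlocks with hS
  have hpast : pastBlocks (n + 1) ⊆ S := Set.subset_union_left
  have hγ : ∀ y : Fin (n + 2) → ℕ+, Measurable[blocks R S] fun ω => (R ω).γ (n + 2) y := by
    intro y
    rw [← Fin.snoc_init_self y]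
    exact measurable_blocks_γ R (S := S) (Or.inr ⟨_, rfl⟩) _
  have hM : ∀ y : Fin (n + 2) → ℕ+, Measurable[blocks R S] fun ω => subtreeLimit α (R ω) y :=
    fun y => (measurable_subtreeLimit α R y).mono (blocks_mono R
      ((subtreeBlocks_subset y).trans ((gammaBlocksFrom_subset _).trans subset_union_right))) le_rfl
  have hθ : ∀ c : ℝ≥0, Measurable[blocks R S] fun ω => theta (R ω) k (n + 1) c := fun c =>
    @measurable_theta Ω (blocks R S) (n + 1) R (measurableUpTo_blocks R hpast) k c
  have h1 := hR.lintegral_expNeg_windowSum (disjoint_past_visit (n + 1))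
    (Y := fun ω => X (R ω) (n + 1))
    (@jointlyMeasurable_X Ω (blocks R S) (n + 1) R (measurableUpTo_blocks R hpast) (n + 1) le_rfl)
    (w := fun ω y => l * (subtreeLimit α (R ω) y * ENNReal.ofReal ((R ω).γ (n + 2) y)))
    (fun y => ((hM y).mul (hγ y).ennreal_ofReal).const_mul _) (hθ a) (hθ b) hg
  simp_rw [windowSum_mul] at h1
  refine le_trans ?_ h1.ge
  refine lintegral_mono_ae ?_
  filter_upwards [hR.ae_σ_pos, hR.ae_σ_injective, hR.ae_tsum_subtreeLimit_le hα,
    hR.ae_theta_lt_top hα k (n + 1) b] with ω hpos hinj hle hfin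
  rw [theta_succ_of_le _ hkn] at hfin
  gcongr
  refine expNeg_antitone ?_
  -- The window of the earlier level is itself `∑_v L_v W(v)` for the occupation times of the next
  -- process, so the comparison can be made node by node.
  rw [theta_succ_of_le _ hkn, theta_succ_of_le _ hkn, adjustedWindow,
    ← tsum_occupation_mul (hpos n) (hinj n) hfin.ne, ← ENNReal.tsum_mul_left]
  refine ENNReal.tsum_le_tsum fun v => ?_
  rw [mul_left_comm]
  gcongr
  calc ∑' x : ℕ+, psi (l * (subtreeLimit α (R ω) (Fin.snoc v x : Fin (n + 2) → ℕ+) *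
        ENNReal.ofReal ((R ω).γ (n + 2) (Fin.snoc v x))))
      ≤ ∑' x : ℕ+, l * (subtreeLimit α (R ω) (Fin.snoc v x : Fin (n + 2) → ℕ+) *
        ENNReal.ofReal ((R ω).γ (n + 2) (Fin.snoc v x))) :=
        ENNReal.tsum_le_tsum fun x => psi_le _
    _ ≤ l * subtreeLimit α (R ω) v := by
        rw [ENNReal.tsum_mul_left]
        gcongr
        exact hle (n + 1) v

/-- The filtration contains all marks `γ` from the start, so every `W` is known and only the visits
of the new level are averaged. -/
lemma ae_exists_tendsto_adjustedWindow (hR : IsRandomInput P α R) (hα : IsParameter α) (j : ℕ)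
    (a b : ℝ≥0) : ∀ᵐ ω ∂P, ∃ c, Tendsto (fun m => adjustedWindow α (R ω) (j + m)
      (theta (R ω) (j + 1) (j + m) a) (theta (R ω) (j + 1) (j + m) b)) atTop (𝓝 c) := by
  refine ae_exists_tendsto_of_expNeg_submartingale
    (𝓢 := fun m => blocks R (pastBlocks (j + m + 1) ∪ gammaBlocks))
    (fun m m' h => blocks_mono R (Set.union_subset_union_left _ (pastBlocks_mono (by omega))))
    (fun m => hR.blocks_le _) (fun m => measurable_adjustedWindow α R (j + 1) (j + m) a b)
    fun m A hA => ?_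
  have hA' : MeasurableSet A := hR.blocks_le _ A hA
  have hind : ∀ f : Ω → ℝ≥0∞, ∫⁻ ω, A.indicator 1 ω * f ω ∂P = ∫⁻ ω in A, f ω ∂P := by
    intro f
    rw [← lintegral_indicator hA']
    refine lintegral_congr fun ω => ?_
    by_cases hω : ω ∈ A <;> simp [hω]
  have h := hR.lintegral_expNeg_adjustedWindow_mono hα (k := j + 1) (n := j + m) (by omega) a b 1
    (g := A.indicator 1) (by
      let _ : MeasurableSpace Ω := blocks R (pastBlocks (j + m + 1) ∪ gammaBlocks)
      exact measurable_one.indicator hA)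
  simp only [one_mul] at h
  rw [hind, hind] at h
  exact h

/-- At `m = 0` the composition is empty and the times are deterministic, so the first moment bound
applies; the submartingale property then preserves the estimate, with no loss in `m`. -/
lemma le_lintegral_expNeg_adjustedWindow_theta (hR : IsRandomInput P α R) (hα : IsParameter α)
    (j m : ℕ) (a b : ℝ≥0) {l : ℝ≥0∞} (hl : l ≠ ∞) :
    expNeg (l ^ α (j + 1) * (b - a)) ≤ ∫⁻ ω, expNeg (l * adjustedWindow α (R ω) (j + m)
      (theta (R ω) (j + 1) (j + m) a) (theta (R ω) (j + 1) (j + m) b)) ∂P := by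
  induction m with
  | zero =>
    simp only [add_zero, theta_of_lt _ (Nat.lt_succ_self j)]
    have h := hR.le_lintegral_expNeg_adjustedWindow hα (k := j) hl (a := fun _ => (a : ℝ≥0∞))
      (b := fun _ => (b : ℝ≥0∞)) (g := fun _ => 1) measurable_const measurable_const
      measurable_const (Eventually.of_forall fun ω => ENNReal.coe_lt_top)
    simpa using h
  | succ m ih =>
    have h := hR.lintegral_expNeg_adjustedWindow_mono hα (k := j + 1) (n := j + m) (by omega) a b l
      (g := fun _ => 1) measurable_const
    simp only [one_mul] at h
    exact ih.trans h

end IsRandomInput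

/-! ### The limiting clocks -/

/-- The increment over `(a, b]` of the limiting clock `θ_{j+1}^∞`. -/
def limitWindow (α : ℕ → ℝ) (R : Input) (j : ℕ) (a b : ℝ≥0∞) : ℝ≥0∞ :=
  limsup (fun m => adjustedWindow α R (j + m) (theta R (j + 1) (j + m) a)
    (theta R (j + 1) (j + m) b)) atTop

lemma theta_zero {R : Input} (hpos : ∀ (k : ℕ) (x i : ℕ+), 0 < R.σ (k + 1) x i) (k n : ℕ) :
    theta R k n 0 = 0 := by
  induction n with
  | zero => rfl
  | succ n ih =>
    by_cases h : k ≤ n + 1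
    · rw [theta_succ_of_le R h, ih]
      exact clockSum_zero (Y := X R n) (w := fun v => ENNReal.ofReal (R.γ (n + 1) v)) (hpos n)
    · exact theta_of_lt R (not_le.1 h) 0

lemma thetaTilde_succ_eq {α : ℕ → ℝ} {R : Input}
    (hpos : ∀ (k : ℕ) (x i : ℕ+), 0 < R.σ (k + 1) x i)
    (hW : ∀ (k : ℕ) (v : Fin k → ℕ+), W α R v = subtreeLimit α R v) (k n : ℕ) (t : ℝ≥0∞) :
    thetaTilde α R k (n + 1) t = adjustedWindow α R n 0 (theta R k n t) := by
  have h := clockSum_eq_windowSum (Y := X R n)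
    (w := fun y => W α R y * ENNReal.ofReal (R.γ (n + 1) y)) (hpos n) (theta R k n t)
  simp only [hW] at h
  rw [adjustedWindow, ← h]
  simp only [thetaTilde, XiTilde, hW]
  rfl

lemma adjustedWindow_add (α : ℕ → ℝ) {R : Input} (hpos : ∀ (k : ℕ) (x i : ℕ+), 0 < R.σ (k + 1) x i)
    (n : ℕ) {a b : ℝ≥0∞} (h : a ≤ b) :
    adjustedWindow α R n 0 b = adjustedWindow α R n 0 a + adjustedWindow α R n a b := by
  unfold adjustedWindow
  rw [← clockSum_eq_windowSum (hpos n), ← clockSum_eq_windowSum (hpos n), clockSum_add_windowSum h]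

lemma thetaLim_mono (α : ℕ → ℝ) (R : Input) (k : ℕ) : Monotone (thetaLim α R k) := by
  intro s t h
  refine limsup_le_limsup (Eventually.of_forall fun n => ?_)
  have h1 := theta_mono R k (n - 1) h
  unfold thetaTilde
  cases n with
  | zero => exact h1
  | succ n =>
    exact clockSum_mono (R := R) (Y := X R n)
      (w := fun v => W α R v * ENNReal.ofReal (R.γ (n + 1) v)) h1

/-! ### Existence, finiteness and right-continuity of the limiting clock -/

namespace IsRandomInput

section

variable {Ω : Type*} {mΩ : MeasurableSpace Ω} {P : Measure Ω} {α : ℕ → ℝ} {R : Ω → Input}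

lemma measurable_adjustedWindow_theta (hR : IsRandomInput P α R) (j m : ℕ) (a b : ℝ≥0∞) :
    Measurable fun ω => adjustedWindow α (R ω) (j + m) (theta (R ω) (j + 1) (j + m) a)
      (theta (R ω) (j + 1) (j + m) b) :=
  (measurable_adjustedWindow α R (j + 1) (j + m) a b).mono (hR.blocks_le _) le_rfl

lemma measurable_limitWindow (hR : IsRandomInput P α R) (j : ℕ) (a b : ℝ≥0∞) :
    Measurable fun ω => limitWindow α (R ω) j a b :=
  Measurable.limsup fun m => hR.measurable_adjustedWindow_theta j m a b

end

variable {Ω : Type*} {mΩ : MeasurableSpace Ω} {P : Measure Ω} [IsProbabilityMeasure P]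
  {α : ℕ → ℝ} {R : Ω → Input}

lemma ae_tendsto_limitWindow (hR : IsRandomInput P α R) (hα : IsParameter α) (j : ℕ) (a b : ℝ≥0) :
    ∀ᵐ ω ∂P, Tendsto (fun m => adjustedWindow α (R ω) (j + m) (theta (R ω) (j + 1) (j + m) a)
      (theta (R ω) (j + 1) (j + m) b)) atTop (𝓝 (limitWindow α (R ω) j a b)) := by
  filter_upwards [hR.ae_exists_tendsto_adjustedWindow hα j a b] with ω ⟨c, hc⟩
  rw [limitWindow, hc.limsup_eq]
  exact hc

lemma le_lintegral_expNeg_limitWindow (hR : IsRandomInput P α R) (hα : IsParameter α) (j : ℕ)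
    (a b : ℝ≥0) {l : ℝ≥0∞} (hl : l ≠ ∞) :
    expNeg (l ^ α (j + 1) * (b - a)) ≤ ∫⁻ ω, expNeg (l * limitWindow α (R ω) j a b) ∂P := by
  refine ge_of_tendsto' (tendsto_lintegral_expNeg
    (fun m => (hR.measurable_adjustedWindow_theta j m a b).const_mul l) ?_)
    fun m => hR.le_lintegral_expNeg_adjustedWindow_theta hα j m a b hl
  filter_upwards [hR.ae_tendsto_limitWindow hα j a b] with ω hω
  exact ENNReal.Tendsto.const_mul hω (Or.inr hl)

lemma ae_limitWindow_lt_top (hR : IsRandomInput P α R) (hα : IsParameter α) (j : ℕ) (a b : ℝ≥0) :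
    ∀ᵐ ω ∂P, limitWindow α (R ω) j a b < ∞ := by
  have hα1 := hα.pos (j + 1) (by omega)
  refine ae_lt_top_of_laplace (hR.measurable_limitWindow j a b)
    (b := fun i => expNeg (((i : ℝ≥0∞) + 1)⁻¹ ^ α (j + 1) * (b - a))) ?_ fun i =>
      hR.le_lintegral_expNeg_limitWindow hα j a b (by simp)
  have h1 : Tendsto (fun i : ℕ => ((i : ℝ≥0∞) + 1)⁻¹ ^ α (j + 1)) atTop (𝓝 0) := by
    have := (ENNReal.continuous_rpow_const (y := α (j + 1))).tendsto 0 |>.comp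
      tendsto_inv_natCast_add_one
    rwa [ENNReal.zero_rpow_of_pos hα1] at this
  have h2 := ENNReal.Tendsto.mul_const (b := (b : ℝ≥0∞) - a) h1
    (Or.inr (tsub_le_self.trans_lt ENNReal.coe_lt_top).ne)
  rw [zero_mul] at h2
  have h3 := (continuous_expNeg.tendsto 0).comp h2
  rw [expNeg_zero] at h3
  exact h3

/-- The adjusted clock compositions converge a.s. at each fixed time. -/
theorem ae_tendsto_thetaTilde (hR : IsRandomInput P α R) (hα : IsParameter α) (j : ℕ) (t : ℝ≥0) :
    ∀ᵐ ω ∂P, Tendsto (fun n => thetaTilde α (R ω) (j + 1) n t) atTop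
      (𝓝 (limitWindow α (R ω) j 0 t)) := by
  filter_upwards [hR.ae_tendsto_limitWindow hα j 0 t, hR.ae_σ_pos, hR.ae_W_eq] with ω h hpos hW
  -- The shift matches the indices: `thetaTilde` at `j + m + 1` is an adjusted window with index `j
  -- + m`.
  rw [← tendsto_add_atTop_iff_nat (j + 1)]
  refine h.congr fun m => ?_
  rw [ENNReal.coe_zero, theta_zero hpos, ← add_assoc, thetaTilde_succ_eq hpos hW, add_comm m j]

lemma ae_thetaLim_eq (hR : IsRandomInput P α R) (hα : IsParameter α) (j : ℕ) (t : ℝ≥0) :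
    ∀ᵐ ω ∂P, thetaLim α (R ω) (j + 1) t = limitWindow α (R ω) j 0 t := by
  filter_upwards [hR.ae_tendsto_thetaTilde hα j t] with ω h using h.limsup_eq

/-- The limiting clock is a.s. right-continuous at each fixed time. -/
theorem ae_thetaInf_eq (hR : IsRandomInput P α R) (hα : IsParameter α) (j : ℕ) {D : Set ℝ≥0}
    (hD : Dense D) (t : ℝ≥0) :
    ∀ᵐ ω ∂P, thetaInf α (R ω) D (j + 1) t = limitWindow α (R ω) j 0 t := by
  by_cases ht : t ∈ D
  · simp only [thetaInf, ht, if_true]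
    exact hR.ae_thetaLim_eq hα j t
  have hs : ∀ i : ℕ, ∃ s ∈ D, t < s ∧ s < t + ((i : ℝ≥0) + 1)⁻¹ := by
    intro i
    obtain ⟨s, hs, hsD⟩ := hD.exists_between
      (lt_add_of_pos_right t (show (0 : ℝ≥0) < ((i : ℝ≥0) + 1)⁻¹ by positivity))
    exact ⟨s, hs, hsD⟩
  choose s hsD hts hst using hs
  -- The transform of the infimum dominates that of each increment, which is at least `e^{-(s i -
  -- t)}` and tends to `1`.
  have hzero : ∀ᵐ ω ∂P, ⨅ i, limitWindow α (R ω) j t (s i) = 0 := by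
    refine ae_eq_zero_of_laplace ?_
    have h1 : Tendsto (fun i : ℕ => expNeg ((i : ℝ≥0∞) + 1)⁻¹) atTop (𝓝 1) := by
      have h3 := (continuous_expNeg.tendsto 0).comp tendsto_inv_natCast_add_one
      rw [expNeg_zero] at h3
      exact h3
    refine le_of_tendsto' h1 fun i => ?_
    have h2 := hR.le_lintegral_expNeg_limitWindow hα j t (s i) (l := 1) ENNReal.one_ne_top
    simp only [ENNReal.one_rpow, one_mul] at h2
    calc expNeg ((i : ℝ≥0∞) + 1)⁻¹ ≤ expNeg (s i - t) := by
          refine expNeg_antitone ?_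
          rw [tsub_le_iff_left]
          have h3 : (s i : ℝ≥0∞) ≤ ((t + ((i : ℝ≥0) + 1)⁻¹ : ℝ≥0) : ℝ≥0∞) := by
            exact_mod_cast (hst i).le
          refine h3.trans ?_
          rw [ENNReal.coe_add, ENNReal.coe_inv (by positivity)]
          simp
      _ ≤ _ := h2
      _ ≤ _ := lintegral_mono fun ω => expNeg_antitone (iInf_le _ i)
  have hwin : ∀ᵐ ω ∂P, ∀ i, thetaLim α (R ω) (j + 1) (s i) =
      limitWindow α (R ω) j 0 t + limitWindow α (R ω) j t (s i) := by
    rw [ae_all_iff]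
    intro i
    filter_upwards [hR.ae_thetaLim_eq hα j (s i), hR.ae_tendsto_limitWindow hα j 0 t,
      hR.ae_tendsto_limitWindow hα j t (s i), hR.ae_tendsto_limitWindow hα j 0 (s i),
      hR.ae_σ_pos] with ω h1 h2 h3 h4 hpos
    rw [h1]
    refine tendsto_nhds_unique h4 ((h2.add h3).congr fun m => ?_)
    rw [ENNReal.coe_zero, theta_zero hpos]
    exact (adjustedWindow_add α hpos (j + m) (theta_mono _ _ _
      (by exact_mod_cast (hts i).le))).symm
  filter_upwards [hzero, hwin, hR.ae_thetaLim_eq hα j t] with ω h0 h1 h2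
  simp only [thetaInf, ht, if_false]
  apply le_antisymm
  · calc _ ≤ ⨅ i, (limitWindow α (R ω) j 0 t + limitWindow α (R ω) j t (s i)) := by
          refine le_iInf fun i => ?_
          rw [← h1 i]
          exact iInf_le (fun s : {s : ℝ≥0 // s ∈ D ∧ t < s} => thetaLim α (R ω) (j + 1) s.1)
            ⟨s i, hsD i, hts i⟩
      _ = limitWindow α (R ω) j 0 t := by rw [← ENNReal.add_iInf, h0, add_zero]
  · rw [← h2]
    exact le_iInf fun s => thetaLim_mono α (R ω) (j + 1) (by exact_mod_cast s.2.2.le)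

end IsRandomInput

/-! ### Comparison of the clock compositions with the adjusted ones -/

/-- First fix `δ` small enough that `2 / ((1 + δ) (1 + K δ))` exceeds `2 - η`; then the powers
converge because `α n → 1`. The factor `2 ^ α (n + 1)` is `l ^ α (n + 1)` at `l = 2`. -/
lemma eventually_lt_rate {α : ℕ → ℝ} (hα : IsParameter α) {K η : ℝ} (hη : 0 < η) :
    ∃ δ > 0, ∀ᶠ n in atTop, 2 - η ≤
      2 ^ α (n + 1) * (δ ^ (1 - α (n + 1)) / ((1 + δ) * (1 + K * δ))) := by
  have h1 : Tendsto (fun δ : ℝ => 2 / ((1 + δ) * (1 + K * δ))) (𝓝[>] 0) (𝓝 2) := by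
    have : ContinuousAt (fun δ : ℝ => 2 / ((1 + δ) * (1 + K * δ))) 0 :=
      ContinuousAt.div (by fun_prop) (by fun_prop) (by simp)
    have h := this.tendsto.mono_left (nhdsWithin_le_nhds (s := Ioi 0))
    simpa using h
  obtain ⟨δ, hδ1, hδ⟩ := ((h1.eventually (lt_mem_nhds (show 2 - η < 2 by linarith))).and
    self_mem_nhdsWithin).exists
  have hδ0 : (0 : ℝ) < δ := hδ
  refine ⟨δ, hδ0, ?_⟩
  have hα1 : Tendsto (fun n => α (n + 1)) atTop (𝓝 1) := (tendsto_add_atTop_iff_nat 1).2 hα.tendsto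
  have h2 : Tendsto (fun n => 2 ^ α (n + 1) * (δ ^ (1 - α (n + 1)) / ((1 + δ) * (1 + K * δ))))
      atTop (𝓝 (2 ^ (1 : ℝ) * (δ ^ (1 - 1 : ℝ) / ((1 + δ) * (1 + K * δ))))) := by
    refine Tendsto.mul ?_ (Tendsto.div_const ?_ _)
    · exact (Real.continuousAt_const_rpow (by norm_num)).tendsto.comp hα1
    · exact (Real.continuousAt_const_rpow hδ0.ne').tendsto.comp (tendsto_const_nhds.sub hα1)
  refine (h2.eventually (lt_mem_nhds ?_)).mono fun n h => h.le
  rwa [Real.rpow_one, sub_self, Real.rpow_zero, mul_one_div]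

/-- Removes the truncation at `K`. Beyond `K` the left side is at most `e^{-K} ≤ ε`, as `c ≥ 1`;
below `K`, replacing `c` by `2` costs at most `(2 - c) s ≤ ε` when `c < 2`. -/
lemma expNeg_min_le {ε K c : ℝ} (hK : 0 < K) (hKε : Real.exp (-K) ≤ ε) (hε1 : ε ≤ K)
    (hc : 2 - ε / K ≤ c) (s : ℝ≥0∞) :
    expNeg (ENNReal.ofReal c * min s (ENNReal.ofReal K)) ≤ expNeg (2 * s) + ENNReal.ofReal ε := by
  have hc1 : 1 ≤ c := by
    have : ε / K ≤ 1 := (div_le_one hK).2 hε1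
    linarith
  rcases le_total (ENNReal.ofReal K) s with h | h
  · rw [min_eq_right h, ← ENNReal.ofReal_mul (by linarith), expNeg_ofReal (by positivity)]
    refine le_add_left (ENNReal.ofReal_le_ofReal (le_trans (Real.exp_le_exp.2 ?_) hKε))
    nlinarith
  · rw [min_eq_left h]
    obtain ⟨x, hx, rfl⟩ : ∃ x : ℝ, 0 ≤ x ∧ s = ENNReal.ofReal x :=
      ⟨s.toReal, ENNReal.toReal_nonneg,
        (ENNReal.ofReal_toReal (ne_top_of_le_ne_top ENNReal.ofReal_ne_top h)).symm⟩
    have hxK : x ≤ K := (ENNReal.ofReal_le_ofReal_iff hK.le).1 h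
    have hε : 0 < ε := (Real.exp_pos _).trans_le hKε
    rw [← ENNReal.ofReal_mul (by linarith), expNeg_ofReal (by positivity),
      show (2 : ℝ≥0∞) = ENNReal.ofReal 2 by simp, ← ENNReal.ofReal_mul (by norm_num),
      expNeg_ofReal (by positivity), ← ENNReal.ofReal_add (Real.exp_pos _).le hε.le]
    apply ENNReal.ofReal_le_ofReal
    rcases le_total 2 c with h2 | h2
    · have : Real.exp (-(c * x)) ≤ Real.exp (-(2 * x)) := Real.exp_le_exp.2 (by nlinarith)
      linarith
    · have h3 : Real.exp (-(2 * x)) = Real.exp (-(c * x)) * Real.exp (-((2 - c) * x)) := by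
        rw [← Real.exp_add]
        ring_nf
      have h4 : 1 - (2 - c) * x ≤ Real.exp (-((2 - c) * x)) := by
        linarith [Real.add_one_le_exp (-((2 - c) * x))]
      have h5 : Real.exp (-(c * x)) ≤ 1 := Real.exp_le_one_iff.2 (by nlinarith)
      have h6 : (2 - c) * x ≤ ε := by
        calc (2 - c) * x ≤ ε / K * K := by
              apply mul_le_mul _ hxK hx (by positivity)
              linarith
          _ = ε := div_mul_cancel₀ _ hK.ne'
      have h7 : 0 ≤ (2 - c) * x := mul_nonneg (by linarith) hx
      have h8 := Real.exp_pos (-(c * x))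
      nlinarith

lemma ofReal_sq_sub_add (x y : ℝ≥0∞) (hx : x ≠ ∞) (hy : y ≠ ∞) :
    ENNReal.ofReal ((x.toReal - y.toReal) ^ 2) + 2 * (x * y) = x * x + y * y := by
  lift x to ℝ≥0 using hx
  lift y to ℝ≥0 using hy
  simp only [ENNReal.coe_toReal]
  rw [← ENNReal.toReal_eq_toReal_iff' (by finiteness) (by finiteness),
    ENNReal.toReal_add (by finiteness) (by finiteness),
    ENNReal.toReal_add (by finiteness) (by finiteness), ENNReal.toReal_ofReal (sq_nonneg _)]
  simp
  ring

/-! ### The `L²` comparison and convergence in probability -/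

namespace IsRandomInput

variable {Ω : Type*} {mΩ : MeasurableSpace Ω} {P : Measure Ω} [IsProbabilityMeasure P]
  {α : ℕ → ℝ} {R : Ω → Input}

lemma eventually_lintegral_expNeg_le (hR : IsRandomInput P α R) (hα : IsParameter α) (j : ℕ)
    (t : ℝ≥0) {ε : ℝ} (hε : 0 < ε) :
    ∀ᶠ n in atTop,
      ∫⁻ ω, expNeg (2 * adjustedWindow α (R ω) n 0 (theta (R ω) (j + 1) n t)) ∂P ≤
        ∫⁻ ω, expNeg (2 * theta (R ω) (j + 1) n t) ∂P + ENNReal.ofReal ε := by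
  obtain ⟨K, hK, hKε, hεK⟩ : ∃ K : ℝ, 0 < K ∧ Real.exp (-K) ≤ ε ∧ ε ≤ K := by
    have h1 : ∀ᶠ K in atTop, Real.exp (-K) < ε :=
      Real.tendsto_exp_neg_atTop_nhds_zero.eventually (gt_mem_nhds hε)
    obtain ⟨K, h1, h2, h3⟩ := (h1.and ((eventually_gt_atTop 0).and (eventually_ge_atTop ε))).exists
    exact ⟨K, h2, h1.le, h3⟩
  obtain ⟨δ, hδ, hrate⟩ := eventually_lt_rate hα (K := K) (div_pos hε hK)
  filter_upwards [hrate, eventually_ge_atTop (j + 1)] with n hn hjn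
  obtain ⟨m, rfl⟩ : ∃ m, n = m + 1 := ⟨n - 1, by omega⟩
  set b : Ω → ℝ≥0∞ := fun ω => min (theta (R ω) (j + 1) (m + 1) t) (ENNReal.ofReal K) with hb
  have hθm : Measurable[blocks R (pastBlocks (m + 1))] fun ω => theta (R ω) (j + 1) (m + 1) t :=
    @measurable_theta Ω (blocks R (pastBlocks (m + 1))) (m + 1) R
      (measurableUpTo_blocks R le_rfl) (j + 1) t
  -- For `n ≥ j + 1` the composition ends with the clock `Ξ_n`, so the truncated time lies below a
  -- value of that clock and `X_n` has been at nodes almost all of the time.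
  have hocc : ∀ᵐ ω ∂P, b ω ≤ ∑' v, occupation (X (R ω) (m + 1)) 0 (b ω) v := by
    filter_upwards [hR.ae_σ_pos, hR.ae_σ_injective, hR.ae_theta_lt_top hα (j + 1) (m + 1) t]
      with ω hpos hinj hfin
    rw [theta_succ_of_le _ hjn] at hfin
    refine le_tsum_occupation (hpos m) (hinj m) (hR.measurableSet_X_eq (m + 1) ω) hfin.ne ?_
    simp only [hb, theta_succ_of_le _ hjn]
    exact min_le_left _ _
  have h := hR.lintegral_expNeg_adjustedWindow_le hα (l := 2) (by simp) (b := b)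
    (hθm.min (@measurable_const _ _ _ (blocks R (pastBlocks (m + 1))) _)) hK.le (fun ω => min_le_right _ _) hocc hδ
  calc ∫⁻ ω, expNeg (2 * adjustedWindow α (R ω) (m + 1) 0 (theta (R ω) (j + 1) (m + 1) t)) ∂P
      ≤ ∫⁻ ω, expNeg (2 * adjustedWindow α (R ω) (m + 1) 0 (b ω)) ∂P :=
        lintegral_mono fun ω => expNeg_antitone
          (mul_le_mul_right (windowSum_mono_right (min_le_left _ _)) _)
    _ ≤ _ := h
    _ ≤ ∫⁻ ω, expNeg (2 * theta (R ω) (j + 1) (m + 1) t) + ENNReal.ofReal ε ∂P := by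
        refine lintegral_mono fun ω => ?_
        rw [← mul_assoc, show (2 : ℝ≥0∞) ^ α (m + 1 + 1) = ENNReal.ofReal (2 ^ α (m + 1 + 1)) by
          rw [← ENNReal.ofReal_rpow_of_pos two_pos]; simp, ← ENNReal.ofReal_mul (by positivity)]
        exact expNeg_min_le hK hKε hεK hn _
    _ = _ := by
        rw [lintegral_add_right _ measurable_const]
        simp

/-- The adjusted and the plain clock compositions are asymptotically equal in `L²`, after taking
Laplace transforms. -/
theorem eventually_lintegral_sq_le (hR : IsRandomInput P α R) (hα : IsParameter α) (j : ℕ)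
    (t : ℝ≥0) {ε : ℝ} (hε : 0 < ε) :
    ∀ᶠ n in atTop, ∫⁻ ω, ENNReal.ofReal
      (((expNeg (adjustedWindow α (R ω) n 0 (theta (R ω) (j + 1) n t))).toReal -
        (expNeg (theta (R ω) (j + 1) n t)).toReal) ^ 2) ∂P ≤ ENNReal.ofReal ε := by
  filter_upwards [hR.eventually_lintegral_expNeg_le hα j t hε] with n hn
  set u : Ω → ℝ≥0∞ := fun ω => adjustedWindow α (R ω) n 0 (theta (R ω) (j + 1) n t) with hu
  set s : Ω → ℝ≥0∞ := fun ω => theta (R ω) (j + 1) n t with hs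
  have hsb : Measurable[blocks R (pastBlocks n)] s :=
    @measurable_theta Ω (blocks R (pastBlocks n)) n R (measurableUpTo_blocks R le_rfl) (j + 1) t
  have hsm : Measurable s := hsb.mono (hR.blocks_le _) le_rfl
  have hum : Measurable u := measurable_windowSum (hR.measurable_σ _) (hR.measurable_T _)
    (jointlyMeasurable_X (hR.measurableUpTo n) le_rfl)
    (fun y => ((measurable_subtreeLimit α R y).mono (hR.blocks_le _) le_rfl).mul
      (hR.measurable_γ _ y).ennreal_ofReal) measurable_const hsm
  have hues : Measurable fun ω => expNeg (u ω) := measurable_expNeg.comp hum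
  have hses : Measurable fun ω => expNeg (s ω) := measurable_expNeg.comp hsm
  -- The weight `e^{-s}` depends only on the past and yields the lower bound for the cross term of
  -- the square.
  have hmain := hR.le_lintegral_expNeg_adjustedWindow hα (k := n) (l := 1) ENNReal.one_ne_top
    (a := fun _ => 0) (b := s) (g := fun ω => expNeg (s ω)) measurable_const hsb
    (measurable_expNeg.comp hsb) (hR.ae_theta_lt_top hα (j + 1) n t)
  simp only [ENNReal.one_rpow, one_mul, tsub_zero] at hmain
  change ∫⁻ ω, expNeg (s ω) * expNeg (s ω) ∂P ≤ ∫⁻ ω, expNeg (s ω) * expNeg (u ω) ∂P at hmain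
  have hn' : ∫⁻ ω, expNeg (u ω) * expNeg (u ω) ∂P ≤
      ∫⁻ ω, expNeg (s ω) * expNeg (s ω) ∂P + ENNReal.ofReal ε := by
    simp_rw [← expNeg_add, ← two_mul]
    exact hn
  have hfin : ∫⁻ ω, expNeg (s ω) * expNeg (u ω) ∂P ≠ ∞ := by
    simp_rw [← expNeg_add]
    exact ((lintegral_expNeg_le_one _).trans_lt ENNReal.one_lt_top).ne
  have hsum : ∫⁻ ω, ENNReal.ofReal (((expNeg (u ω)).toReal - (expNeg (s ω)).toReal) ^ 2) ∂P +
      2 * ∫⁻ ω, expNeg (s ω) * expNeg (u ω) ∂P =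
      ∫⁻ ω, expNeg (u ω) * expNeg (u ω) ∂P + ∫⁻ ω, expNeg (s ω) * expNeg (s ω) ∂P := by
    have hsu : Measurable fun ω => expNeg (s ω) * expNeg (u ω) := hses.mul hues
    have hss : Measurable fun ω => expNeg (s ω) * expNeg (s ω) := hses.mul hses
    rw [← lintegral_const_mul _ hsu, ← lintegral_add_right _ (hsu.const_mul _),
      ← lintegral_add_right _ hss]
    refine lintegral_congr fun ω => ?_
    rw [mul_comm (expNeg (s ω)) (expNeg (u ω))]
    exact ofReal_sq_sub_add _ _ (expNeg_ne_top _) (expNeg_ne_top _)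
  have hle : ∫⁻ ω, ENNReal.ofReal (((expNeg (u ω)).toReal - (expNeg (s ω)).toReal) ^ 2) ∂P +
      2 * ∫⁻ ω, expNeg (s ω) * expNeg (u ω) ∂P ≤
      ENNReal.ofReal ε + 2 * ∫⁻ ω, expNeg (s ω) * expNeg (u ω) ∂P := by
    rw [hsum]
    calc _ ≤ ∫⁻ ω, expNeg (s ω) * expNeg (s ω) ∂P + ENNReal.ofReal ε +
          ∫⁻ ω, expNeg (s ω) * expNeg (s ω) ∂P := by gcongr
      _ = ENNReal.ofReal ε + 2 * ∫⁻ ω, expNeg (s ω) * expNeg (s ω) ∂P := by ring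
      _ ≤ _ := by gcongr
  exact (ENNReal.add_le_add_iff_right (ENNReal.mul_ne_top (by simp) hfin)).1 hle

/-- The clock compositions converge in probability at each fixed time. -/
theorem tendstoInMeasure_theta (hR : IsRandomInput P α R) (hα : IsParameter α) (j : ℕ)
    (t : ℝ≥0) :
    TendstoInMeasure P (fun (n : ℕ) ω => (theta (R ω) (j + 1) n t).toReal) atTop
      (fun ω => (limitWindow α (R ω) j 0 t).toReal) := by
  set u : ℕ → Ω → ℝ≥0∞ := fun n ω => adjustedWindow α (R ω) n 0 (theta (R ω) (j + 1) n t) with hu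
  set s : ℕ → Ω → ℝ≥0∞ := fun n ω => theta (R ω) (j + 1) n t with hs
  have hsm : ∀ n, Measurable (s n) := fun n => measurable_theta (hR.measurableUpTo n) (j + 1) t
  have hum : ∀ n, Measurable (u n) := fun n => measurable_windowSum (hR.measurable_σ _)
    (hR.measurable_T _) (jointlyMeasurable_X (hR.measurableUpTo n) le_rfl)
    (fun y => ((measurable_subtreeLimit α R y).mono (hR.blocks_le _) le_rfl).mul
      (hR.measurable_γ _ y).ennreal_ofReal) measurable_const (hsm n)
  set d : ℕ → Ω → ℝ := fun n ω => (expNeg (u n ω)).toReal - (expNeg (s n ω)).toReal with hd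
  have hdm : ∀ n, Measurable (d n) := fun n =>
    (measurable_expNeg.comp (hum n)).ennreal_toReal.sub
      (measurable_expNeg.comp (hsm n)).ennreal_toReal
  have hL2 : Tendsto (fun n => ∫⁻ ω, ENNReal.ofReal (d n ω ^ 2) ∂P) atTop (𝓝 0) := by
    rw [ENNReal.tendsto_nhds_zero]
    intro ε hε
    obtain ⟨x, hx0, hxε⟩ := ENNReal.lt_iff_exists_nnreal_btwn.1 hε
    have hx : (0 : ℝ) < x := by exact_mod_cast hx0
    filter_upwards [hR.eventually_lintegral_sq_le hα j t hx] with n hn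
    refine hn.trans ?_
    rw [ENNReal.ofReal_coe_nnreal]
    exact hxε.le
  have hdmeas : TendstoInMeasure P d atTop 0 := by
    refine tendstoInMeasure_of_tendsto_eLpNorm (p := 2) two_ne_zero
      (fun n => (hdm n).aestronglyMeasurable) aestronglyMeasurable_const ?_
    have h := (ENNReal.continuous_rpow_const (y := (1 / 2 : ℝ))).tendsto 0 |>.comp hL2
    rw [ENNReal.zero_rpow_of_pos (by norm_num)] at h
    refine h.congr fun n => ?_
    rw [sub_zero, eLpNorm_eq_lintegral_rpow_enorm_toReal two_ne_zero ENNReal.ofNat_ne_top]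
    simp only [Function.comp_apply, ENNReal.toReal_ofNat]
    congr 1
    refine lintegral_congr fun ω => ?_
    rw [Real.enorm_eq_ofReal_abs, ENNReal.ofReal_rpow_of_nonneg (abs_nonneg _) (by norm_num),
      Real.rpow_two, sq_abs]
  have hu_tendsto : ∀ᵐ ω ∂P, Tendsto (fun n => u n ω) atTop (𝓝 (limitWindow α (R ω) j 0 t)) := by
    filter_upwards [hR.ae_tendsto_thetaTilde hα j t, hR.ae_σ_pos, hR.ae_W_eq] with ω h hpos hW
    refine ((tendsto_add_atTop_iff_nat 1).2 h).congr fun n => ?_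
    exact thetaTilde_succ_eq hpos hW (j + 1) n t
  -- Subsequence criterion: along a further subsequence the difference of exponentials vanishes
  -- a.s., and the adjusted exponentials converge a.s. along the full sequence.
  rw [exists_seq_tendstoInMeasure_atTop_iff fun n => (hsm n).ennreal_toReal.aestronglyMeasurable]
  intro ns hns
  obtain ⟨ns', hns', h⟩ :=
    (exists_seq_tendstoInMeasure_atTop_iff fun n => (hdm n).aestronglyMeasurable).1 hdmeas ns hns
  refine ⟨ns', hns', ?_⟩
  filter_upwards [h, hu_tendsto, hR.ae_limitWindow_lt_top hα j 0 t] with ω h1 h2 h3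
  rw [ENNReal.coe_zero] at h3
  have hsub : Tendsto (fun i => ns (ns' i)) atTop atTop :=
    hns.tendsto_atTop.comp hns'.tendsto_atTop
  have h4 : Tendsto (fun i => (expNeg (u (ns (ns' i)) ω)).toReal) atTop
      (𝓝 (expNeg (limitWindow α (R ω) j 0 t)).toReal) :=
    (ENNReal.tendsto_toReal (expNeg_ne_top _)).comp
      (((continuous_expNeg.tendsto _).comp h2).comp hsub)
  have h5 : Tendsto (fun i => (expNeg (s (ns (ns' i)) ω)).toReal) atTop
      (𝓝 (expNeg (limitWindow α (R ω) j 0 t)).toReal) := by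
    have := h4.sub h1
    simp only [Pi.zero_apply, sub_zero] at this
    refine this.congr fun i => ?_
    simp [hd]
  rw [ENNReal.tendsto_toReal_iff (fun i => expNeg_ne_top _) (expNeg_ne_top _),
    tendsto_expNeg_iff] at h5
  exact (ENNReal.tendsto_toReal h3.ne).comp h5

end IsRandomInput

end KTree

end

/-! ### The finite dimensional convergence -/

theorem mainTheorem8 {Ω : Type*} [MeasurableSpace Ω] (P : Measure Ω) [IsProbabilityMeasure P]
    (α : ℕ → ℝ) (hα : KTree.IsParameter α) (hsum : Summable fun k : ℕ => 1 - α (k + 1))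
    (R : Ω → KTree.Input) (hR : KTree.IsRandomInput P α R)
    (k : ℕ) (hk : 1 ≤ k) (D : Set ℝ≥0) (hDcount : D.Countable) (hDdense : Dense D)
    (t : ℝ≥0) (ht : 0 < t) :
    (∀ n, k ≤ n → ∀ᵐ ω ∂P, KTree.theta (R ω) k n t < ∞) ∧
    (∀ᵐ ω ∂P, KTree.thetaInf α (R ω) D k t < ∞) ∧
    TendstoInMeasure P (fun (n : ℕ) ω => (KTree.theta (R ω) k n t).toReal) atTop
      (fun ω => (KTree.thetaInf α (R ω) D k t).toReal) := by
  obtain ⟨j, rfl⟩ : ∃ j, k = j + 1 := ⟨k - 1, by omega⟩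
  have hlim := hR.ae_thetaInf_eq hα j hDdense t
  refine ⟨fun n _ => hR.ae_theta_lt_top hα (j + 1) n t, ?_, ?_⟩
  · filter_upwards [hlim, hR.ae_limitWindow_lt_top hα j 0 t] with ω h1 h2
    rw [h1]
    exact h2
  · refine (hR.tendstoInMeasure_theta hα j t).congr_right ?_
    filter_upwards [hlim] with ω h
    rw [h]
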